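/- Let $M$ be a smooth manifold and let $A\to M$ be a smooth (real or complex) vector bundle of rank $n$ such that $A$ and its dual $A^*$ both carry Lie algebroid structures (in the complex case anchors take values in $TM\otimes\mathbb{C}$ and $C^\infty(M)$ means $C^\infty(M,\mathbb{C})$). Let $[\cdot,\cdot]$ be the Schouten bracket on $\Gamma(\wedge^\bullet A)$ extending the bracket of $\Gamma(A)$, with $[X,f]=\rho(X)f$ for $X\in\Gamma(A)$, $f\in C^\infty(M)$, where $\rho$ is the anchor of $A$, and with $$[u,v]=-(-1)^{(k-1)(l-1)}[v,u],\qquad [u,v\wedge w]=[u,v]\wedge w+(-1)^{(k-1)l}\,v\wedge[u,w]$$ for $u\in\Gamma(\wedge^kA)$, $v\in\Gamma(\wedge^lA)$, $w\in\Gamma(\wedge A)$. Let $d:\Gamma(\wedge^\bullet A^*)\to\Gamma(\wedge^{\bullet+1}A^*)$ and $d_*:\Gamma(\wedge^\bullet A)\to\Gamma(\wedge^{\bullet+1}A)$ be the differentials of the Lie algebroids $A$ and $A^*$, given by the Cartan formula. Assume that $(A,A^*)$ is a Lie bialgebroid, i.e. that $d_*$ is a derivation of degree $1$ of the Gerstenhaber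 algebra $(\Gamma(\wedge^\bullet A),\wedge,[\cdot,\cdot])$: besides the Leibniz rule for $\wedge$, $$d_*[u,v]=[d_*u,v]+(-1)^{k-1}[u,d_*v],\qquad u\in\Gamma(\wedge^kA),\ v\in\Gamma(\wedge A).$$ Assume that there is a nowhere vanishing section $\Omega\in\Gamma(\wedge^nA^*)$, and fix one. Let $\Omega^\sharp:\wedge^kA\to\wedge^{n-k}A^*$ be the isomorphism $u\mapsto i_u\Omega$, where $i_{X_1\wedge\cdots\wedge X_k}=i_{X_k}\circ\cdots\circ i_{X_1}$, and let $\partial:\Gamma(\wedge^kA)\to\Gamma(\wedge^{k-1}A)$ be the operator determined by $$\Omega^\sharp(\partial u)=(-1)^k\,d(\Omega^\sharp u),\qquad u\in\Gamma(\wedge^kA).$$ Then the Laplacian $\Delta=d_*\partial+\partial d_*$ is a derivation of degree $0$ of the Gerstenhaber algebra $\Gamma(\wedge^\bullet A)$: it is a linear map $\Gamma(\wedge^kA)\to\Gamma(\wedge^kA)$ for every $k$, and for all $u,v\in\Gamma(\wedge A)$ $$\Delta(u\wedge v)=\Delta u\wedge v+u\wedge\Delta v,\qquad \Delta[u,v]=[\Delta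 u,v]+[u,\Delta v].$$ -/

import Mathlib

open scoped Manifold ContDiff Bundle TensorProduct

noncomputable section

namespace LieBialg

/-! ### Smooth functions, sections of a vector bundle and of its dual

`𝕜` is `ℝ` or `ℂ`; `M` is a real smooth manifold of dimension `m`; vector bundles over `M` are
real (`𝕜 = ℝ`) or complex (`𝕜 = ℂ`). -/

section Functions

variable (𝕜 : Type*) [RCLike 𝕜] (m : ℕ) (M : Type*) [TopologicalSpace M]
  [ChartedSpace (EuclideanSpace ℝ (Fin m)) M]

/-- The algebra `C^∞(M)` of smooth `𝕜`-valued functions on the real manifold `M`. -/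
def smoothFun : Subalgebra 𝕜 (M → 𝕜) where
  carrier := {f | ContMDiff (𝓡 m) 𝓘(ℝ, 𝕜) ∞ f}
  mul_mem' := by
    intro f g hf hg
    exact (contDiff_mul (𝕜 := ℝ) (𝔸 := 𝕜)).contMDiff.comp (hf.prodMk_space hg)
  add_mem' := by
    intro f g hf hg
    exact hf.add hg
  algebraMap_mem' := fun _ => contMDiff_const

variable {𝕜 m M}

/-- The derivative `v f` of a function `f : M → 𝕜` along a tangent vector `v ∈ 𝕜 ⊗ T_xM`
(for `𝕜 = ℝ` this is `T_xM`, for `𝕜 = ℂ` it is the complexified tangent space). -/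
def vecDeriv {x : M} (v : 𝕜 ⊗[ℝ] TangentSpace (𝓡 m) x) (f : M → 𝕜) : 𝕜 :=
  let df : TangentSpace (𝓡 m) x →L[ℝ] 𝕜 := mfderiv (𝓡 m) 𝓘(ℝ, 𝕜) f x
  LinearMap.liftBaseChange 𝕜 df.toLinearMap v

end Functions

section Bundles

variable {𝕜 : Type*} [RCLike 𝕜] {m : ℕ} {M : Type*} [TopologicalSpace M]
  [ChartedSpace (EuclideanSpace ℝ (Fin m)) M]

/-- The `C^∞(M)`-module `Γ(A)` of smooth sections of a smooth vector bundle `A` with model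
fibre `F`. -/
def sections (𝕜 : Type*) [RCLike 𝕜] (m : ℕ) (F : Type*) [NormedAddCommGroup F]
    [NormedSpace ℝ F] [NormedSpace 𝕜 F] [IsScalarTower ℝ 𝕜 F] {M : Type*} [TopologicalSpace M]
    [ChartedSpace (EuclideanSpace ℝ (Fin m)) M]
    (A : M → Type*) [TopologicalSpace (Bundle.TotalSpace F A)]
    [∀ x, AddCommGroup (A x)] [∀ x, Module ℝ (A x)] [∀ x, Module 𝕜 (A x)]
    [∀ x, TopologicalSpace (A x)] [FiberBundle F A]
    [VectorBundle ℝ F A] [VectorBundle 𝕜 F A] :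
    Submodule (smoothFun 𝕜 m M) (∀ x, A x) where
  carrier := {s | ContMDiff (𝓡 m) ((𝓡 m).prod 𝓘(ℝ, F)) ∞
    (fun x => Bundle.TotalSpace.mk' F x (s x))}
  add_mem' := by
    intro s t hs ht
    exact ContMDiff.add_section hs ht
  zero_mem' := Bundle.contMDiff_zeroSection ℝ A
  smul_mem' := by
    intro f s hs x₀
    have hs := hs x₀
    rw [Bundle.contMDiffAt_section] at hs ⊢
    set e := trivializationAt F A x₀
    have hf : ContMDiffAt (𝓡 m) 𝓘(ℝ, 𝕜) ∞ (f : M → 𝕜) x₀ := f.2 x₀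
    have h : ContMDiffAt (𝓡 m) 𝓘(ℝ, F) ∞
        (fun x => (f : M → 𝕜) x • (e ⟨x, s x⟩).2) x₀ :=
      ((contDiff_smul (𝕜 := ℝ) (𝕜' := 𝕜) (F := F)).contMDiff.contMDiffAt).comp x₀
        (hf.prodMk_space hs)
    refine h.congr_of_eventuallyEq ?_
    filter_upwards [e.open_baseSet.mem_nhds
      (FiberBundle.mem_baseSet_trivializationAt' (F := F) (E := A) x₀)] with x hx
    exact (e.linear 𝕜 hx).2 ((f : M → 𝕜) x) (s x)

/-- Given the smooth sections `Γ` of a vector bundle with fibres `V x`, the smooth sections of the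
dual bundle: those `θ` whose pairing with every smooth section is a smooth function. -/
def dualSections {V : M → Type*} [∀ x, AddCommGroup (V x)] [∀ x, Module 𝕜 (V x)]
    (Γ : Submodule (smoothFun 𝕜 m M) (∀ x, V x)) :
    Submodule (smoothFun 𝕜 m M) (∀ x, Module.Dual 𝕜 (V x)) where
  carrier := {θ | ∀ X ∈ Γ, (fun x => θ x (X x)) ∈ smoothFun 𝕜 m M}
  add_mem' := fun hs ht X hX => add_mem (hs X hX) (ht X hX)
  zero_mem' := fun _ _ => zero_mem _
  smul_mem' := fun f _ hs X hX => mul_mem f.2 (hs X hX)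

/-! ### Lie algebroids -/

/-- A Lie algebroid structure on a vector bundle with fibres `V x` and smooth sections `Γ`:
an anchor `V → 𝕜 ⊗ TM` (a smooth bundle map, i.e. smooth sections differentiate smooth functions
to smooth functions) and a Lie bracket on `Γ`, such that the anchor is a homomorphism to vector
fields and the Leibniz rule holds. Vector fields are compared by their action on functions. -/
structure LieAlgebroid {V : M → Type*} [∀ x, AddCommGroup (V x)] [∀ x, Module 𝕜 (V x)]
    (Γ : Submodule (smoothFun 𝕜 m M) (∀ x, V x)) where
  anchor : ∀ x, V x →ₗ[𝕜] 𝕜 ⊗[ℝ] TangentSpace (𝓡 m) x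
  bracket : Γ →ₗ[𝕜] Γ →ₗ[𝕜] Γ
  anchor_smooth : ∀ X : Γ, ∀ f ∈ smoothFun 𝕜 m M,
    (fun x => vecDeriv (anchor x (X.1 x)) f) ∈ smoothFun 𝕜 m M
  bracket_self : ∀ X : Γ, bracket X X = 0
  jacobi : ∀ X Y Z : Γ,
    bracket X (bracket Y Z) = bracket (bracket X Y) Z + bracket Y (bracket X Z)
  anchor_bracket : ∀ X Y : Γ, ∀ f ∈ smoothFun 𝕜 m M, ∀ x,
    vecDeriv (anchor x ((bracket X Y).1 x)) f =
      vecDeriv (anchor x (X.1 x)) (fun y => vecDeriv (anchor y (Y.1 y)) f) -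
      vecDeriv (anchor x (Y.1 x)) (fun y => vecDeriv (anchor y (X.1 y)) f)
  leibniz : ∀ (X Y : Γ) (f : smoothFun 𝕜 m M) (x : M),
    (bracket X ⟨fun y => f.1 y • Y.1 y, Γ.smul_mem f Y.2⟩).1 x =
      vecDeriv (anchor x (X.1 x)) f.1 • Y.1 x + f.1 x • (bracket X Y).1 x

/-- The derivative `ρ(X) f` of a function `f` along the anchor of a section `X`. -/
def LieAlgebroid.act {V : M → Type*} [∀ x, AddCommGroup (V x)] [∀ x, Module 𝕜 (V x)]
    {Γ : Submodule (smoothFun 𝕜 m M) (∀ x, V x)} (L : LieAlgebroid Γ) (X : Γ) (f : M → 𝕜) :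
    M → 𝕜 :=
  fun x => vecDeriv (L.anchor x (X.1 x)) f

/-! ### Sections of exterior algebra bundles -/

/-- Evaluation of `α ∈ ⋀W` on a list of linear forms on `W`, by iterated contraction:
`α(θ, θ₁, …) = (i_θ α)(θ₁, …)`, and on the empty list the degree-zero component of `α`.
On a list of length `k` only the component of `α` of degree `k` contributes, and
`(w₁ ∧ ⋯ ∧ w_k)(θ₁, …, θ_k) = det (θ_i(w_j))`. -/
def evalList {W : Type*} [AddCommGroup W] [Module 𝕜 W] :
    List (Module.Dual 𝕜 W) → ExteriorAlgebra 𝕜 W → 𝕜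
  | [], α => ExteriorAlgebra.algebraMapInv α
  | θ :: l, α => evalList l (CliffordAlgebra.contractLeft (Q := (0 : QuadraticForm 𝕜 W)) θ α)

section Pairing

variable {V W : M → Type*} [∀ x, AddCommGroup (V x)] [∀ x, Module 𝕜 (V x)]
  [∀ x, AddCommGroup (W x)] [∀ x, Module 𝕜 (W x)]
  {Γ : Submodule (smoothFun 𝕜 m M) (∀ x, V x)}

/-- The function `α(X₁, …, X_k)` on `M`, where `α` is a section of `⋀W`, the `X_i` are sections
of `V`, and `V` is paired with `W` by `pair`. -/
def evalOn (pair : ∀ x, V x →ₗ[𝕜] Module.Dual 𝕜 (W x)) (α : ∀ x, ExteriorAlgebra 𝕜 (W x))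
    (Xs : List Γ) : M → 𝕜 :=
  fun x => evalList (Xs.map fun X => pair x (X.1 x)) (α x)

/-- Smoothness of a section `α` of `⋀W`, for `W` dual to `V`: all functions `α(X₁, …, X_k)`
with `X_i` smooth sections of `V` are smooth. -/
def IsSmoothVia (Γ : Submodule (smoothFun 𝕜 m M) (∀ x, V x))
    (pair : ∀ x, V x →ₗ[𝕜] Module.Dual 𝕜 (W x)) (α : ∀ x, ExteriorAlgebra 𝕜 (W x)) : Prop :=
  ∀ Xs : List Γ, evalOn pair α Xs ∈ smoothFun 𝕜 m M

/-- The right-hand side of the Cartan formula for `(dα)(X₀, …, X_k)`: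
`∑ᵢ (-1)ⁱ ρ(X_i) α(…, X̂_i, …) + ∑_{i<j} (-1)^{i+j} α([X_i, X_j], …, X̂_i, …, X̂_j, …)`.
For the empty list it is zero: `dα` has no component of degree zero. -/
def cartan (L : LieAlgebroid Γ) (pair : ∀ x, V x →ₗ[𝕜] Module.Dual 𝕜 (W x))
    (α : ∀ x, ExteriorAlgebra 𝕜 (W x)) (Xs : List Γ) : M → 𝕜 :=
  ∑ i : Fin Xs.length, (-1 : 𝕜) ^ (i : ℕ) •
      L.act (Xs.get i) (evalOn pair α (Xs.eraseIdx i)) +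
  ∑ i : Fin Xs.length, ∑ j ∈ Finset.Ioi i, (-1 : 𝕜) ^ ((i : ℕ) + (j : ℕ)) •
      evalOn pair α (L.bracket (Xs.get i) (Xs.get j) :: (Xs.eraseIdx j).eraseIdx i)

/-- `D` is the Lie algebroid differential `Γ(⋀W) → Γ(⋀W)`, `W = V*`: it is given by the Cartan
formula (which determines `D α` for every smooth `α`). -/
def IsDifferential (L : LieAlgebroid Γ) (pair : ∀ x, V x →ₗ[𝕜] Module.Dual 𝕜 (W x))
    (D : (∀ x, ExteriorAlgebra 𝕜 (W x)) → (∀ x, ExteriorAlgebra 𝕜 (W x))) : Prop :=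
  ∀ α, IsSmoothVia Γ pair α → ∀ Xs : List Γ, evalOn pair (D α) Xs = cartan L pair α Xs

open Classical in
/-- The Lie algebroid differential of `V`, acting on sections of `⋀W`, `W = V*`. -/
def differential (L : LieAlgebroid Γ) (pair : ∀ x, V x →ₗ[𝕜] Module.Dual 𝕜 (W x)) :
    (∀ x, ExteriorAlgebra 𝕜 (W x)) → (∀ x, ExteriorAlgebra 𝕜 (W x)) :=
  if h : ∃ D, IsDifferential L pair D then h.choose else 0

end Pairing

/-- The section `α` of `⋀W` is a section of `⋀^k W`. -/
def HasDeg {W : M → Type*} [∀ x, AddCommGroup (W x)] [∀ x, Module 𝕜 (W x)]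
    (k : ℕ) (α : ∀ x, ExteriorAlgebra 𝕜 (W x)) : Prop :=
  ∀ x, α x ∈ ⋀[𝕜]^k (W x)

/-- A function, as a section of `⋀⁰W`. -/
def ofFun {W : M → Type*} [∀ x, AddCommGroup (W x)] [∀ x, Module 𝕜 (W x)] (f : M → 𝕜) :
    ∀ x, ExteriorAlgebra 𝕜 (W x) :=
  fun x => algebraMap 𝕜 _ (f x)

/-- A section of `W`, as a section of `⋀¹W`. -/
def ofSec {W : M → Type*} [∀ x, AddCommGroup (W x)] [∀ x, Module 𝕜 (W x)] (X : ∀ x, W x) :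
    ∀ x, ExteriorAlgebra 𝕜 (W x) :=
  fun x => ExteriorAlgebra.ι 𝕜 (X x)

section Pair

variable {V : M → Type*} [∀ x, AddCommGroup (V x)] [∀ x, Module 𝕜 (V x)]
  {Γ : Submodule (smoothFun 𝕜 m M) (∀ x, V x)}

/-- `u ∈ Γ(⋀A)`: `u` is a smooth section of `⋀A`, where `Γ = Γ(A)`. -/
def IsMultivector (Γ : Submodule (smoothFun 𝕜 m M) (∀ x, V x))
    (u : ∀ x, ExteriorAlgebra 𝕜 (V x)) : Prop :=
  IsSmoothVia (dualSections Γ) (fun _ => LinearMap.id) u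

/-- `α ∈ Γ(⋀A*)`: `α` is a smooth section of `⋀A*`, where `Γ = Γ(A)`. -/
def IsForm (Γ : Submodule (smoothFun 𝕜 m M) (∀ x, V x))
    (α : ∀ x, ExteriorAlgebra 𝕜 (Module.Dual 𝕜 (V x))) : Prop :=
  IsSmoothVia Γ (fun x => Module.Dual.eval 𝕜 (V x)) α

/-- The differential `d : Γ(⋀A*) → Γ(⋀A*)` of the Lie algebroid `A`. -/
def dA (L : LieAlgebroid Γ) :
    (∀ x, ExteriorAlgebra 𝕜 (Module.Dual 𝕜 (V x))) →
      (∀ x, ExteriorAlgebra 𝕜 (Module.Dual 𝕜 (V x))) :=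
  differential L (fun x => Module.Dual.eval 𝕜 (V x))

/-- The differential `d_* : Γ(⋀A) → Γ(⋀A)` of the Lie algebroid `A*`. -/
def dStar (L' : LieAlgebroid (dualSections Γ)) :
    (∀ x, ExteriorAlgebra 𝕜 (V x)) → (∀ x, ExteriorAlgebra 𝕜 (V x)) :=
  differential L' (fun _ => LinearMap.id)

/-! ### The Gerstenhaber algebra of a Lie algebroid -/

/-- `B` is the Schouten bracket on `Γ(⋀A)`: the `𝕜`-bilinear extension of the bracket of `Γ(A)`
with `[X, f] = ρ(X) f` and `[f, g] = 0` that is graded skew-symmetric and satisfies the graded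
Leibniz rule. (These properties determine `B` on smooth sections.) -/
structure IsSchouten (L : LieAlgebroid Γ)
    (B : (∀ x, ExteriorAlgebra 𝕜 (V x)) → (∀ x, ExteriorAlgebra 𝕜 (V x)) →
      (∀ x, ExteriorAlgebra 𝕜 (V x))) : Prop where
  smooth : ∀ u v, IsMultivector Γ u → IsMultivector Γ v → IsMultivector Γ (B u v)
  add_left : ∀ u u' v, IsMultivector Γ u → IsMultivector Γ u' → IsMultivector Γ v →
    B (u + u') v = B u v + B u' v
  add_right : ∀ u v v', IsMultivector Γ u → IsMultivector Γ v → IsMultivector Γ v' →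
    B u (v + v') = B u v + B u v'
  smul_left : ∀ (c : 𝕜) u v, IsMultivector Γ u → IsMultivector Γ v → B (c • u) v = c • B u v
  smul_right : ∀ (c : 𝕜) u v, IsMultivector Γ u → IsMultivector Γ v → B u (c • v) = c • B u v
  fun_fun : ∀ f ∈ smoothFun 𝕜 m M, ∀ g ∈ smoothFun 𝕜 m M, B (ofFun f) (ofFun g) = 0
  sec_fun : ∀ X : Γ, ∀ f ∈ smoothFun 𝕜 m M, B (ofSec X.1) (ofFun f) = ofFun (L.act X f)
  sec_sec : ∀ X Y : Γ, B (ofSec X.1) (ofSec Y.1) = ofSec (L.bracket X Y).1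
  skew : ∀ (k l : ℕ) (u v), IsMultivector Γ u → IsMultivector Γ v → HasDeg k u → HasDeg l v →
    B u v = -((-1 : 𝕜) ^ ((k + 1) * (l + 1)) • B v u)
  leibniz : ∀ (k l : ℕ) (u v w), IsMultivector Γ u → IsMultivector Γ v → IsMultivector Γ w →
    HasDeg k u → HasDeg l v →
    B u (v * w) = B u v * w + (-1 : 𝕜) ^ ((k + 1) * l) • (v * B u w)

open Classical in
/-- The Schouten bracket on `Γ(⋀A)`. -/
def schouten (L : LieAlgebroid Γ) :
    (∀ x, ExteriorAlgebra 𝕜 (V x)) → (∀ x, ExteriorAlgebra 𝕜 (V x)) →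
      (∀ x, ExteriorAlgebra 𝕜 (V x)) :=
  if h : ∃ B, IsSchouten L B then h.choose else 0

/-- `D` is a derivation of degree `p` of the Gerstenhaber algebra `(Γ(⋀A), ∧, [·,·])`: a linear
map `Γ(⋀^k A) → Γ(⋀^{k+p} A)` with
`D(u ∧ v) = Du ∧ v + (-1)^{pk} u ∧ Dv` and `D[u, v] = [Du, v] + (-1)^{p(k-1)} [u, Dv]`
for `u ∈ Γ(⋀^k A)`. -/
structure IsGerstenhaberDerivation (L : LieAlgebroid Γ) (p : ℕ)
    (D : (∀ x, ExteriorAlgebra 𝕜 (V x)) → (∀ x, ExteriorAlgebra 𝕜 (V x))) : Prop where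
  smooth : ∀ u, IsMultivector Γ u → IsMultivector Γ (D u)
  deg : ∀ (k : ℕ) (u), IsMultivector Γ u → HasDeg k u → HasDeg (k + p) (D u)
  add : ∀ u v, IsMultivector Γ u → IsMultivector Γ v → D (u + v) = D u + D v
  smul : ∀ (c : 𝕜) u, IsMultivector Γ u → D (c • u) = c • D u
  wedge : ∀ (k : ℕ) (u v), IsMultivector Γ u → IsMultivector Γ v → HasDeg k u →
    D (u * v) = D u * v + (-1 : 𝕜) ^ (p * k) • (u * D v)
  bracket : ∀ (k : ℕ) (u v), IsMultivector Γ u → IsMultivector Γ v → HasDeg k u →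
    D (schouten L u v) = schouten L (D u) v + (-1 : 𝕜) ^ (p * (k + 1)) • schouten L u (D v)

/-- The pair `(A, A*)` of Lie algebroids is a Lie bialgebroid: `d_*` is a degree 1 derivation of
the Gerstenhaber algebra `(Γ(⋀A), ∧, [·,·])`. -/
def IsLieBialgebroid (L : LieAlgebroid Γ) (L' : LieAlgebroid (dualSections Γ)) : Prop :=
  IsGerstenhaberDerivation L 1 (dStar L')

/-! ### The operator `∂` and the Laplacian -/

/-- Contraction of a form by a multivector, `i_{X₁ ∧ ⋯ ∧ X_k} = i_{X_k} ∘ ⋯ ∘ i_{X₁}`. -/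
def contract {E : Type*} [AddCommGroup E] [Module 𝕜 E] :
    ExteriorAlgebra 𝕜 E →ₐ[𝕜] (Module.End 𝕜 (ExteriorAlgebra 𝕜 (Module.Dual 𝕜 E)))ᵐᵒᵖ :=
  ExteriorAlgebra.lift 𝕜
    ⟨(MulOpposite.opLinearEquiv 𝕜
      (M := Module.End 𝕜 (ExteriorAlgebra 𝕜 (Module.Dual 𝕜 E)))).toLinearMap ∘ₗ
      (CliffordAlgebra.contractLeft (Q := (0 : QuadraticForm 𝕜 (Module.Dual 𝕜 E)))) ∘ₗ
        Module.Dual.eval 𝕜 E, by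
      intro X
      apply MulOpposite.unop_injective
      exact LinearMap.ext fun α => CliffordAlgebra.contractLeft_contractLeft _ _⟩

/-- The map `Ω♯ : ⋀A → ⋀A*`, `u ↦ i_u Ω`, in one fibre. -/
def sharp {E : Type*} [AddCommGroup E] [Module 𝕜 E]
    (Ω : ExteriorAlgebra 𝕜 (Module.Dual 𝕜 E)) (u : ExteriorAlgebra 𝕜 E) :
    ExteriorAlgebra 𝕜 (Module.Dual 𝕜 E) :=
  (contract (𝕜 := 𝕜) u).unop Ω

/-- The operator `∂` dual to `d` with respect to `Ω♯`: `Ω♯(∂u) = (-1)^k d(Ω♯ u)` for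
`u ∈ Γ(⋀^k A)`. Here `involute` is multiplication by `(-1)^k` in degree `k`, and `Ω♯` is
bijective on each fibre when `Ω` is a nowhere vanishing form of top degree. -/
def del (L : LieAlgebroid Γ) (Ω : ∀ x, ExteriorAlgebra 𝕜 (Module.Dual 𝕜 (V x)))
    (u : ∀ x, ExteriorAlgebra 𝕜 (V x)) : ∀ x, ExteriorAlgebra 𝕜 (V x) :=
  fun x => Function.invFun (sharp (Ω x))
    (dA L (fun y => sharp (Ω y) (CliffordAlgebra.involute (u y))) x)

/-- The Laplacian `Δ = d_* ∂ + ∂ d_*`. -/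
def laplacian (L : LieAlgebroid Γ) (L' : LieAlgebroid (dualSections Γ))
    (Ω : ∀ x, ExteriorAlgebra 𝕜 (Module.Dual 𝕜 (V x)))
    (u : ∀ x, ExteriorAlgebra 𝕜 (V x)) : ∀ x, ExteriorAlgebra 𝕜 (V x) :=
  dStar L' (del L Ω u) + del L Ω (dStar L' u)

end Pair

end Bundles

end LieBialg

end

/-!
Cartan's formula is equivalent to the recursion `i_X d = 𝓛_X - d i_X` on the number of arguments,
from which `d ∘ d = 0` and the rest of the Cartan calculus follow by induction. Transported to
multivectors by `Ω♯`, `d` becomes the operator `∂` of square zero, whose failure to be a derivation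
of the exterior product, `(-1)^k (∂(u ∧ v) - ∂u ∧ v) - u ∧ ∂v`, is bilinear and graded
skew-symmetric. The Cartan calculus shows that this bracket takes the values of the Schouten bracket
on functions and sections and is a derivation in its second argument; as functions and sections
generate `Γ(⋀A)` locally, it is the Schouten bracket. Since `d_*` is a derivation of the product and
of the bracket generated by `∂`, `Δ = d_* ∂ + ∂ d_*` is a derivation of the product, and since `Δ`
commutes with `∂`, it is a derivation of the bracket.
-/

noncomputable section

namespace LieBialg

/-! ### Cochains of a Lie–Rinehart algebra -/

section Cochains

/-- Cochains of all degrees at once: functions of finitely many arguments in `G`. A form of degree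
`k` is a cochain supported on lists of length `k`. -/
abbrev Cochain (R G : Type*) := List G → R

variable {R G : Type*} [CommRing R]

/-- Insertion of `X` into the first slot, `i_X`. -/
def ins (X : G) : Cochain R G →ₗ[R] Cochain R G := LinearMap.funLeft R R (List.cons X)

@[simp] lemma ins_apply (X : G) (Φ : Cochain R G) (l : List G) : ins X Φ l = Φ (X :: l) := rfl

variable [AddCommGroup G] [Module R G]

variable (R G) in
/-- The cochains that are `R`-linear in every slot and vanish when two neighbouring arguments
agree. -/
def altCochains : Submodule R (Cochain R G) where
  carrier := {Φ | ∀ p l, (∀ X Y, Φ (p ++ (X + Y) :: l) = Φ (p ++ X :: l) + Φ (p ++ Y :: l)) ∧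
    (∀ (f : R) X, Φ (p ++ (f • X) :: l) = f * Φ (p ++ X :: l)) ∧ ∀ X, Φ (p ++ X :: X :: l) = 0}
  add_mem' {Φ Ψ} hΦ hΨ p l := by
    simp only [Pi.add_apply, (hΦ p l).1, (hΦ p l).2.1, (hΦ p l).2.2, (hΨ p l).1, (hΨ p l).2.1,
      (hΨ p l).2.2, mul_add, add_zero, implies_true, and_true]
    exact fun X Y => add_add_add_comm ..
  zero_mem' p l := by simp
  smul_mem' c Φ hΦ p l := by
    simp only [Pi.smul_apply, smul_eq_mul, (hΦ p l).1, (hΦ p l).2.1, (hΦ p l).2.2, mul_add,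
      mul_zero, mul_left_comm, implies_true, and_self]

variable {Φ : Cochain R G}

lemma ins_mem_altCochains (hΦ : Φ ∈ altCochains R G) (X : G) : ins X Φ ∈ altCochains R G :=
  fun p => hΦ (X :: p)

lemma ins_add_left (hΦ : Φ ∈ altCochains R G) (X Y : G) : ins (X + Y) Φ = ins X Φ + ins Y Φ :=
  funext fun l => (hΦ [] l).1 X Y

lemma ins_smul_left (hΦ : Φ ∈ altCochains R G) (f : R) (X : G) : ins (f • X) Φ = f • ins X Φ :=
  funext fun l => (hΦ [] l).2.1 f X

lemma ins_ins_self (hΦ : Φ ∈ altCochains R G) (X : G) : ins X (ins X Φ) = 0 :=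
  funext fun l => (hΦ [] l).2.2 X

lemma ins_neg_left (hΦ : Φ ∈ altCochains R G) (X : G) : ins (-X) Φ = -ins X Φ := by
  simpa using ins_smul_left hΦ (-1) X

lemma ins_sub_left (hΦ : Φ ∈ altCochains R G) (X Y : G) : ins (X - Y) Φ = ins X Φ - ins Y Φ := by
  rw [sub_eq_add_neg, ins_add_left hΦ, ins_neg_left hΦ, sub_eq_add_neg]

lemma ins_zero_left (hΦ : Φ ∈ altCochains R G) : ins 0 Φ = 0 := by
  simpa using ins_smul_left hΦ 0 0

lemma ins_sum_left (hΦ : Φ ∈ altCochains R G) {ι : Type*} (s : Finset ι) (X : ι → G) :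
    ins (∑ i ∈ s, X i) Φ = ∑ i ∈ s, ins (X i) Φ := by
  induction s using Finset.cons_induction with
  | empty => simpa using ins_zero_left hΦ
  | cons i s hi ih => rw [Finset.sum_cons, Finset.sum_cons, ins_add_left hΦ, ih]

lemma ins_swap (hΦ : Φ ∈ altCochains R G) (X Y : G) : ins Y (ins X Φ) = -ins X (ins Y Φ) := by
  have h := ins_ins_self hΦ (X + Y)
  rw [ins_add_left hΦ, map_add, ins_add_left (ins_mem_altCochains hΦ X),
    ins_add_left (ins_mem_altCochains hΦ Y), ins_ins_self hΦ, ins_ins_self hΦ] at h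
  rw [eq_neg_iff_add_eq_zero]
  simpa using h

/-- Coinduction: it is enough to control the first two slots of a family of cochains stable under
insertion. -/
lemma mem_altCochains_of_coind (P : Cochain R G → Prop) (hins : ∀ Ψ X, P Ψ → P (ins X Ψ))
    (hadd : ∀ Ψ X Y, P Ψ → ins (X + Y) Ψ = ins X Ψ + ins Y Ψ)
    (hsmul : ∀ Ψ (f : R) X, P Ψ → ins (f • X) Ψ = f • ins X Ψ)
    (hself : ∀ Ψ X, P Ψ → ins X (ins X Ψ) = 0) (hΦ : P Φ) : Φ ∈ altCochains R G := by
  intro p l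
  induction p generalizing Φ with
  | nil =>
    exact ⟨fun X Y => congrFun (hadd Φ X Y hΦ) l, fun f X => congrFun (hsmul Φ f X hΦ) l,
      fun X => congrFun (hself Φ X hΦ) l⟩
  | cons X _ ih => exact ih (hins Φ X hΦ)

/-- The value of the exterior product with a linear form on a list of arguments; the recursion is
`i_X (θ ∧ Φ) = θ(X) Φ - θ ∧ i_X Φ`. -/
def wedgeAt (θ : G →ₗ[R] R) : List G → Cochain R G →ₗ[R] R
  | [] => 0
  | X :: l => θ X • LinearMap.proj l - wedgeAt θ l ∘ₗ ins X

/-- Exterior multiplication of a cochain by a linear form. -/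
def wedge (θ : G →ₗ[R] R) : Cochain R G →ₗ[R] Cochain R G := LinearMap.pi (wedgeAt θ)

@[simp] lemma wedge_nil (θ : G →ₗ[R] R) (Φ : Cochain R G) : wedge θ Φ [] = 0 := rfl

lemma ins_wedge (θ : G →ₗ[R] R) (X : G) (Φ : Cochain R G) :
    ins X (wedge θ Φ) = θ X • Φ - wedge θ (ins X Φ) := rfl

@[simp] lemma wedge_cons (θ : G →ₗ[R] R) (Φ : Cochain R G) (X : G) (l : List G) :
    wedge θ Φ (X :: l) = θ X * Φ l - wedge θ (ins X Φ) l := rfl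

lemma wedge_zero_left (Φ : Cochain R G) : wedge 0 Φ = 0 := by
  funext l
  induction l generalizing Φ with
  | nil => rfl
  | cons X l ih => simp [ih]

lemma wedge_mem_altCochains (θ : G →ₗ[R] R) (hΦ : Φ ∈ altCochains R G) :
    wedge θ Φ ∈ altCochains R G := by
  refine mem_altCochains_of_coind
    (fun Ψ => ∃ A ∈ altCochains R G, ∃ B ∈ altCochains R G, Ψ = A + wedge θ B)
    ?_ ?_ ?_ ?_ ⟨0, zero_mem _, Φ, hΦ, (zero_add _).symm⟩
  · rintro _ X ⟨A, hA, B, hB, rfl⟩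
    exact ⟨ins X A + θ X • B, add_mem (ins_mem_altCochains hA X) (Submodule.smul_mem _ _ hB),
      -ins X B, neg_mem (ins_mem_altCochains hB X), by rw [map_add, ins_wedge, map_neg]; abel⟩
  · rintro _ X Y ⟨A, hA, B, hB, rfl⟩
    simp only [map_add, ins_wedge, ins_add_left hA, ins_add_left hB, add_smul]
    abel
  · rintro _ f X ⟨A, hA, B, hB, rfl⟩
    simp only [map_add, ins_wedge, ins_smul_left hA, ins_smul_left hB, map_smul, smul_sub,
      smul_eq_mul, mul_smul, smul_add]
  · rintro _ X ⟨A, hA, B, hB, rfl⟩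
    simp only [map_add, map_sub, map_smul, ins_wedge, ins_ins_self hA, ins_ins_self hB, map_zero]
    abel

end Cochains

section Differential

variable {R G : Type*} [CommRing R] [LieRing G] [LieRingModule G R]

/-- The value of a Lie derivative on a list of arguments; the recursion is
`i_Y L_X = L_X i_Y - i_[X,Y]`. -/
def lieDerivAt (X : G) : List G → Cochain R G →+ R
  | [] => (LieRingModule.toEnd G R X).comp (Pi.evalAddMonoidHom _ [])
  | Y :: l => (lieDerivAt X l).comp (ins Y).toAddMonoidHom - Pi.evalAddMonoidHom _ (⁅X, Y⁆ :: l)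

/-- The Lie derivative `L_X` of a cochain. -/
def lieDeriv (X : G) : Cochain R G →+ Cochain R G := AddMonoidHom.pi (lieDerivAt X)

/-- The value of the differential on a list of arguments; the recursion is Cartan's magic formula
`i_X d = L_X - d i_X`. -/
def diffAt : List G → Cochain R G →+ R
  | [] => 0
  | X :: l => (Pi.evalAddMonoidHom _ l).comp (lieDeriv X) - (diffAt l).comp (ins X).toAddMonoidHom

/-- The Chevalley–Eilenberg differential of a cochain. -/
def diff : Cochain R G →+ Cochain R G := AddMonoidHom.pi diffAt

@[simp] lemma lieDeriv_nil (X : G) (Φ : Cochain R G) : lieDeriv X Φ [] = ⁅X, Φ []⁆ := rfl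

@[simp] lemma lieDeriv_cons (X Y : G) (Φ : Cochain R G) (l : List G) :
    lieDeriv X Φ (Y :: l) = lieDeriv X (ins Y Φ) l - Φ (⁅X, Y⁆ :: l) := rfl

lemma ins_lieDeriv (X Y : G) (Φ : Cochain R G) :
    ins Y (lieDeriv X Φ) = lieDeriv X (ins Y Φ) - ins ⁅X, Y⁆ Φ := rfl

@[simp] lemma diff_nil (Φ : Cochain R G) : diff Φ [] = 0 := rfl

@[simp] lemma diff_cons (Φ : Cochain R G) (X : G) (l : List G) :
    diff Φ (X :: l) = lieDeriv X Φ l - diff (ins X Φ) l := rfl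

lemma ins_diff (X : G) (Φ : Cochain R G) : ins X (diff Φ) = lieDeriv X Φ - diff (ins X Φ) := rfl

variable [Module R G] {Φ : Cochain R G}

lemma lieDeriv_add_left (hΦ : Φ ∈ altCochains R G) (X Y : G) :
    lieDeriv (X + Y) Φ = lieDeriv X Φ + lieDeriv Y Φ := by
  funext l
  induction l generalizing Φ with
  | nil => simp
  | cons Z l ih =>
    simp only [lieDeriv_cons, ih (ins_mem_altCochains hΦ Z), Pi.add_apply, add_lie,
      ← ins_apply _ Φ, ins_add_left hΦ]
    ring

lemma lieDeriv_lieDeriv_sub (hΦ : Φ ∈ altCochains R G) (X Y : G) :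
    lieDeriv X (lieDeriv Y Φ) - lieDeriv Y (lieDeriv X Φ) = lieDeriv ⁅X, Y⁆ Φ := by
  funext l
  induction l generalizing Φ with
  | nil => simp
  | cons Z l ih =>
    simp only [Pi.sub_apply, lieDeriv_cons, ins_lieDeriv, map_sub,
      ← ih (ins_mem_altCochains hΦ Z), lie_lie, ins_sub_left hΦ, ← ins_apply _ (lieDeriv _ Φ)]
    ring

lemma lieDeriv_eq_sum (hΦ : Φ ∈ altCochains R G) (X : G) (l : List G) :
    lieDeriv X Φ l = ⁅X, Φ l⁆ +
      ∑ j : Fin l.length, (-1) ^ ((j : ℕ) + 1) * Φ (⁅X, l.get j⁆ :: l.eraseIdx j) := by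
  induction l generalizing Φ with
  | nil => simp
  | cons Y l ih =>
    have hswap (j : Fin l.length) : ins Y Φ (⁅X, l.get j⁆ :: l.eraseIdx j) =
        -Φ (⁅X, l.get j⁆ :: Y :: l.eraseIdx j) :=
      congrFun (ins_swap hΦ Y ⁅X, l.get j⁆) _
    simp only [lieDeriv_cons, ih (ins_mem_altCochains hΦ Y), hswap, List.length_cons,
      Fin.sum_univ_succ]
    simp [pow_succ]
    ring

lemma diff_lieDeriv (hΦ : Φ ∈ altCochains R G) (X : G) :
    diff (lieDeriv X Φ) = lieDeriv X (diff Φ) := by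
  funext l
  induction l generalizing Φ with
  | nil => simp
  | cons Y l ih =>
    simp only [diff_cons, lieDeriv_cons, ins_lieDeriv, ins_diff, map_sub, Pi.sub_apply,
      ih (ins_mem_altCochains hΦ Y), ← lieDeriv_lieDeriv_sub hΦ X Y]
    ring

lemma diff_diff (hΦ : Φ ∈ altCochains R G) : diff (diff Φ) = 0 := by
  funext l
  induction l generalizing Φ with
  | nil => simp
  | cons X l ih =>
    simp only [diff_cons, ins_diff, map_sub, Pi.sub_apply, diff_lieDeriv hΦ,
      ih (ins_mem_altCochains hΦ X), Pi.zero_apply, sub_zero, sub_self]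

lemma diff_eq_sum (hΦ : Φ ∈ altCochains R G) (l : List G) :
    diff Φ l = ∑ i : Fin l.length, (-1) ^ (i : ℕ) * ⁅l.get i, Φ (l.eraseIdx i)⁆ +
      ∑ i : Fin l.length, ∑ j ∈ Finset.Ioi i, (-1) ^ ((i : ℕ) + (j : ℕ)) *
        Φ (⁅l.get i, l.get j⁆ :: (l.eraseIdx j).eraseIdx i) := by
  induction l generalizing Φ with
  | nil => simp
  | cons X l ih =>
    have hswap (i j : Fin l.length) :
        ins X Φ (⁅l.get i, l.get j⁆ :: (l.eraseIdx j).eraseIdx i) =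
          -Φ (⁅l.get i, l.get j⁆ :: X :: (l.eraseIdx j).eraseIdx i) :=
      congrFun (ins_swap hΦ X ⁅l.get i, l.get j⁆) _
    simp only [diff_cons, ih (ins_mem_altCochains hΦ X), lieDeriv_eq_sum hΦ, hswap,
      List.length_cons, Fin.sum_univ_succ, Fin.Ioi_zero_eq_map, Fin.Ioi_succ, Finset.sum_map]
    simp [pow_succ, pow_add, Finset.sum_neg_distrib]
    ring

lemma diff_apply_eq_zero (hΦ : Φ ∈ altCochains R G) {k : ℕ} (h : ∀ l, l.length ≠ k → Φ l = 0)
    {l : List G} (hl : l.length ≠ k + 1) : diff Φ l = 0 := by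
  have h₁ (i : Fin l.length) : Φ (l.eraseIdx i) = 0 := h _ <| by
    have := i.2
    rw [List.length_eraseIdx_of_lt i.2]
    lia
  have h₂ (i j : Fin l.length) (hij : i < j) :
      Φ (⁅l.get i, l.get j⁆ :: (l.eraseIdx j).eraseIdx i) = 0 := h _ <| by
    have hj := j.2
    have hi : i < (l.eraseIdx j).length := by
      rw [List.length_eraseIdx_of_lt hj]
      lia
    rw [List.length_cons, List.length_eraseIdx_of_lt hi, List.length_eraseIdx_of_lt hj]
    lia
  rw [diff_eq_sum hΦ, Finset.sum_eq_zero fun i _ => by rw [h₁, lie_zero, mul_zero], zero_add]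
  exact Finset.sum_eq_zero fun i _ => Finset.sum_eq_zero fun j hj => by
    rw [h₂ i j (Finset.mem_Ioi.mp hj), mul_zero]

variable [LieRinehartRing R G]

variable (G) in
/-- The differential of a function, as a linear form. -/
def diffFun (f : R) : G →ₗ[R] R where
  toFun X := ⁅X, f⁆
  map_add' X Y := add_lie X Y f
  map_smul' g X := LieRinehartRing.lie_smul_eq_mul g f X

@[simp] lemma diffFun_apply (f : R) (X : G) : diffFun G f X = ⁅X, f⁆ := rfl

lemma lieDeriv_smul (X : G) (f : R) (Φ : Cochain R G) :
    lieDeriv X (f • Φ) = f • lieDeriv X Φ + ⁅X, f⁆ • Φ := by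
  funext l
  induction l generalizing Φ with
  | nil => simp
  | cons Y l ih => simp only [lieDeriv_cons, map_smul, ih, Pi.add_apply, Pi.smul_apply, ins_apply,
      smul_eq_mul]; ring

lemma diff_smul (f : R) (Φ : Cochain R G) : diff (f • Φ) = f • diff Φ + wedge (diffFun G f) Φ := by
  funext l
  induction l generalizing Φ with
  | nil => simp
  | cons Y l ih => simp only [diff_cons, wedge_cons, map_smul, ih, Pi.add_apply, Pi.smul_apply,
      lieDeriv_smul, diffFun_apply, smul_eq_mul]; ring

lemma smul_lie_eq_sub (f : R) (X Y : G) : ⁅f • X, Y⁆ = f • ⁅X, Y⁆ - ⁅Y, f⁆ • X := by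
  rw [← lie_skew, LieRinehartRing.leibniz_smul_right, ← lie_skew X Y, smul_neg]; abel

lemma lieDeriv_smul_left (hΦ : Φ ∈ altCochains R G) (f : R) (X : G) :
    lieDeriv (f • X) Φ = f • lieDeriv X Φ + wedge (diffFun G f) (ins X Φ) := by
  funext l
  induction l generalizing Φ with
  | nil => simp
  | cons Z l ih =>
    simp only [lieDeriv_cons, ih (ins_mem_altCochains hΦ Z), Pi.add_apply, Pi.smul_apply,
      wedge_cons, diffFun_apply, ← ins_apply _ Φ, smul_lie_eq_sub, ins_sub_left hΦ,
      ins_smul_left hΦ, Pi.sub_apply, ins_swap hΦ Z X, map_neg, Pi.neg_apply, smul_eq_mul]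
    ring

lemma lieDeriv_mem_altCochains (hΦ : Φ ∈ altCochains R G) (X : G) :
    lieDeriv X Φ ∈ altCochains R G := by
  refine mem_altCochains_of_coind
    (fun Ψ => ∃ A ∈ altCochains R G, ∃ B ∈ altCochains R G, Ψ = A + lieDeriv X B)
    ?_ ?_ ?_ ?_ ⟨0, zero_mem _, Φ, hΦ, (zero_add _).symm⟩
  · rintro _ Y ⟨A, hA, B, hB, rfl⟩
    exact ⟨ins Y A - ins ⁅X, Y⁆ B, sub_mem (ins_mem_altCochains hA Y) (ins_mem_altCochains hB _),
      ins Y B, ins_mem_altCochains hB Y, by rw [map_add, ins_lieDeriv]; abel⟩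
  · rintro _ Y Z ⟨A, hA, B, hB, rfl⟩
    simp only [map_add, ins_lieDeriv, ins_add_left hA, ins_add_left hB, lie_add]
    abel
  · rintro _ f Y ⟨A, hA, B, hB, rfl⟩
    simp only [map_add, ins_lieDeriv, ins_smul_left hA, ins_smul_left hB, ins_add_left hB,
      lieDeriv_smul, LieRinehartRing.leibniz_smul_right, smul_sub, smul_add]
    abel
  · rintro _ Y ⟨A, hA, B, hB, rfl⟩
    simp only [map_add, map_sub, ins_lieDeriv, ins_ins_self hA, ins_ins_self hB,
      ins_swap hB Y ⁅X, Y⁆, map_zero]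
    abel

lemma diff_mem_altCochains (hΦ : Φ ∈ altCochains R G) : diff Φ ∈ altCochains R G := by
  refine mem_altCochains_of_coind
    (fun Ψ => ∃ A ∈ altCochains R G, ∃ B ∈ altCochains R G, Ψ = A + diff B)
    ?_ ?_ ?_ ?_ ⟨0, zero_mem _, Φ, hΦ, (zero_add _).symm⟩
  · rintro _ X ⟨A, hA, B, hB, rfl⟩
    exact ⟨ins X A + lieDeriv X B, add_mem (ins_mem_altCochains hA X)
      (lieDeriv_mem_altCochains hB X), -ins X B, neg_mem (ins_mem_altCochains hB X),
      by rw [map_add, ins_diff, map_neg]; abel⟩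
  · rintro _ X Y ⟨A, hA, B, hB, rfl⟩
    simp only [map_add, ins_diff, ins_add_left hA, ins_add_left hB, lieDeriv_add_left hB]
    abel
  · rintro _ f X ⟨A, hA, B, hB, rfl⟩
    simp only [map_add, ins_diff, ins_smul_left hA, ins_smul_left hB, diff_smul,
      lieDeriv_smul_left hB, smul_sub, smul_add]
    abel
  · rintro _ X ⟨A, hA, B, hB, rfl⟩
    simp only [map_add, map_sub, ins_diff, ins_lieDeriv, ins_ins_self hA, ins_ins_self hB,
      lie_self, ins_zero_left hB, map_zero]
    abel

end Differential

/-! ### The exterior algebra of one fibre -/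

section ExteriorAlgebra

open CliffordAlgebra hiding ι
open ExteriorAlgebra

variable {R W : Type*} [CommRing R] [AddCommGroup W] [Module R W]

/-- Contraction of elements of the exterior algebra with a linear form. -/
abbrev contr (θ : Module.Dual R W) : ExteriorAlgebra R W →ₗ[R] ExteriorAlgebra R W :=
  contractLeft (Q := (0 : QuadraticForm R W)) θ

lemma contr_ι_mul (θ : Module.Dual R W) (w : W) (α : ExteriorAlgebra R W) :
    contr θ (ι R w * α) = θ w • α - ι R w * contr θ α :=
  contractLeft_ι_mul ..

lemma contr_mul (θ : Module.Dual R W) (α β : ExteriorAlgebra R W) :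
    contr θ (α * β) = contr θ α * β + involute α * contr θ β := by
  induction α using CliffordAlgebra.left_induction with
  | algebraMap c =>
    rw [contractLeft_algebraMap_mul, contractLeft_algebraMap, AlgHom.commutes, zero_mul, zero_add]
  | add a b ha hb => simp only [add_mul, map_add, ha, hb]; abel
  | ι_mul a w ha =>
    change contr θ (ι R w * a * β) = contr θ (ι R w * a) * β + involute (ι R w * a) * _
    rw [mul_assoc, contr_ι_mul, contr_ι_mul, ha, map_mul, involute_ι]
    simp only [sub_mul, mul_add, smul_mul_assoc, mul_assoc, neg_mul]
    abel

lemma contr_involute (θ : Module.Dual R W) (α : ExteriorAlgebra R W) :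
    contr θ (involute α) = -involute (contr θ α) := by
  induction α using CliffordAlgebra.left_induction with
  | algebraMap c => simp only [AlgHom.commutes, contractLeft_algebraMap, map_zero, neg_zero]
  | add a b ha hb => simp only [map_add, ha, hb, neg_add]
  | ι_mul a w ha =>
    simp only [map_mul, involute_ι, neg_mul, map_neg, contractLeft_ι_mul, ha, map_sub, map_smul,
      mul_neg, sub_neg_eq_add]

lemma algebraMap_mem_exteriorPower (c : R) : algebraMap R (ExteriorAlgebra R W) c ∈ ⋀[R]^0 W := by
  rw [exteriorPower, pow_zero]
  exact Submodule.mem_one.2 ⟨c, rfl⟩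

lemma ι_mem_exteriorPower (w : W) : ι R w ∈ ⋀[R]^1 W := by
  rw [exteriorPower, pow_one]
  exact ⟨w, rfl⟩

lemma mul_mem_exteriorPower {k l : ℕ} {α β : ExteriorAlgebra R W} (hα : α ∈ ⋀[R]^k W)
    (hβ : β ∈ ⋀[R]^l W) : α * β ∈ ⋀[R]^(k + l) W :=
  SetLike.mul_mem_graded hα hβ

lemma ι_mul_mem_exteriorPower (w : W) {k : ℕ} {α : ExteriorAlgebra R W} (hα : α ∈ ⋀[R]^k W) :
    ι R w * α ∈ ⋀[R]^(k + 1) W := by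
  rw [add_comm]
  exact mul_mem_exteriorPower (ι_mem_exteriorPower w) hα

lemma exteriorPower_zero_eq_algebraMap {α : ExteriorAlgebra R W} (hα : α ∈ ⋀[R]^0 W) :
    ∃ c, algebraMap R _ c = α := by
  rwa [exteriorPower, pow_zero, Submodule.mem_one] at hα

lemma contr_eq_zero (θ : Module.Dual R W) {α : ExteriorAlgebra R W} (hα : α ∈ ⋀[R]^0 W) :
    contr θ α = 0 := by
  obtain ⟨c, rfl⟩ := exteriorPower_zero_eq_algebraMap hα
  exact contractLeft_algebraMap ..

lemma contr_mem (θ : Module.Dual R W) {k : ℕ} {α : ExteriorAlgebra R W}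
    (hα : α ∈ ⋀[R]^(k + 1) W) : contr θ α ∈ ⋀[R]^k W := by
  induction k generalizing α with
  | zero =>
    obtain ⟨w, rfl⟩ : ∃ w, ι R w = α := by simpa [exteriorPower] using hα
    rw [contractLeft_ι]
    exact algebraMap_mem_exteriorPower _
  | succ k ih =>
    rw [exteriorPower, pow_succ'] at hα
    refine Submodule.mul_induction_on hα ?_ fun x y hx hy => by
      rw [map_add]; exact add_mem hx hy
    rintro _ ⟨w, rfl⟩ b hb
    rw [contr_ι_mul]
    exact sub_mem (Submodule.smul_mem _ _ hb) (ι_mul_mem_exteriorPower w (ih hb))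

lemma involute_eq_smul {k : ℕ} {α : ExteriorAlgebra R W} (hα : α ∈ ⋀[R]^k W) :
    involute α = (-1 : R) ^ k • α := by
  induction hα using Submodule.pow_induction_on_left' with
  | algebraMap c => simp
  | add a b k _ _ ha hb => rw [map_add, ha, hb, smul_add]
  | mem_mul _ hm k a _ ha =>
    obtain ⟨w, rfl⟩ := hm
    rw [map_mul, ha, involute_ι, pow_succ, mul_neg_one, neg_smul, mul_smul_comm, neg_mul, smul_neg]

lemma algebraMapInv_ι_mul (w : W) (α : ExteriorAlgebra R W) : algebraMapInv (ι R w * α) = 0 := by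
  rw [map_mul, algebraMapInv, lift_ι_apply]
  simp

lemma algebraMapInv_eq_zero {k : ℕ} {α : ExteriorAlgebra R W} (hα : α ∈ ⋀[R]^(k + 1) W) :
    algebraMapInv α = 0 := by
  rw [exteriorPower, pow_succ'] at hα
  refine Submodule.mul_induction_on hα ?_ fun x y hx hy => by rw [map_add, hx, hy, add_zero]
  rintro _ ⟨w, rfl⟩ b -
  exact algebraMapInv_ι_mul w b

lemma ι_mul_eq_involute_mul (w : W) (α : ExteriorAlgebra R W) :
    ι R w * α = involute α * ι R w := by
  induction α using CliffordAlgebra.left_induction with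
  | algebraMap c => rw [AlgHom.commutes, Algebra.commutes]
  | add a b ha hb => rw [mul_add, ha, hb, map_add, add_mul]
  | ι_mul a v h =>
    calc ι R w * (ι R v * a) = -(ι R v * (ι R w * a)) := by
          rw [← mul_assoc, eq_neg_of_add_eq_zero_left (ι_add_mul_swap w v), neg_mul, mul_assoc]
      _ = involute (ι R v * a) * ι R w := by
          rw [h, map_mul, ← mul_assoc, ← neg_mul, ← neg_mul]
          exact congrArg (· * _ * _) (involute_ι v).symm

lemma mul_comm_of_involute {α β : ExteriorAlgebra R W} {k l : ℕ}
    (hα : involute α = (-1 : R) ^ k • α) (hβ : involute β = (-1 : R) ^ l • β) :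
    α * β = (-1 : R) ^ (k * l) • (β * α) := by
  have hpow (γ : ExteriorAlgebra R W) : α * γ = (involute ^ k : _ →ₐ[R] _) γ * α := by
    induction γ using ExteriorAlgebra.induction with
    | algebraMap c => rw [AlgHom.commutes, Algebra.commutes]
    | ι w =>
      have h : (involute ^ k : _ →ₐ[R] _) (ι R w) = (-1 : R) ^ k • ι R w := by
        clear hα
        induction k with
        | zero => simp
        | succ k ih =>
          rw [pow_succ', AlgHom.mul_apply, ih, map_smul, pow_succ, mul_smul, neg_one_smul]
          exact congrArg _ (involute_ι w)
      rw [h, smul_mul_assoc, ι_mul_eq_involute_mul, hα, smul_mul_assoc, smul_smul, ← mul_pow]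
      simp
    | mul a b ha hb => rw [map_mul, ← mul_assoc, ha, mul_assoc, hb, mul_assoc]
    | add a b ha hb => rw [mul_add, ha, hb, map_add, add_mul]
  have h : (involute ^ k : _ →ₐ[R] _) β = (-1 : R) ^ (k * l) • β := by
    clear hα hpow
    induction k with
    | zero => simp
    | succ k ih =>
      rw [pow_succ', AlgHom.mul_apply, ih, map_smul, hβ, smul_smul, ← pow_add, Nat.succ_mul]
  rw [hpow, h, smul_mul_assoc]

/-- The homogeneous component of degree `k`. -/
def component (k : ℕ) : ExteriorAlgebra R W →ₗ[R] ExteriorAlgebra R W :=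
  GradedAlgebra.proj (fun i : ℕ => ⋀[R]^i W) k

lemma component_mem (k : ℕ) (α : ExteriorAlgebra R W) : component k α ∈ ⋀[R]^k W := by
  rw [component, GradedAlgebra.proj_apply]
  exact SetLike.coe_mem _

lemma component_of_mem {k : ℕ} {α : ExteriorAlgebra R W} (hα : α ∈ ⋀[R]^k W) :
    component k α = α := by
  rw [component, GradedAlgebra.proj_apply]
  exact DirectSum.decompose_of_mem_same _ hα

lemma component_of_mem_ne {k j : ℕ} {α : ExteriorAlgebra R W} (hα : α ∈ ⋀[R]^k W) (hj : k ≠ j) :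
    component j α = 0 := by
  rw [component, GradedAlgebra.proj_apply]
  exact DirectSum.decompose_of_mem_ne _ hα hj

@[elab_as_elim]
lemma homogeneous_induction {C : ExteriorAlgebra R W → Prop}
    (add : ∀ a b, C a → C b → C (a + b)) (mem : ∀ k, ∀ a ∈ ⋀[R]^k W, C a)
    (a : ExteriorAlgebra R W) : C a := by
  induction a using DirectSum.Decomposition.inductionOn (fun i : ℕ => ⋀[R]^i W) with
  | zero => exact mem 0 0 (Submodule.zero_mem _)
  | add a b ha hb => exact add a b ha hb
  | homogeneous m => exact mem _ _ m.2

lemma component_zero (α : ExteriorAlgebra R W) :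
    component 0 α = algebraMap R _ (algebraMapInv α) := by
  induction α using homogeneous_induction with
  | add α β hα hβ => simp only [map_add, hα, hβ]
  | mem k α hα =>
    obtain _ | k := k
    · obtain ⟨c, rfl⟩ := exteriorPower_zero_eq_algebraMap hα
      rw [component_of_mem hα, algebraMap_leftInverse]
    · rw [component_of_mem_ne hα k.succ_ne_zero, algebraMapInv_eq_zero hα, map_zero]

lemma eq_zero_of_component {α : ExteriorAlgebra R W} (h : ∀ k, component k α = 0) : α = 0 :=
  (DirectSum.decompose fun i : ℕ => ⋀[R]^i W).injective <| DFinsupp.ext fun k =>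
    Subtype.ext <| (h k).trans <| by simp

lemma contr_component (θ : Module.Dual R W) (k : ℕ) (α : ExteriorAlgebra R W) :
    contr θ (component (k + 1) α) = component k (contr θ α) := by
  induction α using homogeneous_induction with
  | add a b ha hb => simp only [map_add, ha, hb]
  | mem j a h =>
    cases j with
    | zero => rw [component_of_mem_ne h k.succ_ne_zero.symm, contr_eq_zero θ h, map_zero, map_zero]
    | succ j =>
      rcases eq_or_ne j k with rfl | hj
      · rw [component_of_mem h, component_of_mem (contr_mem θ h)]
      · rw [component_of_mem_ne h (by simpa using hj), component_of_mem_ne (contr_mem θ h) hj,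
          map_zero]

section Basis

variable {I : Type*} [Fintype I] (b : Module.Basis I R W)

lemma sum_ι_mul_contr_coord {k : ℕ} {α : ExteriorAlgebra R W} (hα : α ∈ ⋀[R]^k W) :
    ∑ i, ι R (b i) * contr (b.coord i) α = (k : R) • α := by
  induction hα using Submodule.pow_induction_on_left' with
  | algebraMap c => simp
  | add a b k _ _ ha hb => simp only [map_add, mul_add, Finset.sum_add_distrib, ha, hb, smul_add]
  | mem_mul _ hm k a _ ha =>
    obtain ⟨w, rfl⟩ := hm
    have expand i : ι R (b i) * contr (b.coord i) (ι R w * a) =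
        ι R (b.repr w i • b i) * a + ι R w * (ι R (b i) * contr (b.coord i) a) := by
      rw [contr_ι_mul, mul_sub, mul_smul_comm, map_smul, smul_mul_assoc, ← mul_assoc, ← mul_assoc,
        eq_neg_of_add_eq_zero_left (ι_add_mul_swap (b i) w), neg_mul, sub_neg_eq_add]
      rfl
    simp only [expand, Finset.sum_add_distrib, ← Finset.mul_sum, ← Finset.sum_mul, ← map_sum, ha,
      b.sum_repr]
    rw [mul_smul_comm, Nat.cast_succ, add_smul, one_smul, add_comm]

end Basis

end ExteriorAlgebra

section FiniteDimensional

open CliffordAlgebra hiding ι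
open ExteriorAlgebra

variable {K W : Type*} [Field K] [AddCommGroup W] [Module K W] [FiniteDimensional K W]

lemma eq_zero_of_finrank_lt {k : ℕ} {α : ExteriorAlgebra K W} (hα : α ∈ ⋀[K]^k W)
    (hk : Module.finrank K W < k) : α = 0 := by
  have hrank : Module.finrank K (⋀[K]^k W) = 0 := by
    rw [exteriorPower.finrank_eq, Nat.choose_eq_zero_of_lt hk]
  have := Module.finrank_zero_iff.1 hrank
  exact congrArg Subtype.val (Subsingleton.elim (⟨α, hα⟩ : ⋀[K]^k W) 0)

lemma sum_component (α : ExteriorAlgebra K W) :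
    ∑ k ∈ Finset.range (Module.finrank K W + 1), component k α = α := by
  induction α using homogeneous_induction with
  | add α β hα hβ => simp only [map_add, Finset.sum_add_distrib, hα, hβ]
  | mem k α hα =>
    by_cases hk : Module.finrank K W < k
    · simp [eq_zero_of_finrank_lt hα hk]
    · rw [Finset.sum_eq_single_of_mem k (by simp; lia) fun j _ hj => component_of_mem_ne hα hj.symm,
        component_of_mem hα]

lemma one_mem_of_contr_mem [CharZero K] (S : Submodule K (ExteriorAlgebra K W))
    (hS : ∀ θ, ∀ α ∈ S, contr θ α ∈ S) {α : ExteriorAlgebra K W} (hα : α ∈ S) (hne : α ≠ 0) :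
    1 ∈ S := by
  obtain ⟨N, hN⟩ : ∃ N, ∀ k, N ≤ k → component k α = 0 :=
    ⟨_, fun k hk => eq_zero_of_finrank_lt (component_mem k α) (Nat.lt_of_succ_le hk)⟩
  let b := Module.finBasis K W
  induction N generalizing α with
  | zero => exact absurd (eq_zero_of_component fun k => hN k k.zero_le) hne
  | succ N ih =>
    by_cases hcontr : ∃ i, contr (b.coord i) α ≠ 0
    · obtain ⟨i, hi⟩ := hcontr
      refine ih (hS _ α hα) hi fun k hk => ?_
      rw [← contr_component, hN (k + 1) (Nat.succ_le_succ hk), map_zero]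
    · push Not at hcontr
      have hpos (k : ℕ) : component (k + 1) α = 0 := by
        have h := sum_ι_mul_contr_coord b (component_mem (k + 1) α)
        simp only [contr_component, hcontr, map_zero, mul_zero, Finset.sum_const_zero] at h
        exact (smul_eq_zero.1 h.symm).resolve_left (Nat.cast_ne_zero.2 k.succ_ne_zero)
      have hα₀ : component 0 α = α := sub_eq_zero.1 <| eq_zero_of_component fun k => by
        cases k with
        | zero => rw [map_sub, component_of_mem (component_mem 0 α), sub_self]
        | succ k => rw [map_sub, hpos, component_of_mem_ne (component_mem 0 α) k.succ_ne_zero.symm,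
            sub_zero]
      obtain ⟨c, hc⟩ := exteriorPower_zero_eq_algebraMap (component_mem 0 α)
      rw [hα₀] at hc
      have hc₀ : c ≠ 0 := by
        rintro rfl
        exact hne (by rw [← hc, map_zero])
      have h := S.smul_mem c⁻¹ hα
      rwa [← hc, Algebra.algebraMap_eq_smul_one, smul_smul, inv_mul_cancel₀ hc₀, one_smul] at h

end FiniteDimensional

section EvalCochain

open CliffordAlgebra hiding ι
open ExteriorAlgebra

variable {𝕜 V W : Type*} [RCLike 𝕜] [AddCommGroup V] [Module 𝕜 V] [AddCommGroup W] [Module 𝕜 W]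

@[simp] lemma evalList_nil (α : ExteriorAlgebra 𝕜 W) : evalList [] α = algebraMapInv α := rfl

@[simp] lemma evalList_cons (θ : Module.Dual 𝕜 W) (l : List (Module.Dual 𝕜 W))
    (α : ExteriorAlgebra 𝕜 W) : evalList (θ :: l) α = evalList l (contr θ α) := rfl

lemma evalList_add (l : List (Module.Dual 𝕜 W)) (α β : ExteriorAlgebra 𝕜 W) :
    evalList l (α + β) = evalList l α + evalList l β := by
  induction l generalizing α β with
  | nil => exact map_add _ _ _
  | cons θ l ih => rw [evalList_cons, map_add, ih]; rfl

lemma evalList_smul (l : List (Module.Dual 𝕜 W)) (c : 𝕜) (α : ExteriorAlgebra 𝕜 W) :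
    evalList l (c • α) = c * evalList l α := by
  induction l generalizing α with
  | nil => exact map_smul _ _ _
  | cons θ l ih => rw [evalList_cons, map_smul, ih]; rfl

lemma evalList_involute (l : List (Module.Dual 𝕜 W)) (α : ExteriorAlgebra 𝕜 W) :
    evalList l (involute α) = (-1) ^ l.length * evalList l α := by
  induction l generalizing α with
  | nil =>
    have h : algebraMapInv.comp involute = (algebraMapInv : ExteriorAlgebra 𝕜 W →ₐ[𝕜] 𝕜) := by
      ext w
      simp [algebraMapInv]
    simpa using DFunLike.congr_fun h α
  | cons θ l ih =>
    rw [evalList_cons, contr_involute, ← neg_one_smul 𝕜, evalList_smul, ih]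
    simp [pow_succ]

/-- The cochain on `V` given by an element of the exterior algebra of `W`, for a pairing of `V`
with `W`. -/
def evalCochain (pair : V →ₗ[𝕜] Module.Dual 𝕜 W) : ExteriorAlgebra 𝕜 W →ₗ[𝕜] Cochain 𝕜 V where
  toFun α l := evalList (l.map pair) α
  map_add' α β := funext fun _ => evalList_add _ α β
  map_smul' c α := funext fun _ => evalList_smul _ c α

variable (pair : V →ₗ[𝕜] Module.Dual 𝕜 W)

lemma evalCochain_apply (α : ExteriorAlgebra 𝕜 W) (l : List V) :
    evalCochain pair α l = evalList (l.map pair) α := rfl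

@[simp] lemma evalCochain_nil (α : ExteriorAlgebra 𝕜 W) :
    evalCochain pair α [] = algebraMapInv α := rfl

lemma ins_evalCochain (X : V) (α : ExteriorAlgebra 𝕜 W) :
    ins X (evalCochain pair α) = evalCochain pair (contr (pair X) α) := rfl

lemma evalCochain_ι_mul (w : W) (α : ExteriorAlgebra 𝕜 W) :
    evalCochain pair (ι 𝕜 w * α) = wedge (pair.flip w) (evalCochain pair α) := by
  funext l
  induction l generalizing α with
  | nil => exact algebraMapInv_ι_mul w α
  | cons X l ih =>
    rw [← ins_apply X (evalCochain _ _), ins_evalCochain, contr_ι_mul, map_sub, map_smul,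
      Pi.sub_apply, ih, wedge_cons, ins_evalCochain]
    rfl

lemma evalCochain_mem_altCochains (α : ExteriorAlgebra 𝕜 W) :
    evalCochain pair α ∈ altCochains 𝕜 V := by
  refine mem_altCochains_of_coind (· ∈ LinearMap.range (evalCochain pair)) ?_ ?_ ?_ ?_ ⟨α, rfl⟩
  · rintro _ X ⟨β, rfl⟩
    exact ⟨_, (ins_evalCochain pair X β).symm⟩
  · rintro _ X Y ⟨β, rfl⟩
    simp only [ins_evalCochain, map_add, LinearMap.add_apply]
  · rintro _ f X ⟨β, rfl⟩
    simp only [ins_evalCochain, map_smul, LinearMap.smul_apply]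
  · rintro _ X ⟨β, rfl⟩
    rw [ins_evalCochain, ins_evalCochain, contractLeft_contractLeft, map_zero]

lemma evalList_component (l : List (Module.Dual 𝕜 W)) (k : ℕ) (α : ExteriorAlgebra 𝕜 W) :
    evalList l (component k α) = if l.length = k then evalList l α else 0 := by
  have zero (l : List (Module.Dual 𝕜 W)) : evalList l (0 : ExteriorAlgebra 𝕜 W) = 0 := by
    simpa using evalList_smul l 0 0
  induction l generalizing k α with
  | nil =>
    cases k with
    | zero => rw [component_zero, evalList_nil, evalList_nil, algebraMap_leftInverse _ _,
        if_pos List.length_nil]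
    | succ k => rw [evalList_nil, algebraMapInv_eq_zero (component_mem (k + 1) α),
        if_neg (by simp)]
  | cons θ l ih =>
    cases k with
    | zero =>
      rw [evalList_cons, contr_eq_zero θ (component_mem 0 α), zero, if_neg (by simp)]
    | succ k =>
      rw [evalList_cons, contr_component, ih]
      simp

lemma evalCochain_injective [FiniteDimensional 𝕜 W] (hpair : Function.Surjective pair) :
    Function.Injective (evalCochain pair) := by
  refine LinearMap.ker_eq_bot.1 <| (Submodule.eq_bot_iff _).2 fun α hα => ?_
  by_contra hne
  have hker : (1 : ExteriorAlgebra 𝕜 W) ∈ LinearMap.ker (evalCochain pair) := by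
    refine one_mem_of_contr_mem _ (fun θ β hβ => ?_) hα hne
    obtain ⟨X, rfl⟩ := hpair θ
    rw [LinearMap.mem_ker] at hβ ⊢
    rw [← ins_evalCochain, hβ, map_zero]
  simpa using congrFun (LinearMap.mem_ker.1 hker) []

/-- Expand in a basis one vector at a time: with `Ψ = i_{b j} Φ` the cochain `Φ - b_j* ∧ Ψ` is
killed by one more basis vector than `Φ`. -/
lemma exists_evalCochain_eq {I : Type*} [Finite I] (b : Module.Basis I 𝕜 V) {Φ : Cochain 𝕜 V}
    (hΦ : Φ ∈ altCochains 𝕜 V) : ∃ α, evalCochain (Module.Dual.eval 𝕜 V) α = Φ := by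
  classical
  cases nonempty_fintype I
  suffices key : ∀ S : Finset I, ∀ Φ ∈ altCochains 𝕜 V, (∀ j ∉ S, ins (b j) Φ = 0) →
      ∃ α, evalCochain (Module.Dual.eval 𝕜 V) α = Φ from
    key Finset.univ Φ hΦ fun j hj => absurd (Finset.mem_univ j) hj
  intro S
  induction S using Finset.induction_on with
  | empty =>
    intro Φ hΦ h₀
    have hins (X : V) : ins X Φ = 0 := by
      rw [← b.sum_repr X, ins_sum_left hΦ]
      exact Finset.sum_eq_zero fun i _ => by
        rw [ins_smul_left hΦ, h₀ i (Finset.notMem_empty i), smul_zero]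
    refine ⟨algebraMap 𝕜 _ (Φ []), funext fun l => ?_⟩
    cases l with
    | nil => exact algebraMap_leftInverse _ _
    | cons X l =>
      rw [← ins_apply X (evalCochain _ _), ins_evalCochain, contractLeft_algebraMap, map_zero,
        ← ins_apply X Φ, hins]
  | insert j S _ ih =>
    intro Φ hΦ h₀
    have hwedge : wedge (b.coord j) (ins (b j) Φ) ∈ altCochains 𝕜 V :=
      wedge_mem_altCochains _ (ins_mem_altCochains hΦ (b j))
    obtain ⟨α, hα⟩ := ih (ins (b j) Φ) (ins_mem_altCochains hΦ _) fun i hi => by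
      rcases eq_or_ne i j with rfl | hij
      · exact ins_ins_self hΦ _
      · rw [ins_swap hΦ, h₀ i (by simp [hij, hi]), map_zero, neg_zero]
    obtain ⟨β, hβ⟩ := ih (Φ - wedge (b.coord j) (ins (b j) Φ)) (sub_mem hΦ hwedge) fun i hi => by
      rcases eq_or_ne i j with rfl | hij
      · rw [map_sub, ins_wedge, ins_ins_self hΦ, map_zero, b.coord_apply, b.repr_self]
        simp
      · rw [map_sub, ins_wedge, ins_swap hΦ, h₀ i (by simp [hij, hi]), map_zero, neg_zero,
          map_zero, b.coord_apply, b.repr_self]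
        simp [hij]
    refine ⟨ι 𝕜 (b.coord j) * α + β, ?_⟩
    rw [map_add, evalCochain_ι_mul, hα, hβ]
    exact add_sub_cancel _ _

end EvalCochain

section InteriorMul

open CliffordAlgebra hiding ι
open ExteriorAlgebra

variable {𝕜 E : Type*} [RCLike 𝕜] [AddCommGroup E] [Module 𝕜 E]

/-- Contraction of forms with multivectors, `u ↦ i_u`, as a linear map to endomorphisms. -/
def interiorMul : ExteriorAlgebra 𝕜 E →ₗ[𝕜] Module.End 𝕜 (ExteriorAlgebra 𝕜 (Module.Dual 𝕜 E)) :=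
  (MulOpposite.opLinearEquiv 𝕜).symm.toLinearMap ∘ₗ contract.toLinearMap

lemma interiorMul_mul (u v : ExteriorAlgebra 𝕜 E) (α : ExteriorAlgebra 𝕜 (Module.Dual 𝕜 E)) :
    interiorMul (u * v) α = interiorMul v (interiorMul u α) := by
  have h : contract (u * v) = contract (𝕜 := 𝕜) u * contract v := map_mul _ u v
  exact congrArg (fun A : (Module.End 𝕜 _)ᵐᵒᵖ => A.unop α) h

lemma interiorMul_ι (X : E) (α : ExteriorAlgebra 𝕜 (Module.Dual 𝕜 E)) :
    interiorMul (ι 𝕜 X) α = contr (Module.Dual.eval 𝕜 E X) α :=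
  congrArg (fun A : (Module.End 𝕜 _)ᵐᵒᵖ => A.unop α) (lift_ι_apply 𝕜 _ _ X)

lemma interiorMul_algebraMap (c : 𝕜) (α : ExteriorAlgebra 𝕜 (Module.Dual 𝕜 E)) :
    interiorMul (algebraMap 𝕜 _ c) α = c • α :=
  congrArg (fun A : (Module.End 𝕜 _)ᵐᵒᵖ => A.unop α) (AlgHom.commutes contract c)

lemma interiorMul_involute (u : ExteriorAlgebra 𝕜 E) (α : ExteriorAlgebra 𝕜 (Module.Dual 𝕜 E)) :
    interiorMul (involute u) (involute α) = involute (interiorMul u α) := by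
  induction u using CliffordAlgebra.left_induction generalizing α with
  | algebraMap c => rw [AlgHom.commutes, interiorMul_algebraMap, interiorMul_algebraMap, map_smul]
  | add u v hu hv => simp only [map_add, LinearMap.add_apply, hu, hv]
  | ι_mul u X hu =>
    change interiorMul (involute (ι 𝕜 X * u)) _ = involute (interiorMul (ι 𝕜 X * u) α)
    rw [map_mul, involute_ι, interiorMul_mul, interiorMul_mul, map_neg, LinearMap.neg_apply,
      interiorMul_ι, interiorMul_ι, contr_involute, neg_neg, hu]

lemma ι_mul_interiorMul (η : Module.Dual 𝕜 E) (u : ExteriorAlgebra 𝕜 E)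
    (α : ExteriorAlgebra 𝕜 (Module.Dual 𝕜 E)) :
    ι 𝕜 η * interiorMul u α = interiorMul (involute u) (ι 𝕜 η * α) -
      interiorMul (contr η (involute u)) α := by
  induction u using CliffordAlgebra.left_induction generalizing α with
  | algebraMap c =>
    rw [AlgHom.commutes, interiorMul_algebraMap, interiorMul_algebraMap, contractLeft_algebraMap,
      map_zero, LinearMap.zero_apply, sub_zero, mul_smul_comm]
  | add u v hu hv => simp only [map_add, LinearMap.add_apply, mul_add, hu, hv]; abel
  | ι_mul u X hu =>
    change ι 𝕜 η * interiorMul (ι 𝕜 X * u) α = interiorMul (involute (ι 𝕜 X * u)) _ -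
      interiorMul (contr η (involute (ι 𝕜 X * u))) α
    rw [map_mul involute, involute_ι, neg_mul, map_neg (contr η), contr_ι_mul, map_neg, map_neg,
      map_sub, map_smul]
    simp only [LinearMap.neg_apply, LinearMap.sub_apply, LinearMap.smul_apply, interiorMul_mul,
      interiorMul_ι, contr_ι_mul, hu, map_sub, map_smul, Module.Dual.eval_apply]
    abel

lemma interiorMul_mem {k j : ℕ} {u : ExteriorAlgebra 𝕜 E} (hu : u ∈ ⋀[𝕜]^k E)
    {α : ExteriorAlgebra 𝕜 (Module.Dual 𝕜 E)} (hα : α ∈ ⋀[𝕜]^(k + j) (Module.Dual 𝕜 E)) :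
    interiorMul u α ∈ ⋀[𝕜]^j (Module.Dual 𝕜 E) := by
  induction hu using Submodule.pow_induction_on_left' generalizing α with
  | algebraMap c =>
    rw [interiorMul_algebraMap]
    exact Submodule.smul_mem _ _ (by rwa [zero_add] at hα)
  | add u v k _ _ hu hv =>
    rw [map_add]
    exact add_mem (hu hα) (hv hα)
  | mem_mul _ hX k u _ hu =>
    obtain ⟨X, rfl⟩ := hX
    rw [interiorMul_mul, interiorMul_ι]
    exact hu (contr_mem _ (by rwa [Nat.succ_add] at hα))

variable [FiniteDimensional 𝕜 E] {Ω : ExteriorAlgebra 𝕜 (Module.Dual 𝕜 E)}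

lemma ι_mul_eq_zero_of_top (hΩ : Ω ∈ ⋀[𝕜]^(Module.finrank 𝕜 E) (Module.Dual 𝕜 E))
    (η : Module.Dual 𝕜 E) : ι 𝕜 η * Ω = 0 :=
  eq_zero_of_finrank_lt (ι_mul_mem_exteriorPower η hΩ) <| by
    rw [Subspace.dual_finrank_eq]
    exact Nat.lt_succ_self _

lemma sharp_surjective (hΩ : Ω ∈ ⋀[𝕜]^(Module.finrank 𝕜 E) (Module.Dual 𝕜 E)) (hne : Ω ≠ 0) :
    Function.Surjective (interiorMul.flip Ω : ExteriorAlgebra 𝕜 E →ₗ[𝕜] _) := by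
  have hone : 1 ∈ LinearMap.range (interiorMul.flip Ω : ExteriorAlgebra 𝕜 E →ₗ[𝕜] _) := by
    refine one_mem_of_contr_mem _ ?_ (α := Ω) ⟨1, ?_⟩ hne
    · rintro θ _ ⟨u, rfl⟩
      obtain ⟨X, rfl⟩ := (Module.evalEquiv 𝕜 E).surjective θ
      exact ⟨u * ι 𝕜 X, by
        rw [LinearMap.flip_apply, interiorMul_mul, interiorMul_ι]; rfl⟩
    · rw [LinearMap.flip_apply, ← map_one (algebraMap 𝕜 _), interiorMul_algebraMap, one_smul]
  intro α
  induction α using CliffordAlgebra.left_induction with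
  | algebraMap c =>
    rw [Algebra.algebraMap_eq_smul_one]
    exact Submodule.smul_mem _ c hone
  | add α β hα hβ => exact (LinearMap.range (interiorMul.flip Ω)).add_mem hα hβ
  | ι_mul α η hα =>
    obtain ⟨u, rfl⟩ := hα
    refine ⟨-contr η (involute u), ?_⟩
    change _ = ι 𝕜 η * interiorMul u Ω
    rw [ι_mul_interiorMul, ι_mul_eq_zero_of_top hΩ, map_zero, zero_sub, map_neg,
      LinearMap.flip_apply]

lemma finrank_exteriorAlgebra_dual : Module.finrank 𝕜 (ExteriorAlgebra 𝕜 E) =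
    Module.finrank 𝕜 (ExteriorAlgebra 𝕜 (Module.Dual 𝕜 E)) := by
  let b := Module.finBasis 𝕜 E
  rw [Module.finrank_eq_card_basis b.ExteriorAlgebra,
    Module.finrank_eq_card_basis b.dualBasis.ExteriorAlgebra]

lemma finiteDimensional_exteriorAlgebra (W : Type*) [AddCommGroup W] [Module 𝕜 W]
    [FiniteDimensional 𝕜 W] : FiniteDimensional 𝕜 (ExteriorAlgebra 𝕜 W) :=
  Module.Basis.finiteDimensional_of_finite (Module.finBasis 𝕜 W).ExteriorAlgebra

lemma sharp_injective (hΩ : Ω ∈ ⋀[𝕜]^(Module.finrank 𝕜 E) (Module.Dual 𝕜 E)) (hne : Ω ≠ 0) :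
    Function.Injective (interiorMul.flip Ω : ExteriorAlgebra 𝕜 E →ₗ[𝕜] _) := by
  have := finiteDimensional_exteriorAlgebra (𝕜 := 𝕜) E
  have := finiteDimensional_exteriorAlgebra (𝕜 := 𝕜) (Module.Dual 𝕜 E)
  exact (LinearMap.injective_iff_surjective_of_finrank_eq_finrank
    finrank_exteriorAlgebra_dual).2 (sharp_surjective hΩ hne)

lemma component_sharp (hΩ : Ω ∈ ⋀[𝕜]^(Module.finrank 𝕜 E) (Module.Dual 𝕜 E)) {i j : ℕ}
    (hij : i + j = Module.finrank 𝕜 E) (u : ExteriorAlgebra 𝕜 E) :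
    component j (interiorMul u Ω) = interiorMul (component i u) Ω := by
  induction u using homogeneous_induction with
  | add u v hu hv => simp only [map_add, LinearMap.add_apply, hu, hv]
  | mem k u hu =>
    rcases lt_or_ge (Module.finrank 𝕜 E) k with hk | hk
    · simp only [eq_zero_of_finrank_lt hu hk, map_zero, LinearMap.zero_apply]
    obtain ⟨l, hl⟩ := Nat.exists_eq_add_of_le hk
    have hsharp := interiorMul_mem hu (hl ▸ hΩ)
    rcases eq_or_ne k i with rfl | hne
    · rw [component_of_mem hu, ← component_of_mem hsharp]
      obtain rfl : l = j := by lia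
      exact component_of_mem (component_mem _ _)
    · rw [component_of_mem_ne hu hne, component_of_mem_ne hsharp (by lia), map_zero,
        LinearMap.zero_apply]

lemma mem_exteriorPower_of_sharp_mem
    (hΩ : Ω ∈ ⋀[𝕜]^(Module.finrank 𝕜 E) (Module.Dual 𝕜 E)) (hne : Ω ≠ 0) {i j : ℕ}
    (hij : i + j = Module.finrank 𝕜 E) {u : ExteriorAlgebra 𝕜 E}
    (hu : interiorMul u Ω ∈ ⋀[𝕜]^j (Module.Dual 𝕜 E)) : u ∈ ⋀[𝕜]^i E := by
  have h : component i u = u := sharp_injective hΩ hne <| by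
    rw [LinearMap.flip_apply, LinearMap.flip_apply, ← component_sharp hΩ hij, component_of_mem hu]
  exact h ▸ component_mem i u

end InteriorMul

/-! ### Smooth functions and sections of locally free modules -/

open scoped Topology

section SmoothFunctions

variable {𝕜 : Type*} [RCLike 𝕜] {m : ℕ} {M : Type*} [TopologicalSpace M]
  [ChartedSpace (EuclideanSpace ℝ (Fin m)) M] {x : M}

lemma mdifferentiableAt_of_mem {f : M → 𝕜} (hf : f ∈ smoothFun 𝕜 m M) (x : M) :
    MDifferentiableAt (𝓡 m) 𝓘(ℝ, 𝕜) f x :=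
  (hf x).mdifferentiableAt (by simp)

lemma vecDeriv_fun_add (v : 𝕜 ⊗[ℝ] TangentSpace (𝓡 m) x) {f g : M → 𝕜}
    (hf : f ∈ smoothFun 𝕜 m M) (hg : g ∈ smoothFun 𝕜 m M) :
    vecDeriv v (f + g) = vecDeriv v f + vecDeriv v g := by
  simp only [vecDeriv]
  rw [mfderiv_add (mdifferentiableAt_of_mem hf x) (mdifferentiableAt_of_mem hg x)]
  exact LinearMap.congr_fun (map_add (LinearMap.liftBaseChangeEquiv 𝕜) _ _) v

lemma vecDeriv_fun_mul (v : 𝕜 ⊗[ℝ] TangentSpace (𝓡 m) x) {f g : M → 𝕜}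
    (hf : f ∈ smoothFun 𝕜 m M) (hg : g ∈ smoothFun 𝕜 m M) :
    vecDeriv v (f * g) = f x * vecDeriv v g + g x * vecDeriv v f := by
  simp only [vecDeriv]
  rw [((mdifferentiableAt_of_mem hf x).hasMFDerivAt.mul
    (mdifferentiableAt_of_mem hg x).hasMFDerivAt).mfderiv]
  have hlin (a b : 𝕜) (φ ψ : TangentSpace (𝓡 m) x →ₗ[ℝ] 𝕜) :
      (a • φ + b • ψ).liftBaseChange 𝕜 v =
        a * φ.liftBaseChange 𝕜 v + b * ψ.liftBaseChange 𝕜 v := by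
    change LinearMap.liftBaseChangeEquiv 𝕜 _ v = _
    rw [map_add, map_smul, map_smul]
    rfl
  exact hlin (f x) (g x) _ _

lemma vecDeriv_const (v : 𝕜 ⊗[ℝ] TangentSpace (𝓡 m) x) (c : 𝕜) :
    vecDeriv v (fun _ : M => c) = 0 := by
  simp only [vecDeriv]
  rw [mfderiv_const]
  exact LinearMap.congr_fun (map_zero (LinearMap.liftBaseChangeEquiv 𝕜)) v

lemma exists_smooth_bump (𝕜 : Type*) [RCLike 𝕜] [T2Space M] [IsManifold (𝓡 m) ∞ M] {U : Set M}
    (hU : U ∈ 𝓝 x) : ∃ χ ∈ smoothFun 𝕜 m M, χ =ᶠ[𝓝 x] 1 ∧ ∀ y ∉ U, χ =ᶠ[𝓝 y] 0 := by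
  obtain ⟨f, -, hf⟩ := (SmoothBumpFunction.nhds_basis_tsupport (I := 𝓡 m) x).mem_iff.1 hU
  refine ⟨fun y => ((f y : ℝ) : 𝕜), fun y => ?_, ?_, fun y hy => ?_⟩
  · exact ((RCLike.ofRealCLM (K := 𝕜)).contDiff.contMDiff).contMDiffAt.comp y f.contMDiffAt
  · filter_upwards [f.eventuallyEq_one] with y hy
    simp [hy]
  · filter_upwards [notMem_tsupport_iff_eventuallyEq.1 fun h => hy (hf h)] with z hz
    simp [hz]

lemma mem_smoothFun_of_mul_mem {g : M → 𝕜}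
    (h : ∀ x, ∃ f ∈ smoothFun 𝕜 m M, f x ≠ 0 ∧ f * g ∈ smoothFun 𝕜 m M) :
    g ∈ smoothFun 𝕜 m M := by
  intro x
  obtain ⟨f, hf, hfx, hfg⟩ := h x
  have hinv : ContMDiffAt (𝓡 m) 𝓘(ℝ, 𝕜) ∞ (fun y => (f y)⁻¹) x :=
    (contDiffAt_inv ℝ hfx).contMDiffAt.comp x (hf x)
  refine ((contDiff_mul (𝕜 := ℝ) (𝔸 := 𝕜)).contMDiff.contMDiffAt.comp x
    (hinv.prodMk_space (hfg x))).congr_of_eventuallyEq ?_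
  filter_upwards [(hf x).continuousAt.eventually_ne hfx] with y hy
  exact (inv_mul_cancel_left₀ hy (g y)).symm

/-- The elements which a function equal to `1` at `x` multiplies into the submodule `N`; for sheaves
of sections, those which belong to `N` near `x`. -/
def localSpan {P : Type*} [AddCommGroup P] [Module (smoothFun 𝕜 m M) P]
    (N : Submodule (smoothFun 𝕜 m M) P) (x : M) : Submodule (smoothFun 𝕜 m M) P where
  carrier := {u | ∃ f : smoothFun 𝕜 m M, f.1 x = 1 ∧ f • u ∈ N}
  zero_mem' := ⟨1, rfl, by rw [smul_zero]; exact zero_mem N⟩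
  add_mem' := by
    rintro u v ⟨f, hf, hfu⟩ ⟨g, hg, hgv⟩
    refine ⟨f * g, ?_, ?_⟩
    · change f.1 x * g.1 x = 1
      rw [hf, hg, one_mul]
    · rw [smul_add, mul_smul f g v, mul_comm f g, mul_smul g f u]
      exact add_mem (N.smul_mem g hfu) (N.smul_mem f hgv)
  smul_mem' := by
    rintro g u ⟨f, hf, hfu⟩
    exact ⟨f, hf, by rw [smul_comm]; exact N.smul_mem g hfu⟩

lemma mem_localSpan_of_smul_mem {P : Type*} [AddCommGroup P] [Module (smoothFun 𝕜 m M) P]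
    {N : Submodule (smoothFun 𝕜 m M) P} {x : M} {f : smoothFun 𝕜 m M} {u : P} (hf : f.1 x = 1)
    (hfu : f • u ∈ localSpan N x) : u ∈ localSpan N x := by
  obtain ⟨g, hg, hgu⟩ := hfu
  refine ⟨g * f, ?_, by rwa [mul_smul]⟩
  change g.1 x * f.1 x = 1
  rw [hf, hg, one_mul]

end SmoothFunctions

section LocallyFree

variable {𝕜 : Type*} [RCLike 𝕜] {m : ℕ} {M : Type*} [TopologicalSpace M]
  [ChartedSpace (EuclideanSpace ℝ (Fin m)) M]
  {V : M → Type*} [∀ x, AddCommGroup (V x)] [∀ x, Module 𝕜 (V x)]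

instance : IsScalarTower 𝕜 (smoothFun 𝕜 m M) (∀ x, V x) :=
  ⟨fun c f X => funext fun x => smul_assoc c (f.1 x) (X x)⟩

/-- The module of sections `Γ` is locally free of rank `n`: every point has a neighbourhood, given
as the set where a smooth function `f` does not vanish, on which global sections of the bundle and
of its dual form dual frames. -/
class LocallyFree (Γ : Submodule (smoothFun 𝕜 m M) (∀ x, V x)) (n : outParam ℕ) : Prop where
  exists_frame : ∀ x, ∃ (f : smoothFun 𝕜 m M) (e : Fin n → Γ) (θ : Fin n → dualSections Γ),
    f.1 x = 1 ∧ ∀ y, f.1 y ≠ 0 → ∃ b : Module.Basis (Fin n) 𝕜 (V y),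
      ∀ i, b i = (e i).1 y ∧ b.coord i = (θ i).1 y

variable {Γ : Submodule (smoothFun 𝕜 m M) (∀ x, V x)}

-- Shortcuts: the default searches for these instances are very slow.
instance : Module (smoothFun 𝕜 m M) Γ := Γ.module

instance : SMul (smoothFun 𝕜 m M) Γ := Γ.module.toSMul

/-- The pairing of a section of the dual bundle with sections. -/
def pairing (θ : dualSections Γ) : Γ →ₗ[smoothFun 𝕜 m M] smoothFun 𝕜 m M where
  toFun X := ⟨fun x => θ.1 x (X.1 x), θ.2 X.1 X.2⟩
  map_add' X Y := Subtype.ext <| funext fun x => map_add (θ.1 x) (X.1 x) (Y.1 x)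
  map_smul' f X := Subtype.ext <| funext fun x => map_smul (θ.1 x) (f.1 x) (X.1 x)

lemma pairing_apply (θ : dualSections Γ) (X : Γ) (x : M) :
    (pairing θ X).1 x = θ.1 x (X.1 x) := rfl

lemma coe_sum_section_apply {I : Type*} (s : Finset I) (X : I → Γ) (x : M) :
    (∑ i ∈ s, X i).1 x = ∑ i ∈ s, (X i).1 x := by
  simp

variable {n : ℕ}

lemma exists_basis (Γ : Submodule (smoothFun 𝕜 m M) (∀ x, V x)) [LocallyFree Γ n]
    (x : M) : Nonempty (Module.Basis (Fin n) 𝕜 (V x)) := by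
  obtain ⟨f, e, θ, hfx, h⟩ := LocallyFree.exists_frame (Γ := Γ) x
  exact ⟨(h x (hfx ▸ one_ne_zero)).choose⟩

lemma finiteDimensional_fibre (Γ : Submodule (smoothFun 𝕜 m M) (∀ x, V x)) [LocallyFree Γ n]
    (x : M) : FiniteDimensional 𝕜 (V x) :=
  .of_basis (exists_basis Γ x).some

lemma finrank_fibre (Γ : Submodule (smoothFun 𝕜 m M) (∀ x, V x)) [LocallyFree Γ n]
    (x : M) : Module.finrank 𝕜 (V x) = n := by
  rw [Module.finrank_eq_card_basis (exists_basis Γ x).some, Fintype.card_fin]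

lemma exists_linear_extension (Γ : Submodule (smoothFun 𝕜 m M) (∀ x, V x)) [LocallyFree Γ n]
    (x : M) : ∃ σ : V x →ₗ[𝕜] Γ, ∀ v, (σ v).1 x = v := by
  obtain ⟨f, e, θ, hfx, h⟩ := LocallyFree.exists_frame (Γ := Γ) x
  obtain ⟨b, hb⟩ := h x (hfx ▸ one_ne_zero)
  refine ⟨∑ i, (b.coord i).smulRight (e i), fun v => ?_⟩
  rw [LinearMap.sum_apply, coe_sum_section_apply]
  conv_rhs => rw [← b.sum_repr v]
  exact Finset.sum_congr rfl fun i _ => by rw [(hb i).1]; rfl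

end LocallyFree

section Bundle

variable {𝕜 : Type*} [RCLike 𝕜] {m : ℕ} {M : Type*} [TopologicalSpace M]
  [ChartedSpace (EuclideanSpace ℝ (Fin m)) M]
  {F : Type*} [NormedAddCommGroup F] [NormedSpace ℝ F] [NormedSpace 𝕜 F] [IsScalarTower ℝ 𝕜 F]
  {A : M → Type*} [TopologicalSpace (Bundle.TotalSpace F A)]
  [∀ x, AddCommGroup (A x)] [∀ x, Module ℝ (A x)] [∀ x, Module 𝕜 (A x)]
  [∀ x, TopologicalSpace (A x)] [FiberBundle F A] [VectorBundle ℝ F A] [VectorBundle 𝕜 F A]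
  [ContMDiffVectorBundle ∞ F A (𝓡 m)]
  (t : Bundle.Trivialization F (Bundle.TotalSpace.proj : Bundle.TotalSpace F A → M))
  [MemTrivializationAtlas t] {χ : M → 𝕜}

lemma smul_symm_mem_sections (hχ : χ ∈ smoothFun 𝕜 m M) (hχ₀ : ∀ x ∉ t.baseSet, χ =ᶠ[𝓝 x] 0)
    (w : F) : (fun x => χ x • t.symmₗ 𝕜 x w) ∈ sections 𝕜 m F A := by
  intro x
  by_cases hx : x ∈ t.baseSet
  · refine (t.contMDiffAt_section_iff (IB := 𝓡 m) (n := ∞) hx).2 ?_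
    have h : ContMDiffAt (𝓡 m) 𝓘(ℝ, F) ∞ (fun x => χ x • w) x :=
      ((contDiff_smul (𝕜 := ℝ) (𝕜' := 𝕜) (F := F)).contMDiff.contMDiffAt).comp x
        ((hχ x).prodMk_space contMDiffAt_const)
    refine h.congr_of_eventuallyEq ?_
    filter_upwards [t.open_baseSet.mem_nhds hx] with y hy
    have hlin := congrFun (t.coe_linearMapAt_of_mem (R := 𝕜) hy) (χ y • t.symmₗ 𝕜 y w)
    rw [map_smul, t.linearMapAt_symmₗ hy] at hlin
    exact hlin.symm
  · refine (Bundle.contMDiff_zeroSection ℝ A x).congr_of_eventuallyEq ?_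
    filter_upwards [hχ₀ x hx] with y hy
    simp [hy, Bundle.zeroSection]

lemma smul_comp_linearMapAt_mem_dualSections [FiniteDimensional 𝕜 F] (hχ : χ ∈ smoothFun 𝕜 m M)
    (hχ₀ : ∀ x ∉ t.baseSet, χ =ᶠ[𝓝 x] 0) (η : Module.Dual 𝕜 F) :
    (fun x => χ x • (η ∘ₗ t.linearMapAt 𝕜 x)) ∈ dualSections (sections 𝕜 m F A) := by
  intro X hX x
  by_cases hx : x ∈ t.baseSet
  · have hη : ContMDiffAt (𝓡 m) 𝓘(ℝ, 𝕜) ∞ (fun x => η (t ⟨x, X x⟩).2) x :=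
      ((η.toContinuousLinearMap.restrictScalars ℝ).contDiff.contMDiff).contMDiffAt.comp x
        ((t.contMDiffAt_section_iff (IB := 𝓡 m) (n := ∞) hx).1 (hX x))
    refine (((contDiff_mul (𝕜 := ℝ) (𝔸 := 𝕜)).contMDiff.contMDiffAt).comp x
      ((hχ x).prodMk_space hη)).congr_of_eventuallyEq ?_
    filter_upwards [t.open_baseSet.mem_nhds hx] with y hy
    simp [t.coe_linearMapAt_of_mem hy]
  · refine (contMDiffAt_const (c := (0 : 𝕜))).congr_of_eventuallyEq ?_
    filter_upwards [hχ₀ x hx] with y hy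
    simp [hy]

instance locallyFree_sections [T2Space M] [IsManifold (𝓡 m) ∞ M] [FiniteDimensional 𝕜 F] :
    LocallyFree (sections 𝕜 m F A) (Module.finrank 𝕜 F) where
  exists_frame x := by
    let t := trivializationAt F A x
    have hU : t.baseSet ∈ 𝓝 x :=
      t.open_baseSet.mem_nhds (FiberBundle.mem_baseSet_trivializationAt' x)
    obtain ⟨χ, hχ, hχ₁, hχ₀⟩ := exists_smooth_bump (m := m) 𝕜 hU
    obtain ⟨f, hf, hf₁, hf₀⟩ := exists_smooth_bump (m := m) 𝕜 (Filter.inter_mem hU hχ₁)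
    let b := Module.finBasis 𝕜 F
    refine ⟨⟨f, hf⟩, fun i => ⟨_, smul_symm_mem_sections t hχ hχ₀ (b i)⟩,
      fun i => ⟨_, smul_comp_linearMapAt_mem_dualSections t hχ hχ₀ (b.coord i)⟩,
      hf₁.self_of_nhds, fun y hy => ?_⟩
    obtain ⟨hyt, hy₁⟩ : y ∈ t.baseSet ∩ {y | χ y = 1} :=
      by_contra fun h => hy (hf₀ y h).self_of_nhds
    refine ⟨b.map (t.linearEquivAt 𝕜 y hyt).symm, fun i => ⟨?_, LinearMap.ext fun v => ?_⟩⟩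
    · simp [hy₁.out, t.symmₗ_apply hyt]
    · simp [hy₁.out, t.coe_linearMapAt_of_mem hyt]

end Bundle

/-! ### The algebras of multivector fields and of forms -/

section SmoothSections

open CliffordAlgebra hiding ι
open ExteriorAlgebra

variable {𝕜 : Type*} [RCLike 𝕜] {m : ℕ} {M : Type*} [TopologicalSpace M]
  [ChartedSpace (EuclideanSpace ℝ (Fin m)) M]
  {V W : M → Type*} [∀ x, AddCommGroup (V x)] [∀ x, Module 𝕜 (V x)]
  [∀ x, AddCommGroup (W x)] [∀ x, Module 𝕜 (W x)]
  {Γ : Submodule (smoothFun 𝕜 m M) (∀ x, V x)}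
  {pair : ∀ x, V x →ₗ[𝕜] Module.Dual 𝕜 (W x)} {α β : ∀ x, ExteriorAlgebra 𝕜 (W x)}

lemma IsSmoothVia.add (hα : IsSmoothVia Γ pair α) (hβ : IsSmoothVia Γ pair β) :
    IsSmoothVia Γ pair (α + β) := fun Xs => by
  have h : evalOn pair (α + β) Xs = evalOn pair α Xs + evalOn pair β Xs :=
    funext fun _ => evalList_add _ _ _
  exact h ▸ add_mem (hα Xs) (hβ Xs)

lemma IsSmoothVia.contr (hα : IsSmoothVia Γ pair α) (X : Γ) :
    IsSmoothVia Γ pair fun x => contr (pair x (X.1 x)) (α x) := fun Xs => hα (X :: Xs)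

lemma IsSmoothVia.involute (hα : IsSmoothVia Γ pair α) :
    IsSmoothVia Γ pair fun x => involute (α x) := fun Xs => by
  have h : evalOn pair (fun x => CliffordAlgebra.involute (α x)) Xs =
      algebraMap 𝕜 (M → 𝕜) ((-1) ^ Xs.length) * evalOn pair α Xs :=
    funext fun x => by simp [evalOn, evalList_involute]
  exact h ▸ mul_mem (algebraMap_mem _ _) (hα Xs)

lemma IsSmoothVia.mul (hα : IsSmoothVia Γ pair α) (hβ : IsSmoothVia Γ pair β) :
    IsSmoothVia Γ pair (α * β) := by
  intro Xs
  induction Xs generalizing α β with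
  | nil =>
    have h : evalOn (Γ := Γ) pair (α * β) [] =
        evalOn (Γ := Γ) pair α [] * evalOn (Γ := Γ) pair β [] :=
      funext fun _ => map_mul algebraMapInv _ _
    exact h ▸ mul_mem (hα []) (hβ [])
  | cons X Xs ih =>
    have h : evalOn pair (α * β) (X :: Xs) =
        evalOn pair ((fun x => LieBialg.contr (pair x (X.1 x)) (α x)) * β) Xs +
          evalOn pair ((fun x => CliffordAlgebra.involute (α x)) *
            fun x => LieBialg.contr (pair x (X.1 x)) (β x)) Xs :=
      funext fun x => by
        simp only [evalOn, List.map_cons, evalList_cons, Pi.mul_apply, contr_mul, evalList_add,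
          Pi.add_apply]
    exact h ▸ add_mem (ih (hα.contr X) hβ) (ih hα.involute (hβ.contr X))

lemma isSmoothVia_ofFun {f : M → 𝕜} (hf : f ∈ smoothFun 𝕜 m M) :
    IsSmoothVia Γ pair (ofFun f)
  | [] => by
    have h : evalOn (Γ := Γ) pair (ofFun f) [] = f := funext fun x => by simp [evalOn, ofFun]
    exact h.symm ▸ hf
  | X :: Xs => by
    have h : evalOn pair (ofFun f) (X :: Xs) = 0 := funext fun x => by
      simp only [evalOn, List.map_cons, evalList_cons, ofFun, contractLeft_algebraMap]
      simpa using evalList_smul (Xs.map fun X => pair x (X.1 x)) (0 : 𝕜) 0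
    exact h ▸ zero_mem _

variable (Γ pair) in
/-- The `C^∞(M)`-algebra of smooth sections of the bundle of exterior algebras `⋀W`. -/
def smoothSections : Subalgebra (smoothFun 𝕜 m M) (∀ x, ExteriorAlgebra 𝕜 (W x)) where
  carrier := {α | IsSmoothVia Γ pair α}
  mul_mem' := IsSmoothVia.mul
  add_mem' := IsSmoothVia.add
  algebraMap_mem' f := isSmoothVia_ofFun f.2

-- Shortcuts: the default searches for these instances are very slow.
instance : Ring (smoothSections Γ pair) := (smoothSections Γ pair).toRing

instance : Semiring (smoothSections Γ pair) := Ring.toSemiring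

instance : Mul (smoothSections Γ pair) := Distrib.toMul

instance : HasDistribNeg (smoothSections Γ pair) := NonUnitalNonAssocRing.toHasDistribNeg

instance : AddCommGroup (smoothSections Γ pair) := Ring.toAddCommGroup

instance : Algebra (smoothFun 𝕜 m M) (smoothSections Γ pair) := (smoothSections Γ pair).algebra

instance : Module (smoothFun 𝕜 m M) (smoothSections Γ pair) := Algebra.toModule

instance : DistribMulAction (smoothFun 𝕜 m M) (smoothSections Γ pair) :=
  Module.toDistribMulAction

instance : DistribSMul (smoothFun 𝕜 m M) (smoothSections Γ pair) :=
  DistribMulAction.toDistribSMul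

instance : MulAction (smoothFun 𝕜 m M) (smoothSections Γ pair) := DistribMulAction.toMulAction

instance : SMul (smoothFun 𝕜 m M) (smoothSections Γ pair) := Algebra.toSMul

instance : Algebra 𝕜 (smoothSections Γ pair) := inferInstance

instance : Module 𝕜 (smoothSections Γ pair) := Algebra.toModule

lemma coe_smul_apply (f : smoothFun 𝕜 m M) (α : smoothSections Γ pair) (x : M) :
    (f • α).1 x = f.1 x • α.1 x := rfl

lemma isSmoothVia_ofSec {w : ∀ x, W x}
    (hw : ∀ X : Γ, (fun x => pair x (X.1 x) (w x)) ∈ smoothFun 𝕜 m M) :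
    IsSmoothVia Γ pair (ofSec w)
  | [] => by
    have h : evalOn (Γ := Γ) pair (ofSec w) [] = 0 :=
      funext fun x => by simp [evalOn, ofSec, algebraMapInv]
    exact h ▸ zero_mem _
  | X :: Xs => by
    have h : evalOn pair (ofSec w) (X :: Xs) =
        evalOn pair (ofFun fun x => pair x (X.1 x) (w x)) Xs := funext fun x => by
      simp only [evalOn, List.map_cons, evalList_cons, ofSec, contractLeft_ι, ofFun]
    exact h ▸ isSmoothVia_ofFun (hw X) Xs

lemma IsSmoothVia.component (hα : IsSmoothVia Γ pair α) (k : ℕ) :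
    IsSmoothVia Γ pair fun x => component k (α x) := fun Xs => by
  have h : evalOn pair (fun x => LieBialg.component k (α x)) Xs =
      if Xs.length = k then evalOn pair α Xs else 0 := funext fun x => by
    simp only [evalOn, evalList_component, List.length_map]
    split_ifs <;> rfl
  rw [h]
  split_ifs
  exacts [hα Xs, zero_mem _]

variable (Γ pair) in
/-- The grading involution of `Γ(⋀W)`, multiplication by `(-1)^k` in degree `k`. -/
def parity : smoothSections Γ pair →ₐ[smoothFun 𝕜 m M] smoothSections Γ pair where
  toFun u := ⟨fun x => involute (u.1 x), IsSmoothVia.involute u.2⟩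
  map_one' := Subtype.ext <| funext fun _ => map_one _
  map_mul' _ _ := Subtype.ext <| funext fun _ => map_mul _ _ _
  map_zero' := Subtype.ext <| funext fun _ => map_zero _
  map_add' _ _ := Subtype.ext <| funext fun _ => map_add _ _ _
  commutes' f := Subtype.ext <| funext fun x => involute.commutes (f.1 x)

variable {u v : smoothSections Γ pair} {k l : ℕ}

lemma parity_parity (u : smoothSections Γ pair) : parity Γ pair (parity Γ pair u) = u :=
  Subtype.ext <| funext fun _ => involute_involute _

lemma parity_add (u v : smoothSections Γ pair) :
    parity Γ pair (u + v) = parity Γ pair u + parity Γ pair v :=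
  Subtype.ext <| funext fun _ => map_add _ _ _

lemma parity_smul (c : 𝕜) (u : smoothSections Γ pair) :
    parity Γ pair (c • u) = c • parity Γ pair u :=
  Subtype.ext <| funext fun x => map_smul involute c (u.1 x)

lemma parity_of_hasDeg (hu : HasDeg k u.1) : parity Γ pair u = (-1 : 𝕜) ^ k • u :=
  Subtype.ext <| funext fun x => involute_eq_smul (hu x)

lemma mul_comm_of_parity (hu : parity Γ pair u = (-1 : 𝕜) ^ k • u)
    (hv : parity Γ pair v = (-1 : 𝕜) ^ l • v) : u * v = (-1 : 𝕜) ^ (k * l) • (v * u) :=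
  Subtype.ext <| funext fun x => mul_comm_of_involute (congrFun (congrArg Subtype.val hu) x)
    (congrFun (congrArg Subtype.val hv) x)

lemma exists_algebraMap_eq_of_hasDeg_zero (hu : HasDeg 0 u.1) :
    ∃ f : smoothFun 𝕜 m M, algebraMap _ _ f = u := by
  refine ⟨⟨evalOn pair u.1 [], u.2 []⟩, Subtype.ext <| funext fun x => ?_⟩
  obtain ⟨c, hc⟩ := exteriorPower_zero_eq_algebraMap (hu x)
  change algebraMap 𝕜 _ (algebraMapInv (u.1 x)) = u.1 x
  rw [← hc, algebraMap_leftInverse]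

end SmoothSections

section LieRinehart

variable {𝕜 : Type*} [RCLike 𝕜] {m : ℕ} {M : Type*} [TopologicalSpace M]
  [ChartedSpace (EuclideanSpace ℝ (Fin m)) M]
  {V : M → Type*} [∀ x, AddCommGroup (V x)] [∀ x, Module 𝕜 (V x)]
  {Γ : Submodule (smoothFun 𝕜 m M) (∀ x, V x)}

/-- The sections `Γ` of a Lie algebroid, as a type of its own carrying the Lie–Rinehart structure
over `C^∞(M)` given by the bracket and the anchor. -/
def LieAlgebroid.Sec (_ : LieAlgebroid Γ) : Type _ := Γ

namespace LieAlgebroid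

variable (L : LieAlgebroid Γ)

instance : AddCommGroup L.Sec := inferInstanceAs (AddCommGroup Γ)

instance : Module (smoothFun 𝕜 m M) L.Sec := inferInstanceAs (Module (smoothFun 𝕜 m M) Γ)

instance : LieRing L.Sec where
  bracket X Y := L.bracket X Y
  add_lie := L.bracket.map_add₂
  lie_add X := (L.bracket X).map_add
  lie_self := L.bracket_self
  leibniz_lie := L.jacobi

instance : LieRingModule L.Sec (smoothFun 𝕜 m M) where
  bracket X f := ⟨L.act X f.1, L.anchor_smooth X f.1 f.2⟩
  add_lie X Y f := Subtype.ext <| funext fun x => by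
    change vecDeriv (L.anchor x (X.1 x + Y.1 x)) f.1 = _
    simp [vecDeriv, act]
  lie_add X f g := Subtype.ext <| funext fun x => vecDeriv_fun_add _ f.2 g.2
  leibniz_lie X Y f := Subtype.ext <| funext fun x => by
    exact sub_eq_iff_eq_add.mp (L.anchor_bracket X Y f.1 f.2 x).symm

instance : LieRinehartRing (smoothFun 𝕜 m M) L.Sec where
  lie_smul_eq_mul' f g X := Subtype.ext <| funext fun x => by
    change vecDeriv (L.anchor x (f.1 x • X.1 x)) g.1 = f.1 x * vecDeriv (L.anchor x (X.1 x)) g.1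
    simp [vecDeriv]
  leibniz_mul_right' X f g := Subtype.ext <| funext fun x =>
    (vecDeriv_fun_mul _ f.2 g.2).trans (congrArg _ (mul_comm _ _))
  leibniz_smul_right' X Y f := Subtype.ext <| funext fun x =>
    (L.leibniz X Y f x).trans (add_comm _ _)

end LieAlgebroid

end LieRinehart

section Forms

open CliffordAlgebra hiding ι
open ExteriorAlgebra

variable {𝕜 : Type*} [RCLike 𝕜] {m : ℕ} {M : Type*} [TopologicalSpace M]
  [ChartedSpace (EuclideanSpace ℝ (Fin m)) M]
  {V : M → Type*} [∀ x, AddCommGroup (V x)] [∀ x, Module 𝕜 (V x)]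

/-- The algebra `Γ(⋀A*)` of forms, where `Γ = Γ(A)`. -/
abbrev forms (Γ : Submodule (smoothFun 𝕜 m M) (∀ x, V x)) :=
  smoothSections Γ fun x => Module.Dual.eval 𝕜 (V x)

variable (Γ : Submodule (smoothFun 𝕜 m M) (∀ x, V x))

/-- A form as a cochain on sections: `values α [X₁, …, X_k] = α(X₁, …, X_k)`. -/
def values : forms Γ →ₗ[smoothFun 𝕜 m M] Cochain (smoothFun 𝕜 m M) Γ where
  toFun α Xs := ⟨evalOn _ α.1 Xs, α.2 Xs⟩
  map_add' _ _ := funext fun _ => Subtype.ext <| funext fun _ => evalList_add ..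
  map_smul' _ _ := funext fun _ => Subtype.ext <| funext fun _ => evalList_smul ..

/-- The interior product `i_X` of forms with a section `X`. -/
def contrForm (X : Γ) : forms Γ →ₗ[smoothFun 𝕜 m M] forms Γ where
  toFun α := ⟨fun x => contr (Module.Dual.eval 𝕜 (V x) (X.1 x)) (α.1 x), IsSmoothVia.contr α.2 X⟩
  map_add' _ _ := Subtype.ext <| funext fun _ => map_add ..
  map_smul' f α := Subtype.ext <| funext fun x => map_smul (contr _) (f.1 x) (α.1 x)

variable {Γ}

lemma coe_values_apply (α : forms Γ) (Xs : List Γ) (x : M) :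
    (values Γ α Xs).1 x =
      evalCochain (Module.Dual.eval 𝕜 (V x)) (α.1 x) (Xs.map fun X => X.1 x) := by
  rw [evalCochain_apply, List.map_map]
  rfl

lemma values_mem_altCochains (α : forms Γ) : values Γ α ∈ altCochains (smoothFun 𝕜 m M) Γ := by
  have h (x : M) := evalCochain_mem_altCochains (Module.Dual.eval 𝕜 (V x)) (α.1 x)
  refine fun p l => ⟨fun X Y => ?_, fun f X => ?_, fun X => ?_⟩ <;>
    refine Subtype.ext <| funext fun x => ?_ <;> rw [coe_values_apply, List.map_append]
  · refine ((h x _ _).1 _ _).trans ?_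
    simp only [Subalgebra.coe_add, Pi.add_apply, coe_values_apply, List.map_append, List.map_cons]
  · refine ((h x _ _).2.1 _ _).trans ?_
    simp only [Subalgebra.coe_mul, Pi.mul_apply, coe_values_apply, List.map_append, List.map_cons]
  · exact (h x _ _).2.2 _

variable {n : ℕ} [hΓ : LocallyFree Γ n]
include hΓ

lemma eq_of_values_apply {α β : forms Γ} {x : M}
    (h : ∀ Xs, (values Γ α Xs).1 x = (values Γ β Xs).1 x) : α.1 x = β.1 x := by
  obtain ⟨σ, hσ⟩ := exists_linear_extension Γ x
  have := finiteDimensional_fibre Γ x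
  refine evalCochain_injective (Module.Dual.eval 𝕜 (V x)) (Module.evalEquiv 𝕜 (V x)).surjective
    (funext fun l => ?_)
  have hl : (l.map σ).map (fun X => X.1 x) = l := by simp [Function.comp_def, hσ]
  rw [← hl, ← coe_values_apply, ← coe_values_apply, h]

lemma values_injective : Function.Injective (values Γ) := fun _ _ h =>
  Subtype.ext <| funext fun x => eq_of_values_apply fun Xs => by rw [h]

variable {Φ : Cochain (smoothFun 𝕜 m M) Γ} (hΦ : Φ ∈ altCochains (smoothFun 𝕜 m M) Γ)
include hΦ

lemma apply_cons_eq_zero {X : Γ} {x : M} (hX : X.1 x = 0) (l : List Γ) :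
    (Φ (X :: l)).1 x = 0 := by
  obtain ⟨f, e, θ, hfx, h⟩ := LocallyFree.exists_frame (Γ := Γ) x
  have hfX : f • X = ∑ i, pairing (θ i) X • (f • e i) := Subtype.ext <| funext fun y => by
    rw [coe_sum_section_apply]
    change f.1 y • X.1 y = ∑ i, (θ i).1 y (X.1 y) • f.1 y • (e i).1 y
    obtain hy | hy := eq_or_ne (f.1 y) 0
    · simp [hy]
    · obtain ⟨b, hb⟩ := h y hy
      conv_lhs => rw [← b.sum_repr (X.1 y), Finset.smul_sum]
      refine Finset.sum_congr rfl fun i _ => ?_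
      rw [← (hb i).1, ← (hb i).2, smul_comm, b.coord_apply]
  have hsum : f • ins X Φ = ∑ i, pairing (θ i) X • ins (f • e i) Φ := by
    simp_rw [← ins_smul_left hΦ, hfX, ins_sum_left hΦ]
  have hval := congrArg (fun g : smoothFun 𝕜 m M => g.1 x) (congrFun hsum l)
  simpa [hfx, pairing_apply, hX] using hval

lemma apply_map_extension {x : M} {σ : V x →ₗ[𝕜] Γ} (hσ : ∀ v, (σ v).1 x = v) (l : List Γ) :
    (Φ (l.map fun X => σ (X.1 x))).1 x = (Φ l).1 x := by
  induction l generalizing Φ with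
  | nil => rfl
  | cons X l ih =>
    have h := apply_cons_eq_zero hΦ (X := σ (X.1 x) - X) (sub_eq_zero_of_eq (hσ _)) l
    have hsub := congrFun (ins_sub_left hΦ (σ (X.1 x)) X) l
    rw [List.map_cons, ← ins_apply (Φ := Φ), ih (ins_mem_altCochains hΦ _)]
    rw [← ins_apply (Φ := Φ), hsub] at h
    exact sub_eq_zero.mp h

lemma exists_values_eq : ∃ α : forms Γ, values Γ α = Φ := by
  have hx (x : M) : ∃ α : ExteriorAlgebra 𝕜 (Module.Dual 𝕜 (V x)), ∀ Xs : List Γ,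
      evalCochain (Module.Dual.eval 𝕜 (V x)) α (Xs.map fun X => X.1 x) = (Φ Xs).1 x := by
    obtain ⟨σ, hσ⟩ := exists_linear_extension Γ x
    have hmem : (fun l => (Φ (l.map σ)).1 x) ∈ altCochains 𝕜 (V x) := by
      refine fun p l => ⟨fun v w => ?_, fun c v => ?_, fun v => ?_⟩
      · simp [(hΦ _ _).1]
      · have h := (hΦ (p.map σ) (l.map σ)).2.1 (algebraMap 𝕜 _ c) (σ v)
        simpa using congrArg (fun g : smoothFun 𝕜 m M => g.1 x) h
      · simp [(hΦ _ _).2.2]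
    obtain ⟨α, hα⟩ := exists_evalCochain_eq (exists_basis Γ x).some hmem
    refine ⟨α, fun Xs => ?_⟩
    refine (congrFun hα _).trans ?_
    rw [List.map_map]
    exact apply_map_extension hΦ hσ Xs
  choose α hα using hx
  have hval (Xs : List Γ) : evalOn (fun x => Module.Dual.eval 𝕜 (V x)) α Xs = (Φ Xs).1 :=
    funext fun x => by rw [← hα, evalCochain_apply, List.map_map]; rfl
  exact ⟨⟨α, fun Xs => hval Xs ▸ (Φ Xs).2⟩, funext fun Xs => Subtype.ext (hval Xs)⟩

end Forms

/-! ### The Cartan calculus of a Lie algebroid -/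

namespace LieAlgebroid

open CliffordAlgebra hiding ι
open ExteriorAlgebra

variable {𝕜 : Type*} [RCLike 𝕜] {m : ℕ} {M : Type*} [TopologicalSpace M]
  [ChartedSpace (EuclideanSpace ℝ (Fin m)) M]
  {V : M → Type*} [∀ x, AddCommGroup (V x)] [∀ x, Module 𝕜 (V x)]
  {Γ : Submodule (smoothFun 𝕜 m M) (∀ x, V x)} (L : LieAlgebroid Γ)

/-- A form as a cochain on the sections of a Lie algebroid. -/
def cochain : forms Γ →ₗ[smoothFun 𝕜 m M] Cochain (smoothFun 𝕜 m M) L.Sec := values Γ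

/-- The contraction of forms with a section of a Lie algebroid. -/
def interior : L.Sec → forms Γ →ₗ[smoothFun 𝕜 m M] forms Γ := contrForm Γ

lemma cochain_interior (X : L.Sec) (α : forms Γ) :
    L.cochain (L.interior X α) = ins X (L.cochain α) := rfl

lemma cochain_mem_altCochains (α : forms Γ) :
    L.cochain α ∈ altCochains (smoothFun 𝕜 m M) L.Sec := values_mem_altCochains α

lemma lie_const (X : L.Sec) (c : 𝕜) : ⁅X, algebraMap 𝕜 (smoothFun 𝕜 m M) c⁆ = 0 :=
  Subtype.ext <| funext fun _ => vecDeriv_const _ c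

variable {n : ℕ} [hΓ : LocallyFree Γ n]
include hΓ

lemma cochain_injective : Function.Injective L.cochain := values_injective

lemma exists_cochain_eq {Φ : Cochain (smoothFun 𝕜 m M) L.Sec}
    (hΦ : Φ ∈ altCochains (smoothFun 𝕜 m M) L.Sec) : ∃ α, L.cochain α = Φ :=
  exists_values_eq (Γ := Γ) (Φ := Φ) hΦ

lemma exists_cochain_eq_diff (α : forms Γ) : ∃ β, L.cochain β = diff (L.cochain α) :=
  L.exists_cochain_eq (diff_mem_altCochains (L.cochain_mem_altCochains α))

/-- The Lie algebroid differential of forms. -/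
def extDeriv : forms Γ →ₗ[𝕜] forms Γ where
  toFun α := (L.exists_cochain_eq_diff α).choose
  map_add' α β := L.cochain_injective <| by
    rw [(L.exists_cochain_eq_diff (α + β)).choose_spec, LinearMap.map_add, LinearMap.map_add,
      (L.exists_cochain_eq_diff α).choose_spec, (L.exists_cochain_eq_diff β).choose_spec, map_add]
  map_smul' c α := L.cochain_injective <| by
    have hdc : diffFun L.Sec (algebraMap 𝕜 (smoothFun 𝕜 m M) c) = 0 :=
      LinearMap.ext fun X => L.lie_const X c
    have hcochain (β : forms Γ) : L.cochain (c • β) =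
      algebraMap 𝕜 (smoothFun 𝕜 m M) c • L.cochain β :=
      L.cochain.map_smul (algebraMap 𝕜 (smoothFun 𝕜 m M) c) β
    rw [(L.exists_cochain_eq_diff (c • α)).choose_spec, RingHom.id_apply, hcochain, hcochain,
      (L.exists_cochain_eq_diff α).choose_spec, diff_smul, hdc, wedge_zero_left, add_zero]

lemma cochain_extDeriv (α : forms Γ) : L.cochain (L.extDeriv α) = diff (L.cochain α) :=
  (L.exists_cochain_eq_diff α).choose_spec

lemma extDeriv_extDeriv (α : forms Γ) : L.extDeriv (L.extDeriv α) = 0 :=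
  L.cochain_injective <| by
    rw [cochain_extDeriv, cochain_extDeriv, diff_diff (L.cochain_mem_altCochains α),
      LinearMap.map_zero]

/-- The Lie derivative of forms, by Cartan's formula `𝓛_X = i_X d + d i_X`. -/
def lieForm (X : L.Sec) (α : forms Γ) : forms Γ :=
  L.interior X (L.extDeriv α) + L.extDeriv (L.interior X α)

lemma cochain_lieForm (X : L.Sec) (α : forms Γ) :
    L.cochain (L.lieForm X α) = lieDeriv X (L.cochain α) := by
  rw [lieForm, LinearMap.map_add, cochain_interior, cochain_extDeriv, cochain_extDeriv,
    cochain_interior, ins_diff, sub_add_cancel]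

lemma interior_lieForm (X Y : L.Sec) (α : forms Γ) :
    L.interior Y (L.lieForm X α) =
      L.lieForm X (L.interior Y α) - L.interior ⁅X, Y⁆ α :=
  L.cochain_injective <| by
    rw [LinearMap.map_sub, cochain_interior, cochain_interior, cochain_lieForm, cochain_lieForm,
      cochain_interior, ins_lieDeriv]

lemma lieForm_smul (X : L.Sec) (f : smoothFun 𝕜 m M) (α : forms Γ) :
    L.lieForm X (f • α) = f • L.lieForm X α + ⁅X, f⁆ • α :=
  L.cochain_injective <| by
    simp only [LinearMap.map_add, LinearMap.map_smul, cochain_lieForm, lieDeriv_smul]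

/-- The operator `α ↦ d(f α) - f dα = df ∧ α`. -/
def wedgeDiff (f : smoothFun 𝕜 m M) (α : forms Γ) : forms Γ :=
  L.extDeriv (f • α) - f • L.extDeriv α

lemma cochain_wedgeDiff (f : smoothFun 𝕜 m M) (α : forms Γ) :
    L.cochain (L.wedgeDiff f α) = wedge (diffFun L.Sec f) (L.cochain α) := by
  simp only [wedgeDiff, LinearMap.map_sub, LinearMap.map_smul, cochain_extDeriv, diff_smul,
    add_sub_cancel_left]

lemma wedgeDiff_smul (f g : smoothFun 𝕜 m M) (α : forms Γ) :
    L.wedgeDiff f (g • α) = g • L.wedgeDiff f α :=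
  L.cochain_injective <| by simp only [LinearMap.map_smul, cochain_wedgeDiff]

lemma interior_wedgeDiff (X : L.Sec) (f : smoothFun 𝕜 m M) (α : forms Γ) :
    L.interior X (L.wedgeDiff f α) = ⁅X, f⁆ • α - L.wedgeDiff f (L.interior X α) :=
  L.cochain_injective <| by
    simp only [LinearMap.map_sub, LinearMap.map_smul, cochain_wedgeDiff, cochain_interior,
      ins_wedge, diffFun_apply]

lemma hasDeg_iff_cochain {α : forms Γ} {k : ℕ} :
    HasDeg k α.1 ↔ ∀ l, l.length ≠ k → L.cochain α l = 0 := by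
  set β : forms Γ := ⟨fun x => component k (α.1 x), α.2.component k⟩
  have hβ_apply (l : List L.Sec) (hl : l.length = k) : L.cochain β l = L.cochain α l :=
    Subtype.ext <| funext fun x => (evalList_component _ k (α.1 x)).trans <|
      if_pos ((List.length_map _).trans hl)
  have hβ_zero (l : List L.Sec) (hl : l.length ≠ k) : L.cochain β l = 0 :=
    Subtype.ext <| funext fun x => (evalList_component _ k (α.1 x)).trans <|
      if_neg (ne_of_eq_of_ne (List.length_map _) hl)
  constructor
  · intro hα l hl
    have hβα : β = α := Subtype.ext <| funext fun x => component_of_mem (hα x)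
    rw [← hβα, hβ_zero l hl]
  · intro h x
    have hβα : β = α := L.cochain_injective <| funext fun l => by
      by_cases hl : l.length = k
      · exact hβ_apply l hl
      · rw [hβ_zero l hl, h l hl]
    exact hβα ▸ component_mem k (α.1 x)

lemma hasDeg_extDeriv {α : forms Γ} {k : ℕ} (hα : HasDeg k α.1) :
    HasDeg (k + 1) (L.extDeriv α).1 := by
  rw [L.hasDeg_iff_cochain] at hα ⊢
  intro l hl
  rw [cochain_extDeriv]
  exact diff_apply_eq_zero (L.cochain_mem_altCochains α) hα hl

lemma cartan_eq_cochain (α : forms Γ) (Xs : List L.Sec) :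
    cartan L (fun x => Module.Dual.eval 𝕜 (V x)) α.1 Xs = (L.cochain (L.extDeriv α) Xs).1 := by
  rw [cochain_extDeriv, diff_eq_sum (L.cochain_mem_altCochains α)]
  simp only [Subalgebra.coe_add, AddSubmonoidClass.coe_finsetSum, Subalgebra.coe_mul,
    Subalgebra.coe_pow, Subalgebra.coe_neg, Subalgebra.coe_one]
  have hsign (k : ℕ) (f : M → 𝕜) : (-1 : 𝕜) ^ k • f = (-1) ^ k * f := funext fun x => by simp
  exact congrArg₂ (· + ·) (Finset.sum_congr rfl fun i _ => hsign _ _)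
    (Finset.sum_congr rfl fun i _ => Finset.sum_congr rfl fun j _ => hsign _ _)

lemma isDifferential_iff {D : (∀ x, ExteriorAlgebra 𝕜 (Module.Dual 𝕜 (V x))) →
      ∀ x, ExteriorAlgebra 𝕜 (Module.Dual 𝕜 (V x))} :
    IsDifferential L (fun x => Module.Dual.eval 𝕜 (V x)) D ↔
      ∀ α : forms Γ, D α.1 = (L.extDeriv α).1 := by
  constructor
  · intro hD α
    have hval (Xs : List L.Sec) := (hD α.1 α.2 Xs).trans (L.cartan_eq_cochain α Xs)
    let β : forms Γ := ⟨D α.1, fun Xs => hval Xs ▸ (L.cochain (L.extDeriv α) Xs).2⟩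
    exact congrArg Subtype.val <| L.cochain_injective (a₁ := β) <|
      funext fun Xs => Subtype.ext (hval Xs)
  · intro hD α hα Xs
    exact (congrArg (evalOn _ · Xs) (hD ⟨α, hα⟩)).trans (L.cartan_eq_cochain ⟨α, hα⟩ Xs).symm

lemma dA_coe (α : forms Γ) : dA L α.1 = (L.extDeriv α).1 := by
  classical
  have hex : ∃ D, IsDifferential L (fun x => Module.Dual.eval 𝕜 (V x)) D :=
    ⟨fun α => if hα : α ∈ forms Γ then (L.extDeriv ⟨α, hα⟩).1 else 0,
      L.isDifferential_iff.mpr fun α => dif_pos α.2⟩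
  rw [dA, differential, dif_pos hex]
  exact L.isDifferential_iff.mp hex.choose_spec α

end LieAlgebroid

section Homogeneous

open CliffordAlgebra hiding ι
open ExteriorAlgebra

variable {𝕜 : Type*} [RCLike 𝕜] {m : ℕ} {M : Type*} [TopologicalSpace M]
  [ChartedSpace (EuclideanSpace ℝ (Fin m)) M]
  {V W : M → Type*} [∀ x, AddCommGroup (V x)] [∀ x, Module 𝕜 (V x)]
  [∀ x, AddCommGroup (W x)] [∀ x, Module 𝕜 (W x)]
  {Γ : Submodule (smoothFun 𝕜 m M) (∀ x, V x)}
  {pair : ∀ x, V x →ₗ[𝕜] Module.Dual 𝕜 (W x)}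

lemma smoothSections_induction {n : ℕ} (hfin : ∀ x, FiniteDimensional 𝕜 (W x))
    (hn : ∀ x, Module.finrank 𝕜 (W x) = n) {C : smoothSections Γ pair → Prop}
    (add : ∀ u v, C u → C v → C (u + v)) (mem : ∀ k u, HasDeg k u.1 → C u)
    (u : smoothSections Γ pair) : C u := by
  have hu : ∑ k ∈ Finset.range (n + 1),
      (⟨fun x => component k (u.1 x), u.2.component k⟩ : smoothSections Γ pair) = u :=
    Subtype.ext <| funext fun x => by
      rw [AddSubmonoidClass.coe_finsetSum, Finset.sum_apply]
      exact hn x ▸ sum_component (u.1 x)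
  rw [← hu]
  exact Finset.sum_induction _ C add (mem 0 0 fun _ => zero_mem _) fun k _ =>
    mem k _ fun x => component_mem k (u.1 x)

lemma forms_induction {n : ℕ} [LocallyFree Γ n] {C : forms Γ → Prop}
    (add : ∀ α β, C α → C β → C (α + β)) (mem : ∀ k α, HasDeg k α.1 → C α) (α : forms Γ) : C α :=
  smoothSections_induction (n := n) (fun x => have := finiteDimensional_fibre Γ x; inferInstance)
    (fun x => have := finiteDimensional_fibre Γ x; Subspace.dual_finrank_eq.trans
      (finrank_fibre Γ x)) add mem α

lemma eq_zero_of_hasDeg_lt {n k : ℕ} [LocallyFree Γ n] {α : forms Γ} (hα : HasDeg k α.1)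
    (hk : n < k) : α = 0 :=
  Subtype.ext <| funext fun x => by
    have := finiteDimensional_fibre Γ x
    exact eq_zero_of_finrank_lt (hα x) <| by
      rwa [Subspace.dual_finrank_eq, finrank_fibre Γ x]

lemma LieAlgebroid.parity_extDeriv (L : LieAlgebroid Γ) {n : ℕ} [LocallyFree Γ n] (α : forms Γ) :
    parity Γ _ (L.extDeriv α) = -L.extDeriv (parity Γ _ α) := by
  induction α using forms_induction with
  | add α β hα hβ =>
    rw [LinearMap.map_add, parity_add, hα, hβ, parity_add, LinearMap.map_add, neg_add]
  | mem k α hα =>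
    rw [parity_of_hasDeg hα, parity_of_hasDeg (L.hasDeg_extDeriv hα), LinearMap.map_smul, pow_succ,
      mul_neg_one, neg_smul]

end Homogeneous

section Multivectors

open CliffordAlgebra hiding ι
open ExteriorAlgebra

variable {𝕜 : Type*} [RCLike 𝕜] {m : ℕ} {M : Type*} [TopologicalSpace M]
  [ChartedSpace (EuclideanSpace ℝ (Fin m)) M]
  {V : M → Type*} [∀ x, AddCommGroup (V x)] [∀ x, Module 𝕜 (V x)]

/-- The `C^∞(M)`-algebra `Γ(⋀A)` of multivectors. -/
abbrev multivectors (Γ : Submodule (smoothFun 𝕜 m M) (∀ x, V x)) :=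
  smoothSections (dualSections Γ) fun _ => LinearMap.id

variable {Γ : Submodule (smoothFun 𝕜 m M) (∀ x, V x)}

/-- A section, as a multivector of degree one. -/
def sec : Γ →ₗ[smoothFun 𝕜 m M] multivectors Γ where
  toFun X := ⟨ofSec X.1, isSmoothVia_ofSec fun θ => θ.2 X.1 X.2⟩
  map_add' _ _ := Subtype.ext <| funext fun _ => map_add _ _ _
  map_smul' _ _ := Subtype.ext <| funext fun _ => map_smul _ _ _

lemma hasDeg_sec (X : Γ) : HasDeg 1 (sec X).1 := fun x => ι_mem_exteriorPower (X.1 x)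

variable {n : ℕ} [hΓ : LocallyFree Γ n]
include hΓ

lemma multivectors_induction {C : multivectors Γ → Prop} (add : ∀ u v, C u → C v → C (u + v))
    (mem : ∀ k u, HasDeg k u.1 → C u) (u : multivectors Γ) : C u :=
  smoothSections_induction (finiteDimensional_fibre Γ) (finrank_fibre Γ) add mem u

lemma exists_smul_eq_sum_sec_mul {k : ℕ} {u : multivectors Γ} (hu : HasDeg (k + 1) u.1) (x : M) :
    ∃ (f : smoothFun 𝕜 m M) (X : Fin n → Γ) (v : Fin n → multivectors Γ),
      f.1 x = 1 ∧ (∀ i, HasDeg k (v i).1) ∧ f • u = ∑ i, sec (X i) * v i := by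
  obtain ⟨f, e, θ, hfx, h⟩ := LocallyFree.exists_frame (Γ := Γ) x
  let v (i : Fin n) : multivectors Γ :=
    ⟨fun y => contr ((θ i).1 y) (u.1 y), IsSmoothVia.contr u.2 (θ i)⟩
  let c : smoothFun 𝕜 m M := algebraMap 𝕜 _ (k + 1 : 𝕜)⁻¹
  refine ⟨f, e, fun i => c • f • v i, hfx,
    fun i y => Submodule.smul_mem _ _ (Submodule.smul_mem _ _ (contr_mem _ (hu y))), ?_⟩
  simp_rw [mul_smul_comm]
  rw [← Finset.smul_sum, ← Finset.smul_sum]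
  refine Subtype.ext <| funext fun y => ?_
  change f.1 y • u.1 y = (k + 1 : 𝕜)⁻¹ • f.1 y • (∑ i, sec (e i) * v i).1 y
  obtain hy | hy := eq_or_ne (f.1 y) 0
  · rw [hy, zero_smul, zero_smul, smul_zero]
  · obtain ⟨b, hb⟩ := h y hy
    have euler : (∑ i, sec (e i) * v i).1 y = (k + 1 : 𝕜) • u.1 y := by
      rw [← Nat.cast_succ, ← sum_ι_mul_contr_coord b (hu y), AddSubmonoidClass.coe_finsetSum,
        Finset.sum_apply]
      simp_rw [hb]
      rfl
    rw [euler, smul_comm, inv_smul_smul₀ (Nat.cast_add_one_ne_zero k)]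

lemma exists_smul_mem_adjoin (u : multivectors Γ) (x : M) : ∃ f : smoothFun 𝕜 m M,
    f.1 x = 1 ∧ f • u ∈ Algebra.adjoin (smoothFun 𝕜 m M) (Set.range (sec (Γ := Γ))) := by
  set S := Algebra.adjoin (smoothFun 𝕜 m M) (Set.range (sec (Γ := Γ)))
  change u ∈ localSpan (Subalgebra.toSubmodule S) x
  induction u using multivectors_induction with
  | add u v hu hv => exact add_mem hu hv
  | mem k u hu =>
    induction k generalizing u with
    | zero =>
      obtain ⟨g, rfl⟩ := exists_algebraMap_eq_of_hasDeg_zero hu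
      exact ⟨1, rfl, by rw [one_smul]; exact S.algebraMap_mem g⟩
    | succ k ih =>
      obtain ⟨f, X, v, hf, hv, hsum⟩ := exists_smul_eq_sum_sec_mul hu x
      refine mem_localSpan_of_smul_mem hf ?_
      rw [hsum]
      refine sum_mem fun i _ => ?_
      obtain ⟨g, hg, hgv⟩ := ih (v i) (hv i)
      refine ⟨g, hg, ?_⟩
      rw [← mul_smul_comm]
      exact S.mul_mem (Algebra.subset_adjoin (Set.mem_range_self (X i))) hgv

lemma multivectors_generator_induction {C : multivectors Γ → Prop}
    (algebraMap : ∀ f, C (algebraMap (smoothFun 𝕜 m M) _ f)) (sec : ∀ X, C (sec X))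
    (add : ∀ u v, C u → C v → C (u + v)) (mul : ∀ u v, C u → C v → C (u * v))
    (of_locally : ∀ u, (∀ x, ∃ f : smoothFun 𝕜 m M, f.1 x = 1 ∧ C (f • u)) → C u)
    (u : multivectors Γ) : C u :=
  of_locally u fun x => by
    obtain ⟨f, hf, hu⟩ := exists_smul_mem_adjoin u x
    refine ⟨f, hf, ?_⟩
    generalize f • u = v at hu
    induction hu using Algebra.adjoin_induction with
    | mem _ h => exact h.elim fun X hX => hX ▸ sec X
    | algebraMap f => exact algebraMap f
    | add u v _ _ hu hv => exact add u v hu hv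
    | mul u v _ _ hu hv => exact mul u v hu hv

end Multivectors

section KoszulBracket

variable {R U : Type*} [CommRing R] [Ring U] [Algebra R U] (σ : U →ₐ[R] U) (D : U →ₗ[R] U)

/-- The bracket generated by an odd operator `D` on a `ℤ/2`-graded algebra with grading involution
`σ`: up to the sign `(-1)^k`, where `k` is the degree of `u`, the failure of `D` to be a derivation
on `u * v`. -/
def koszulBracket : U →ₗ[R] U →ₗ[R] U :=
  LinearMap.mk₂ R (fun u v => D (σ u * v) - D (σ u) * v - u * D v)
    (fun u u' v => by simp only [map_add, add_mul]; abel)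
    (fun c u v => by simp only [map_smul, smul_mul_assoc, smul_sub])
    (fun u v v' => by simp only [map_add, mul_add]; abel)
    (fun c u v => by simp only [map_smul, mul_smul_comm, smul_sub])

variable {σ D} {u v : U} {k l : ℕ}

lemma koszulBracket_apply (u v : U) :
    koszulBracket σ D u v = D (σ u * v) - D (σ u) * v - u * D v := rfl

lemma koszulBracket_of_parity (hu : σ u = (-1 : R) ^ k • u) (v : U) :
    koszulBracket σ D u v = (-1 : R) ^ k • (D (u * v) - D u * v) - u * D v := by
  rw [koszulBracket_apply, hu, map_smul, smul_mul_assoc, smul_mul_assoc, map_smul, smul_sub]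

lemma parity_koszulBracket (hσσ : ∀ u, σ (σ u) = u) (hσD : ∀ u, σ (D u) = -D (σ u)) (u v : U) :
    σ (koszulBracket σ D u v) = -koszulBracket σ D (σ u) (σ v) := by
  simp only [koszulBracket_apply, map_sub, map_mul, hσD, hσσ]
  noncomm_ring

section Commutative

variable (hσD : ∀ u, σ (D u) = -D (σ u))
  (hcomm : ∀ {u v k l}, σ u = (-1 : R) ^ k • u → σ v = (-1 : R) ^ l • v →
    u * v = (-1 : R) ^ (k * l) • (v * u))
include hcomm

include hσD in
lemma koszulBracket_skew (hu : σ u = (-1 : R) ^ k • u) (hv : σ v = (-1 : R) ^ l • v) :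
    koszulBracket σ D u v = -((-1 : R) ^ ((k + 1) * (l + 1)) • koszulBracket σ D v u) := by
  have parity_D {w : U} {j : ℕ} (hw : σ w = (-1 : R) ^ j • w) :
      σ (D w) = (-1 : R) ^ (j + 1) • D w := by
    rw [hσD, hw, map_smul, pow_succ, mul_neg_one, neg_smul]
  rw [koszulBracket_of_parity hu, koszulBracket_of_parity hv, hcomm hu hv,
    hcomm (parity_D hu) hv, hcomm hu (parity_D hv)]
  obtain hk | hk := neg_one_pow_eq_or R k <;> obtain hl | hl := neg_one_pow_eq_or R l <;>
    simp [hk, hl, pow_mul, pow_add] <;> abel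

lemma koszulBracket_leibniz_swap (hu : σ u = (-1 : R) ^ k • u) (hv : σ v = (-1 : R) ^ l • v) {w : U}
    (h : koszulBracket σ D u (v * w) =
      koszulBracket σ D u v * w + (-1 : R) ^ ((k + 1) * l) • (v * koszulBracket σ D u w)) :
    koszulBracket σ D v (u * w) =
      koszulBracket σ D v u * w + (-1 : R) ^ ((l + 1) * k) • (u * koszulBracket σ D v w) := by
  have huv (w : U) : v * (u * w) = (-1 : R) ^ (l * k) • (u * (v * w)) := by
    rw [← mul_assoc, hcomm hv hu, smul_mul_assoc, mul_assoc]
  simp only [koszulBracket_of_parity hu, koszulBracket_of_parity hv, hcomm hv hu, huv] at h ⊢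
  obtain hk | hk := neg_one_pow_eq_or R k <;> obtain hl | hl := neg_one_pow_eq_or R l <;>
    simp only [add_mul k, add_mul l, pow_add, pow_mul, one_mul, hk, hl, one_pow, mul_one, neg_mul,
      mul_neg, neg_neg, one_smul, neg_smul, map_neg, mul_sub, sub_mul, neg_sub, mul_assoc, huv]
      at h ⊢ <;>
    first | linear_combination (norm := abel1) h | linear_combination (norm := abel1) -h

end Commutative

section Laplacian

variable {d : U →ₗ[R] U} (hσD : ∀ u, σ (D u) = -D (σ u)) (hσd : ∀ u, σ (d u) = -d (σ u))
  (hσσ : ∀ u, σ (σ u) = u) (hd : ∀ u v, d (u * v) = d u * v + σ u * d v)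
  (hbracket : ∀ u v, d (koszulBracket σ D u v) =
    koszulBracket σ D (d u) v - koszulBracket σ D (σ u) (d v))

include hσD hσd hσσ hd hbracket

lemma laplacian_mul (u v : U) : d (D (u * v)) + D (d (u * v)) =
    (d (D u) + D (d u)) * v + u * (d (D v) + D (d v)) := by
  have D_mul (u v : U) : D (u * v) = D u * v + σ u * D v + koszulBracket σ D (σ u) v := by
    rw [koszulBracket_apply, hσσ]
    abel
  simp only [D_mul, hd, map_add, hbracket, hσσ, hσD, hσd, map_neg, LinearMap.neg_apply]
  noncomm_ring

lemma laplacian_koszulBracket (hDD : ∀ u, D (D u) = 0) (u v : U) :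
    d (D (koszulBracket σ D u v)) + D (d (koszulBracket σ D u v)) =
      koszulBracket σ D (d (D u) + D (d u)) v + koszulBracket σ D u (d (D v) + D (d v)) := by
  set Δ : U →ₗ[R] U := d ∘ₗ D + D ∘ₗ d
  have Δ_mul (u v : U) : Δ (u * v) = Δ u * v + u * Δ v :=
    laplacian_mul hσD hσd hσσ hd hbracket u v
  have Δ_D (u : U) : Δ (D u) = D (Δ u) := by simp [Δ, hDD]
  have Δ_σ (u : U) : σ (Δ u) = Δ (σ u) := by simp [Δ, hσD, hσd]
  change Δ (koszulBracket σ D u v) = koszulBracket σ D (Δ u) v + koszulBracket σ D u (Δ v)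
  simp only [koszulBracket_apply, map_sub, map_add, Δ_mul, Δ_D, Δ_σ]
  noncomm_ring

end Laplacian

end KoszulBracket

section Volume

open CliffordAlgebra hiding ι
open ExteriorAlgebra

variable {𝕜 : Type*} [RCLike 𝕜] {m : ℕ} {M : Type*} [TopologicalSpace M]
  [ChartedSpace (EuclideanSpace ℝ (Fin m)) M]
  {V : M → Type*} [∀ x, AddCommGroup (V x)] [∀ x, Module 𝕜 (V x)]
  {Γ : Submodule (smoothFun 𝕜 m M) (∀ x, V x)}

lemma isSmoothVia_of_locally {W : M → Type*} [∀ x, AddCommGroup (W x)] [∀ x, Module 𝕜 (W x)]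
    {pair : ∀ x, V x →ₗ[𝕜] Module.Dual 𝕜 (W x)} {α : ∀ x, ExteriorAlgebra 𝕜 (W x)}
    (h : ∀ x, ∃ f : smoothFun 𝕜 m M, f.1 x ≠ 0 ∧ IsSmoothVia Γ pair fun y => f.1 y • α y) :
    IsSmoothVia Γ pair α := fun Xs => mem_smoothFun_of_mul_mem fun x => by
  obtain ⟨f, hf, hα⟩ := h x
  have heval : evalOn pair (fun y => f.1 y • α y) Xs = f.1 * evalOn pair α Xs :=
    funext fun y => evalList_smul _ _ _
  exact ⟨f.1, f.2, hf, heval ▸ hα Xs⟩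

/-- A volume form of a bundle of rank `n`: a nowhere vanishing form of degree `n`. -/
structure IsVolume (n : ℕ) (Ω : forms Γ) : Prop where
  hasDeg : HasDeg n Ω.1
  ne_zero : ∀ x, Ω.1 x ≠ 0

variable {n : ℕ} [hΓ : LocallyFree Γ n]
include hΓ

lemma isSmoothVia_interiorMul (u : multivectors Γ) (α : forms Γ) :
    IsSmoothVia Γ (fun x => Module.Dual.eval 𝕜 (V x)) fun x => interiorMul (u.1 x) (α.1 x) := by
  induction u using multivectors_generator_induction generalizing α with
  | algebraMap f =>
    have h : (fun x => interiorMul ((algebraMap _ (multivectors Γ) f).1 x) (α.1 x)) = (f • α).1 :=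
      funext fun x => interiorMul_algebraMap _ _
    exact h ▸ (f • α).2
  | sec X =>
    have h : (fun x => interiorMul ((sec X).1 x) (α.1 x)) = (contrForm Γ X α).1 :=
      funext fun x => interiorMul_ι _ _
    exact h ▸ (contrForm Γ X α).2
  | add u v hu hv =>
    have h : (fun x => interiorMul ((u + v).1 x) (α.1 x)) =
        (fun x => interiorMul (u.1 x) (α.1 x)) + fun x => interiorMul (v.1 x) (α.1 x) :=
      funext fun x => congrArg (· (α.1 x)) (map_add interiorMul (u.1 x) (v.1 x))
    exact h ▸ (hu α).add (hv α)
  | mul u v hu hv =>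
    have h : (fun x => interiorMul ((u * v).1 x) (α.1 x)) =
        fun x => interiorMul (v.1 x) (interiorMul (u.1 x) (α.1 x)) :=
      funext fun x => interiorMul_mul _ _ _
    exact h ▸ hv ⟨_, hu α⟩
  | of_locally u h =>
    refine isSmoothVia_of_locally fun x => ?_
    obtain ⟨f, hf, hu⟩ := h x
    have hfu : (fun y => f.1 y • interiorMul (u.1 y) (α.1 y)) =
        fun y => interiorMul ((f • u).1 y) (α.1 y) :=
      funext fun y => congrArg (· (α.1 y)) (map_smul interiorMul (f.1 y) (u.1 y)).symm
    exact ⟨f, hf ▸ one_ne_zero, hfu ▸ hu α⟩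

/-- The map `Ω♯ : u ↦ i_u Ω` from multivectors to forms. -/
def sharpForm (Ω : forms Γ) : multivectors Γ →ₗ[smoothFun 𝕜 m M] forms Γ where
  toFun u := ⟨fun x => interiorMul (u.1 x) (Ω.1 x), isSmoothVia_interiorMul u Ω⟩
  map_add' u v := Subtype.ext <| funext fun x =>
    congrArg (· (Ω.1 x)) (map_add interiorMul (u.1 x) (v.1 x))
  map_smul' f u := Subtype.ext <| funext fun x =>
    congrArg (· (Ω.1 x)) (map_smul interiorMul (f.1 x) (u.1 x))

namespace IsVolume

variable {Ω : forms Γ} (hΩ : IsVolume n Ω)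
include hΩ

lemma mem_top (x : M) : Ω.1 x ∈ ⋀[𝕜]^(Module.finrank 𝕜 (V x)) (Module.Dual 𝕜 (V x)) := by
  rw [finrank_fibre Γ x]
  exact hΩ.hasDeg x

lemma interiorMul_contr (x : M) (η : Module.Dual 𝕜 (V x)) (u : ExteriorAlgebra 𝕜 (V x)) :
    interiorMul (contr η u) (Ω.1 x) =
      -((-1 : 𝕜) ^ n • (ι 𝕜 η * involute (interiorMul u (Ω.1 x)))) := by
  have := finiteDimensional_fibre Γ x
  have hι := ι_mul_interiorMul η (involute u) (Ω.1 x)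
  have hinv := interiorMul_involute u (Ω.1 x)
  rw [involute_eq_smul (hΩ.hasDeg x), map_smul] at hinv
  rw [ι_mul_eq_zero_of_top (hΩ.mem_top x), map_zero, zero_sub, involute_involute] at hι
  rw [← hinv, mul_smul_comm, smul_smul, ← mul_pow, hι]
  simp

lemma isSmoothVia_of_sharp {u : ∀ x, ExteriorAlgebra 𝕜 (V x)}
    (hu : IsSmoothVia Γ (fun x => Module.Dual.eval 𝕜 (V x)) fun x => interiorMul (u x) (Ω.1 x)) :
    IsSmoothVia (dualSections Γ) (fun _ => LinearMap.id) u := by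
  intro θs
  induction θs generalizing u with
  | nil =>
    refine mem_smoothFun_of_mul_mem fun x => ?_
    obtain ⟨Xs, hXs⟩ : ∃ Xs, (values Γ Ω Xs).1 x ≠ 0 := by
      by_contra! h
      refine hΩ.ne_zero x (eq_of_values_apply (β := 0) fun Xs => ?_)
      rw [h Xs, LinearMap.map_zero]
      rfl
    refine ⟨_, (values Γ Ω Xs).2, hXs, ?_⟩
    have htop (y : M) : component n (interiorMul (u y) (Ω.1 y)) =
        algebraMapInv (u y) • Ω.1 y := by
      have := finiteDimensional_fibre Γ y
      rw [component_sharp (hΩ.mem_top y) (i := 0) (by rw [finrank_fibre Γ y, zero_add])]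
      rw [component_zero, interiorMul_algebraMap]
    have heval : (values Γ Ω Xs).1 * evalOn (fun _ => LinearMap.id) u ([] : List (dualSections Γ)) =
        evalOn (fun x => Module.Dual.eval 𝕜 (V x))
          (fun y => component n (interiorMul (u y) (Ω.1 y))) Xs := funext fun y => by
      simp only [htop, evalOn, evalList_smul]
      exact mul_comm _ _
    exact heval ▸ hu.component n Xs
  | cons θ _ ih =>
    refine ih ?_
    have h : (fun x => interiorMul (contr (θ.1 x) (u x)) (Ω.1 x)) =
        fun x => -((-1 : 𝕜) ^ n • (ι 𝕜 (θ.1 x) * involute (interiorMul (u x) (Ω.1 x)))) :=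
      funext fun x => hΩ.interiorMul_contr x _ _
    have hθ : IsSmoothVia Γ (fun x => Module.Dual.eval 𝕜 (V x)) (ofSec θ.1) :=
      isSmoothVia_ofSec fun X => θ.2 X.1 X.2
    exact h ▸ (-((-1 : 𝕜) ^ n • (⟨_, hθ.mul hu.involute⟩ : forms Γ))).2

/-- The isomorphism `Ω♯` of multivectors with forms. -/
def sharpEquiv : multivectors Γ ≃ₗ[smoothFun 𝕜 m M] forms Γ :=
  LinearEquiv.ofBijective (sharpForm Ω) <| by
    have sharp_bijective (x : M) :
        Function.Bijective (interiorMul.flip (Ω.1 x) : ExteriorAlgebra 𝕜 (V x) →ₗ[𝕜] _) := by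
      have := finiteDimensional_fibre Γ x
      exact ⟨sharp_injective (hΩ.mem_top x) (hΩ.ne_zero x),
        sharp_surjective (hΩ.mem_top x) (hΩ.ne_zero x)⟩
    refine ⟨fun u v huv => Subtype.ext <| funext fun x => (sharp_bijective x).1 <|
      congrFun (congrArg Subtype.val huv) x, fun α => ?_⟩
    choose u hu using fun x => (sharp_bijective x).2 (α.1 x)
    refine ⟨⟨u, hΩ.isSmoothVia_of_sharp ?_⟩, Subtype.ext (funext hu)⟩
    exact (funext hu : (fun x => interiorMul (u x) (Ω.1 x)) = α.1) ▸ α.2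

end IsVolume

end Volume

namespace IsVolume

open CliffordAlgebra hiding ι
open ExteriorAlgebra

variable {𝕜 : Type*} [RCLike 𝕜] {m : ℕ} {M : Type*} [TopologicalSpace M]
  [ChartedSpace (EuclideanSpace ℝ (Fin m)) M]
  {V : M → Type*} [∀ x, AddCommGroup (V x)] [∀ x, Module 𝕜 (V x)]
  {Γ : Submodule (smoothFun 𝕜 m M) (∀ x, V x)} {n : ℕ} [hΓ : LocallyFree Γ n]
  {Ω : forms Γ} (hΩ : IsVolume n Ω) (L : LieAlgebroid Γ)
include hΩ

/-- The operator `∂` of `Γ(⋀A)`, determined by `Ω♯(∂u) = (-1)^k d(Ω♯u)` for `u` of degree `k`. -/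
def divergence : multivectors Γ →ₗ[𝕜] multivectors Γ where
  toFun u := hΩ.sharpEquiv.symm (L.extDeriv (sharpForm Ω (parity (dualSections Γ) _ u)))
  map_add' u v := by
    rw [parity_add, LinearMap.map_add, LinearMap.map_add, LinearEquiv.map_add]
  map_smul' c u := by
    have hsharp (w : multivectors Γ) : sharpForm Ω (c • w) = c • sharpForm Ω w :=
      Subtype.ext <| funext fun x => congrArg (· (Ω.1 x)) (map_smul interiorMul c (w.1 x))
    rw [parity_smul, hsharp, LinearMap.map_smul, LinearEquiv.symm_apply_eq]
    exact ((hsharp _).trans (congrArg _ (hΩ.sharpEquiv.apply_symm_apply _))).symm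

lemma sharpForm_divergence (u : multivectors Γ) :
    sharpForm Ω (hΩ.divergence L u) = L.extDeriv (sharpForm Ω (parity (dualSections Γ) _ u)) :=
  hΩ.sharpEquiv.apply_symm_apply _

lemma sharpForm_injective : Function.Injective (sharpForm Ω) := hΩ.sharpEquiv.injective

lemma del_coe (u : multivectors Γ) : del L Ω.1 u.1 = (hΩ.divergence L u).1 := funext fun x => by
  have := finiteDimensional_fibre Γ x
  have hdA := L.dA_coe (sharpForm Ω (parity (dualSections Γ) _ u))
  rw [← hΩ.sharpForm_divergence] at hdA
  exact (congrArg (Function.invFun (sharp (Ω.1 x))) (congrFun hdA x)).trans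
    (Function.leftInverse_invFun (sharp_injective (hΩ.mem_top x) (hΩ.ne_zero x)) _)

lemma parity_sharpForm (u : multivectors Γ) :
    parity Γ _ (sharpForm Ω u) = (-1 : 𝕜) ^ n • sharpForm Ω (parity (dualSections Γ) _ u) :=
  Subtype.ext <| funext fun x => by
    have h := interiorMul_involute (u.1 x) (Ω.1 x)
    rw [involute_eq_smul (hΩ.hasDeg x), map_smul] at h
    exact h.symm

lemma parity_divergence (u : multivectors Γ) :
    parity (dualSections Γ) _ (hΩ.divergence L u) =
      -hΩ.divergence L (parity (dualSections Γ) _ u) := by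
  refine hΩ.sharpForm_injective ?_
  have h : (-1 : 𝕜) ^ n • sharpForm Ω (parity (dualSections Γ) _ (hΩ.divergence L u)) =
      -((-1 : 𝕜) ^ n • sharpForm Ω (hΩ.divergence L (parity (dualSections Γ) _ u))) := by
    rw [← parity_sharpForm hΩ, sharpForm_divergence, LieAlgebroid.parity_extDeriv,
      parity_sharpForm hΩ, LinearMap.map_smul, sharpForm_divergence]
  rw [LinearMap.map_neg]
  rcases neg_one_pow_eq_or 𝕜 n with hn | hn
  · rwa [hn, one_smul, one_smul] at h
  · rwa [hn, neg_smul, neg_smul, one_smul, one_smul, neg_inj] at h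

lemma divergence_divergence (u : multivectors Γ) : hΩ.divergence L (hΩ.divergence L u) = 0 := by
  refine hΩ.sharpForm_injective ?_
  rw [sharpForm_divergence, parity_divergence, LinearMap.map_neg, LinearMap.map_neg,
    sharpForm_divergence, LieAlgebroid.extDeriv_extDeriv, neg_zero, LinearMap.map_zero]

lemma divergence_algebraMap (f : smoothFun 𝕜 m M) :
    hΩ.divergence L (algebraMap _ _ f) = 0 := by
  have hsharp : sharpForm Ω (algebraMap _ _ f) = f • Ω :=
    Subtype.ext <| funext fun x => interiorMul_algebraMap _ _
  have hdeg : HasDeg n (f • Ω).1 := fun x => Submodule.smul_mem _ _ (hΩ.hasDeg x)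
  refine hΩ.sharpForm_injective ?_
  rw [sharpForm_divergence, AlgHom.commutes, hsharp, LinearMap.map_zero]
  exact eq_zero_of_hasDeg_lt (L.hasDeg_extDeriv hdeg) n.lt_succ_self

lemma hasDeg_divergence {u : multivectors Γ} {k : ℕ} (hu : HasDeg (k + 1) u.1) :
    HasDeg k (hΩ.divergence L u).1 := by
  intro x
  have := finiteDimensional_fibre Γ x
  have hrank := finrank_fibre Γ x
  obtain hk | ⟨j, hj⟩ := (lt_or_ge n (k + 1)).imp_right Nat.exists_eq_add_of_le
  · have hu₀ : u = 0 := Subtype.ext <| funext fun y => by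
      have := finiteDimensional_fibre Γ y
      exact eq_zero_of_finrank_lt (hu y) (by rwa [finrank_fibre Γ y])
    rw [hu₀, LinearMap.map_zero]
    exact zero_mem _
  · have hsharp : HasDeg j (sharpForm Ω (parity (dualSections Γ) _ u)).1 := fun y =>
      interiorMul_mem (involute_eq_smul (hu y) ▸ Submodule.smul_mem _ _ (hu y))
        (hj ▸ hΩ.hasDeg y)
    refine mem_exteriorPower_of_sharp_mem (hΩ.mem_top x) (hΩ.ne_zero x) (j := j + 1)
      (by omega) ?_
    have h := L.hasDeg_extDeriv hsharp x
    rwa [← hΩ.sharpForm_divergence] at h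

/-- The bracket generated by `∂`. -/
def bracket : multivectors Γ →ₗ[𝕜] multivectors Γ →ₗ[𝕜] multivectors Γ :=
  koszulBracket ((parity (dualSections Γ) _).restrictScalars 𝕜) (hΩ.divergence L)

end IsVolume

section Bracket

open CliffordAlgebra hiding ι
open ExteriorAlgebra

variable {𝕜 : Type*} [RCLike 𝕜] {m : ℕ} {M : Type*} [TopologicalSpace M]
  [ChartedSpace (EuclideanSpace ℝ (Fin m)) M]
  {V : M → Type*} [∀ x, AddCommGroup (V x)] [∀ x, Module 𝕜 (V x)]
  {Γ : Submodule (smoothFun 𝕜 m M) (∀ x, V x)} (L : LieAlgebroid Γ)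

/-- A section of the Lie algebroid, as a multivector of degree one. -/
def LieAlgebroid.sec (X : L.Sec) : multivectors Γ := LieBialg.sec X

lemma LieAlgebroid.sec_mul (X : L.Sec) (u : multivectors Γ) :
    L.sec X * u = parity (dualSections Γ) _ u * L.sec X :=
  Subtype.ext <| funext fun x => ι_mul_eq_involute_mul (X.1 x) (u.1 x)

lemma LieAlgebroid.parity_sec (X : L.Sec) :
    parity (dualSections Γ) _ (L.sec X) = -L.sec X :=
  Subtype.ext <| funext fun x => involute_ι (X.1 x)

variable {n : ℕ} [hΓ : LocallyFree Γ n] {Ω : forms Γ}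
include hΓ

lemma LieAlgebroid.sharpForm_sec_mul (X : L.Sec) (u : multivectors Γ) :
    sharpForm Ω (L.sec X * u) = L.interior X (sharpForm Ω (parity (dualSections Γ) _ u)) := by
  rw [L.sec_mul]
  refine Subtype.ext <| funext fun x => ?_
  exact (interiorMul_mul _ _ _).trans (interiorMul_ι _ _)

namespace IsVolume

variable (hΩ : IsVolume n Ω)
include hΩ

lemma parity_bracket (u v : multivectors Γ) :
    parity (dualSections Γ) _ (hΩ.bracket L u v) =
      -hΩ.bracket L (parity (dualSections Γ) _ u) (parity (dualSections Γ) _ v) :=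
  parity_koszulBracket (σ := (parity (dualSections Γ) fun _ => .id).restrictScalars 𝕜)
    (fun u => parity_parity u) (fun u => hΩ.parity_divergence L u) u v

lemma bracket_one (u : multivectors Γ) : hΩ.bracket L u 1 = 0 := by
  have h : hΩ.divergence L 1 = 0 := by
    rw [← (algebraMap (smoothFun 𝕜 m M) (multivectors Γ)).map_one, hΩ.divergence_algebraMap L 1]
  refine (koszulBracket_apply _ _).trans ?_
  rw [mul_one, mul_one, h, mul_zero, sub_self, zero_sub, neg_zero]

lemma sharpForm_bracket_algebraMap (f : smoothFun 𝕜 m M) (u : multivectors Γ) :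
    sharpForm Ω (hΩ.bracket L (algebraMap _ _ f) u) =
      L.wedgeDiff f (sharpForm Ω (parity (dualSections Γ) _ u)) := by
  have h : hΩ.bracket L (algebraMap _ _ f) u =
      hΩ.divergence L (f • u) - f • hΩ.divergence L u := by
    refine (koszulBracket_apply _ _).trans ?_
    rw [AlgHom.restrictScalars_apply, AlgHom.commutes, divergence_algebraMap, zero_mul, sub_zero,
      ← Algebra.smul_def, ← Algebra.smul_def]
  rw [h, LinearMap.map_sub, LinearMap.map_smul, sharpForm_divergence, sharpForm_divergence,
    map_smul (parity (dualSections Γ) _), LinearMap.map_smul, LieAlgebroid.wedgeDiff]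

lemma sharpForm_divergence_sec_mul (X : L.Sec) (u : multivectors Γ) :
    sharpForm Ω (hΩ.divergence L (L.sec X * u)) =
      -L.extDeriv (L.interior X (sharpForm Ω u)) := by
  rw [sharpForm_divergence, map_mul, L.parity_sec, neg_mul, LinearMap.map_neg, LinearMap.map_neg,
    L.sharpForm_sec_mul, parity_parity u]

lemma sharpForm_sec_mul_divergence (X : L.Sec) (u : multivectors Γ) :
    sharpForm Ω (L.sec X * hΩ.divergence L u) =
      -L.interior X (L.extDeriv (sharpForm Ω u)) := by
  rw [L.sharpForm_sec_mul, parity_divergence, LinearMap.map_neg, LinearMap.map_neg,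
    sharpForm_divergence, parity_parity u]

lemma exists_sharpForm_bracket_sec (X : L.Sec) : ∃ g : smoothFun 𝕜 m M, ∀ u : multivectors Γ,
    sharpForm Ω (hΩ.bracket L (L.sec X) u) =
      L.lieForm X (sharpForm Ω u) + g • sharpForm Ω u := by
  obtain ⟨g, hg⟩ := exists_algebraMap_eq_of_hasDeg_zero
    (hΩ.hasDeg_divergence L (u := L.sec X) (hasDeg_sec X))
  refine ⟨g, fun u => ?_⟩
  have h : hΩ.bracket L (L.sec X) u =
      -hΩ.divergence L (L.sec X * u) + g • u - L.sec X * hΩ.divergence L u := by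
    refine (koszulBracket_apply _ _).trans ?_
    rw [AlgHom.restrictScalars_apply, L.parity_sec, neg_mul, LinearMap.map_neg, LinearMap.map_neg,
      ← hg, neg_mul, sub_neg_eq_add, ← Algebra.smul_def]
  rw [h, LinearMap.map_sub, LinearMap.map_add, LinearMap.map_neg, LinearMap.map_smul,
    sharpForm_divergence_sec_mul, sharpForm_sec_mul_divergence, LieAlgebroid.lieForm]
  abel

lemma bracket_algebraMap_smul (f g : smoothFun 𝕜 m M) (u : multivectors Γ) :
    hΩ.bracket L (algebraMap _ _ f) (g • u) = g • hΩ.bracket L (algebraMap _ _ f) u :=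
  hΩ.sharpForm_injective <| by
    rw [LinearMap.map_smul (sharpForm Ω), sharpForm_bracket_algebraMap,
      sharpForm_bracket_algebraMap, map_smul (parity (dualSections Γ) _), LinearMap.map_smul,
      LieAlgebroid.wedgeDiff_smul]

lemma sharpForm_sec_mul_bracket_algebraMap (f : smoothFun 𝕜 m M) (Y : L.Sec)
    (u : multivectors Γ) :
    sharpForm Ω (L.sec Y * hΩ.bracket L (algebraMap _ _ f) u) =
      -L.interior Y (L.wedgeDiff f (sharpForm Ω u)) := by
  rw [L.sharpForm_sec_mul, parity_bracket, AlgHom.commutes, LinearMap.map_neg, LinearMap.map_neg,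
    sharpForm_bracket_algebraMap, parity_parity u]

lemma sharpForm_bracket_algebraMap_sec_mul (f : smoothFun 𝕜 m M) (Y : L.Sec)
    (u : multivectors Γ) :
    sharpForm Ω (hΩ.bracket L (algebraMap _ _ f) (L.sec Y * u)) =
      -L.wedgeDiff f (L.interior Y (sharpForm Ω u)) := by
  have hneg (α : forms Γ) : L.wedgeDiff f (-α) = -L.wedgeDiff f α := by
    simpa using L.wedgeDiff_smul f (-1) α
  rw [sharpForm_bracket_algebraMap, map_mul, L.parity_sec, neg_mul, LinearMap.map_neg,
    L.sharpForm_sec_mul, parity_parity u, hneg]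

lemma bracket_algebraMap_sec_mul (f : smoothFun 𝕜 m M) (Y : L.Sec) (u : multivectors Γ) :
    hΩ.bracket L (algebraMap _ _ f) (L.sec Y * u) =
      -(⁅Y, f⁆ • u) - L.sec Y * hΩ.bracket L (algebraMap _ _ f) u :=
  hΩ.sharpForm_injective <| by
    rw [LinearMap.map_sub, LinearMap.map_neg, LinearMap.map_smul,
      sharpForm_sec_mul_bracket_algebraMap, sharpForm_bracket_algebraMap_sec_mul,
      LieAlgebroid.interior_wedgeDiff]
    abel

lemma bracket_sec_smul (X : L.Sec) (g : smoothFun 𝕜 m M) (u : multivectors Γ) :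
    hΩ.bracket L (L.sec X) (g • u) = ⁅X, g⁆ • u + g • hΩ.bracket L (L.sec X) u := by
  obtain ⟨h, hX⟩ := hΩ.exists_sharpForm_bracket_sec L X
  refine hΩ.sharpForm_injective ?_
  rw [hX, LinearMap.map_smul, LieAlgebroid.lieForm_smul, LinearMap.map_add, LinearMap.map_smul,
    LinearMap.map_smul, hX]
  module

lemma bracket_sec_sec_mul (X Y : L.Sec) (u : multivectors Γ) :
    hΩ.bracket L (L.sec X) (L.sec Y * u) =
      L.sec ⁅X, Y⁆ * u + L.sec Y * hΩ.bracket L (L.sec X) u := by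
  obtain ⟨h, hX⟩ := hΩ.exists_sharpForm_bracket_sec L X
  have hparity : parity (dualSections Γ) _ (hΩ.bracket L (L.sec X) u) =
      hΩ.bracket L (L.sec X) (parity (dualSections Γ) _ u) := by
    rw [parity_bracket, L.parity_sec, LinearMap.map_neg, LinearMap.neg_apply, neg_neg]
  refine hΩ.sharpForm_injective ?_
  rw [hX, LinearMap.map_add, L.sharpForm_sec_mul, L.sharpForm_sec_mul, L.sharpForm_sec_mul, hparity,
    hX, LinearMap.map_add, LinearMap.map_smul, LieAlgebroid.interior_lieForm]
  abel

lemma bracket_algebraMap_algebraMap (f g : smoothFun 𝕜 m M) :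
    hΩ.bracket L (algebraMap _ _ f) (algebraMap _ _ g) = 0 := by
  rw [Algebra.algebraMap_eq_smul_one g, bracket_algebraMap_smul, bracket_one, smul_zero]

lemma bracket_algebraMap_sec (f : smoothFun 𝕜 m M) (Y : L.Sec) :
    hΩ.bracket L (algebraMap _ _ f) (L.sec Y) = -algebraMap _ _ ⁅Y, f⁆ := by
  rw [← mul_one (L.sec Y), bracket_algebraMap_sec_mul, bracket_one, mul_zero, sub_zero,
    ← Algebra.algebraMap_eq_smul_one]

lemma bracket_sec_algebraMap (X : L.Sec) (g : smoothFun 𝕜 m M) :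
    hΩ.bracket L (L.sec X) (algebraMap _ _ g) = algebraMap _ _ ⁅X, g⁆ := by
  rw [Algebra.algebraMap_eq_smul_one g, bracket_sec_smul, bracket_one, smul_zero, add_zero,
    ← Algebra.algebraMap_eq_smul_one]

lemma bracket_sec_sec (X Y : L.Sec) : hΩ.bracket L (L.sec X) (L.sec Y) = L.sec ⁅X, Y⁆ := by
  rw [← mul_one (L.sec Y), bracket_sec_sec_mul, bracket_one, mul_zero, add_zero, mul_one]

end IsVolume

end Bracket

section TwistedDerivation

variable {𝕜 : Type*} [RCLike 𝕜] {m : ℕ} {M : Type*} [TopologicalSpace M]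
  [ChartedSpace (EuclideanSpace ℝ (Fin m)) M]
  {V : M → Type*} [∀ x, AddCommGroup (V x)] [∀ x, Module 𝕜 (V x)]
  {Γ : Submodule (smoothFun 𝕜 m M) (∀ x, V x)}

/-- `B` is a derivation of the algebra of multivectors, twisted by the endomorphism `τ`. -/
def IsTwistedDerivation (τ : multivectors Γ →ₐ[smoothFun 𝕜 m M] multivectors Γ)
    (B : multivectors Γ →ₗ[𝕜] multivectors Γ) : Prop :=
  ∀ v w, B (v * w) = B v * w + τ v * B w

variable {τ : multivectors Γ →ₐ[smoothFun 𝕜 m M] multivectors Γ}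
  {B B' : multivectors Γ →ₗ[𝕜] multivectors Γ}

lemma IsTwistedDerivation.smul (hB : IsTwistedDerivation τ B) (f : smoothFun 𝕜 m M)
    (u : multivectors Γ) : B (f • u) = B (algebraMap _ _ f) * u + f • B u := by
  rw [Algebra.smul_def, hB, AlgHom.commutes, ← Algebra.smul_def]

variable {n : ℕ} [hΓ : LocallyFree Γ n]
include hΓ

lemma isTwistedDerivation_of_generators
    (algebraMap_mul : ∀ f w, B (algebraMap (smoothFun 𝕜 m M) _ f * w) =
      B (algebraMap (smoothFun 𝕜 m M) _ f) * w + f • B w)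
    (sec_mul : ∀ X w, B (sec X * w) = B (sec X) * w + τ (sec X) * B w) :
    IsTwistedDerivation τ B := by
  intro v
  induction v using multivectors_generator_induction with
  | algebraMap f => exact fun w => by rw [algebraMap_mul, AlgHom.commutes, ← Algebra.smul_def]
  | sec X => exact sec_mul X
  | add u v hu hv =>
    intro w
    rw [add_mul, LinearMap.map_add, LinearMap.map_add, hu, hv, map_add τ]
    noncomm_ring
  | mul u v hu hv =>
    intro w
    rw [mul_assoc, hu, hv, hu, map_mul τ]
    noncomm_ring
  | of_locally u h =>
    intro w
    refine Subtype.ext <| funext fun x => ?_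
    obtain ⟨f, hf, hu⟩ := h x
    have B_smul (z : multivectors Γ) :
        B (f • z) = B (algebraMap (smoothFun 𝕜 m M) _ f) * z + f • B z := by
      rw [Algebra.smul_def, algebraMap_mul]
    have hfu : f • B (u * w) = f • (B u * w + τ u * B w) := by
      have h := hu w
      rw [smul_mul_assoc, B_smul, B_smul, map_smul τ, add_mul, mul_assoc, add_assoc,
        add_right_inj, smul_mul_assoc, smul_mul_assoc, ← smul_add] at h
      exact h
    have hx := congrFun (congrArg Subtype.val hfu) x
    rwa [coe_smul_apply, coe_smul_apply, hf, one_smul, one_smul] at hx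

lemma IsTwistedDerivation.eq_of_generators (hB : IsTwistedDerivation τ B)
    (hB' : IsTwistedDerivation τ B')
    (algebraMap : ∀ f, B (algebraMap (smoothFun 𝕜 m M) _ f) = B' (algebraMap _ _ f))
    (sec : ∀ X, B (sec X) = B' (sec X)) : B = B' := by
  refine LinearMap.ext fun u => ?_
  induction u using multivectors_generator_induction with
  | algebraMap f => exact algebraMap f
  | sec X => exact sec X
  | add u v hu hv => rw [LinearMap.map_add, LinearMap.map_add, hu, hv]
  | mul u v hu hv => rw [hB, hB', hu, hv]
  | of_locally u h =>
    refine Subtype.ext <| funext fun x => ?_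
    obtain ⟨f, hf, hu⟩ := h x
    rw [hB.smul, hB'.smul, algebraMap, add_right_inj] at hu
    have hx := congrFun (congrArg Subtype.val hu) x
    rwa [coe_smul_apply, coe_smul_apply, hf, one_smul, one_smul] at hx

end TwistedDerivation

section BracketLeibniz

variable {𝕜 : Type*} [RCLike 𝕜] {m : ℕ} {M : Type*} [TopologicalSpace M]
  [ChartedSpace (EuclideanSpace ℝ (Fin m)) M]
  {V : M → Type*} [∀ x, AddCommGroup (V x)] [∀ x, Module 𝕜 (V x)]
  {Γ : Submodule (smoothFun 𝕜 m M) (∀ x, V x)} {u v : multivectors Γ} {k l : ℕ}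

lemma parity_sec (X : Γ) : parity (dualSections Γ) (fun _ => .id) (sec X) = (-1 : 𝕜) ^ 1 • sec X :=
  parity_of_hasDeg (hasDeg_sec X)

lemma parity_algebraMap (f : smoothFun 𝕜 m M) :
    parity (dualSections Γ) (fun _ => .id) (algebraMap _ _ f) =
      (-1 : 𝕜) ^ 0 • algebraMap _ _ f := by
  rw [AlgHom.commutes, pow_zero, one_smul]

lemma parity_pow_apply (hv : parity (dualSections Γ) (fun _ => .id) v = (-1 : 𝕜) ^ l • v) (k : ℕ) :
    (parity (dualSections Γ) (fun _ => .id) ^ k) v = (-1 : 𝕜) ^ (k * l) • v := by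
  induction k with
  | zero => rw [pow_zero, zero_mul, pow_zero, one_smul, AlgHom.one_apply]
  | succ k ih =>
    rw [pow_succ', AlgHom.mul_apply, ih, parity_smul, hv, smul_smul, ← pow_add, Nat.succ_mul]

variable {B : multivectors Γ →ₗ[𝕜] multivectors Γ}

lemma IsTwistedDerivation.map_mul
    (hB : IsTwistedDerivation (parity (dualSections Γ) (fun _ => .id) ^ k) B)
    (hv : parity (dualSections Γ) (fun _ => .id) v = (-1 : 𝕜) ^ l • v) (w : multivectors Γ) :
    B (v * w) = B v * w + (-1 : 𝕜) ^ (k * l) • (v * B w) := by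
  rw [hB, parity_pow_apply hv, smul_mul_assoc]

variable (L : LieAlgebroid Γ) {n : ℕ} [hΓ : LocallyFree Γ n]
include hΓ

lemma isTwistedDerivation_of_homogeneous
    (algebraMap_mul : ∀ f w, B (algebraMap (smoothFun 𝕜 m M) _ f * w) =
      B (algebraMap (smoothFun 𝕜 m M) _ f) * w +
        (-1 : 𝕜) ^ (k * 0) • (algebraMap (smoothFun 𝕜 m M) _ f * B w))
    (sec_mul : ∀ X w, B (sec X * w) = B (sec X) * w + (-1 : 𝕜) ^ (k * 1) • (sec X * B w)) :
    IsTwistedDerivation (parity (dualSections Γ) (fun _ => .id) ^ k) B := by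
  refine isTwistedDerivation_of_generators (fun f w => ?_) fun X w => ?_
  · rw [algebraMap_mul, mul_zero, pow_zero, one_smul, ← Algebra.smul_def]
  · rw [sec_mul, parity_pow_apply (parity_sec X), smul_mul_assoc]

namespace IsVolume

variable {Ω : forms Γ} (hΩ : IsVolume n Ω)
include hΩ

lemma isTwistedDerivation_bracket_algebraMap (f : smoothFun 𝕜 m M) :
    IsTwistedDerivation (parity (dualSections Γ) (fun _ => .id) ^ (0 + 1))
      (hΩ.bracket L (algebraMap _ _ f)) := by
  refine isTwistedDerivation_of_generators (fun g w => ?_) fun (X : L.Sec) w => ?_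
  · rw [← Algebra.smul_def, bracket_algebraMap_smul, bracket_algebraMap_algebraMap, zero_mul,
      zero_add]
  · change hΩ.bracket L _ (L.sec X * w) = hΩ.bracket L _ (L.sec X) * w +
      (parity (dualSections Γ) _ ^ (0 + 1)) (L.sec X) * hΩ.bracket L _ w
    rw [bracket_algebraMap_sec_mul, bracket_algebraMap_sec, zero_add, pow_one, L.parity_sec,
      neg_mul, neg_mul, ← Algebra.smul_def, sub_eq_add_neg]

lemma isTwistedDerivation_bracket_sec (X : L.Sec) :
    IsTwistedDerivation (parity (dualSections Γ) (fun _ => .id) ^ (1 + 1))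
      (hΩ.bracket L (L.sec X)) := by
  refine isTwistedDerivation_of_generators (fun g w => ?_) fun (Y : L.Sec) w => ?_
  · rw [← Algebra.smul_def, bracket_sec_smul, bracket_sec_algebraMap, Algebra.smul_def ⁅X, g⁆]
  · change hΩ.bracket L _ (L.sec Y * w) = hΩ.bracket L _ (L.sec Y) * w +
      (parity (dualSections Γ) _ ^ (1 + 1)) (L.sec Y) * hΩ.bracket L _ w
    rw [bracket_sec_sec_mul, bracket_sec_sec, pow_succ, pow_one, AlgHom.mul_apply, parity_parity]

lemma isTwistedDerivation_bracket
    (hu : parity (dualSections Γ) (fun _ => .id) u = (-1 : 𝕜) ^ k • u) :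
    IsTwistedDerivation (parity (dualSections Γ) (fun _ => .id) ^ (k + 1)) (hΩ.bracket L u) := by
  refine isTwistedDerivation_of_homogeneous (fun f w => ?_) fun X w => ?_
  · exact koszulBracket_leibniz_swap (fun hu hv => mul_comm_of_parity hu hv) (parity_algebraMap f)
      hu ((isTwistedDerivation_bracket_algebraMap L hΩ f).map_mul hu w)
  · exact koszulBracket_leibniz_swap (fun hu hv => mul_comm_of_parity hu hv) (parity_sec X) hu
      ((isTwistedDerivation_bracket_sec L hΩ X).map_mul hu w)

lemma bracket_skew (hu : parity (dualSections Γ) (fun _ => .id) u = (-1 : 𝕜) ^ k • u)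
    (hv : parity (dualSections Γ) (fun _ => .id) v = (-1 : 𝕜) ^ l • v) :
    hΩ.bracket L u v = -((-1 : 𝕜) ^ ((k + 1) * (l + 1)) • hΩ.bracket L v u) :=
  koszulBracket_skew (fun u => hΩ.parity_divergence L u) (fun hu hv => mul_comm_of_parity hu hv)
    hu hv

end IsVolume

end BracketLeibniz

section Schouten

open ExteriorAlgebra

variable {𝕜 : Type*} [RCLike 𝕜] {m : ℕ} {M : Type*} [TopologicalSpace M]
  [ChartedSpace (EuclideanSpace ℝ (Fin m)) M]
  {V : M → Type*} [∀ x, AddCommGroup (V x)] [∀ x, Module 𝕜 (V x)]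
  {Γ : Submodule (smoothFun 𝕜 m M) (∀ x, V x)} {L : LieAlgebroid Γ}
  {B B' : (∀ x, ExteriorAlgebra 𝕜 (V x)) → (∀ x, ExteriorAlgebra 𝕜 (V x)) →
    (∀ x, ExteriorAlgebra 𝕜 (V x))}
  {u v : multivectors Γ} {k l : ℕ}

lemma hasDeg_algebraMap (f : smoothFun 𝕜 m M) :
    HasDeg 0 (algebraMap (smoothFun 𝕜 m M) (multivectors Γ) f).1 := fun x => by
  rw [exteriorPower, pow_zero]
  exact Submodule.algebraMap_mem (f.1 x)

lemma coe_algebraMap (f : smoothFun 𝕜 m M) :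
    (algebraMap (smoothFun 𝕜 m M) (multivectors Γ) f).1 = ofFun f.1 := rfl

namespace IsSchouten

/-- A Schouten bracket, restricted to smooth multivectors. -/
def bilin (hB : IsSchouten L B) : multivectors Γ →ₗ[𝕜] multivectors Γ →ₗ[𝕜] multivectors Γ :=
  LinearMap.mk₂ 𝕜 (fun u v => ⟨B u.1 v.1, hB.smooth _ _ u.2 v.2⟩)
    (fun u u' v => Subtype.ext <| hB.add_left _ _ _ u.2 u'.2 v.2)
    (fun c u v => Subtype.ext <| hB.smul_left c _ _ u.2 v.2)
    (fun u v v' => Subtype.ext <| hB.add_right _ _ _ u.2 v.2 v'.2)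
    (fun c u v => Subtype.ext <| hB.smul_right c _ _ u.2 v.2)

lemma bilin_skew (hB : IsSchouten L B) (hu : HasDeg k u.1) (hv : HasDeg l v.1) :
    hB.bilin u v = -((-1 : 𝕜) ^ ((k + 1) * (l + 1)) • hB.bilin v u) :=
  Subtype.ext <| hB.skew k l _ _ u.2 v.2 hu hv

lemma bilin_apply_congr (hB : IsSchouten L B) (hB' : IsSchouten L B') (hu : HasDeg k u.1)
    (hv : HasDeg l v.1) (h : hB.bilin v = hB'.bilin v) : hB.bilin u v = hB'.bilin u v := by
  rw [hB.bilin_skew hu hv, hB'.bilin_skew hu hv, h]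

variable {n : ℕ} [hΓ : LocallyFree Γ n]
include hΓ

lemma isTwistedDerivation_bilin (hB : IsSchouten L B) (hu : HasDeg k u.1) :
    IsTwistedDerivation (parity (dualSections Γ) (fun _ => .id) ^ (k + 1)) (hB.bilin u) := by
  intro v w
  induction v using multivectors_induction with
  | add v v' hv hv' =>
    rw [add_mul, LinearMap.map_add, LinearMap.map_add, hv, hv', map_add (_ ^ (k + 1))]
    noncomm_ring
  | mem l v hv =>
    rw [parity_pow_apply (parity_of_hasDeg hv), smul_mul_assoc]
    exact Subtype.ext <| hB.leibniz k l _ _ _ u.2 v.2 w.2 hu hv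

lemma bilin_eq (hB : IsSchouten L B) (hB' : IsSchouten L B') : hB.bilin = hB'.bilin := by
  have eq_of_generators {k : ℕ} {u : multivectors Γ} (hu : HasDeg k u.1) :=
    (hB.isTwistedDerivation_bilin hu).eq_of_generators (hB'.isTwistedDerivation_bilin hu)
  have eq_sec (X : Γ) : hB.bilin (sec X) = hB'.bilin (sec X) :=
    eq_of_generators (hasDeg_sec X)
      (fun f => Subtype.ext <| (hB.sec_fun X f.1 f.2).trans (hB'.sec_fun X f.1 f.2).symm)
      (fun Y => Subtype.ext <| (hB.sec_sec X Y).trans (hB'.sec_sec X Y).symm)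
  have eq_algebraMap (f : smoothFun 𝕜 m M) :
      hB.bilin (algebraMap _ _ f) = hB'.bilin (algebraMap _ _ f) :=
    eq_of_generators (hasDeg_algebraMap f)
      (fun g => Subtype.ext <| (hB.fun_fun _ f.2 _ g.2).trans (hB'.fun_fun _ f.2 _ g.2).symm)
      (fun X => hB.bilin_apply_congr hB' (hasDeg_algebraMap f) (hasDeg_sec X) (eq_sec X))
  refine LinearMap.ext fun u => ?_
  induction u using multivectors_induction with
  | add u v hu hv => rw [LinearMap.map_add, LinearMap.map_add, hu, hv]
  | mem k u hu =>
    exact eq_of_generators hu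
      (fun f => hB.bilin_apply_congr hB' hu (hasDeg_algebraMap f) (eq_algebraMap f))
      (fun X => hB.bilin_apply_congr hB' hu (hasDeg_sec X) (eq_sec X))

end IsSchouten

variable {n : ℕ} [hΓ : LocallyFree Γ n]
include hΓ

namespace IsVolume

variable {Ω : forms Γ} (hΩ : IsVolume n Ω) (L)
include hΩ

lemma isSchouten (hB : ∀ u v : multivectors Γ, B u.1 v.1 = (hΩ.bracket L u v).1) :
    IsSchouten L B where
  smooth u v hu hv := hB ⟨u, hu⟩ ⟨v, hv⟩ ▸ (hΩ.bracket L ⟨u, hu⟩ ⟨v, hv⟩).2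
  add_left u u' v hu hu' hv := (hB (⟨u, hu⟩ + ⟨u', hu'⟩) ⟨v, hv⟩).trans <|
    (congrArg Subtype.val (LinearMap.map_add₂ _ _ _ _)).trans <|
      congrArg₂ (· + ·) (hB ⟨u, hu⟩ ⟨v, hv⟩).symm (hB ⟨u', hu'⟩ ⟨v, hv⟩).symm
  add_right u v v' hu hv hv' := (hB ⟨u, hu⟩ (⟨v, hv⟩ + ⟨v', hv'⟩)).trans <|
    (congrArg Subtype.val (LinearMap.map_add _ _ _)).trans <|
      congrArg₂ (· + ·) (hB ⟨u, hu⟩ ⟨v, hv⟩).symm (hB ⟨u, hu⟩ ⟨v', hv'⟩).symm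
  smul_left c u v hu hv := (hB (c • ⟨u, hu⟩) ⟨v, hv⟩).trans <|
    (congrArg Subtype.val (LinearMap.map_smul₂ _ _ _ _)).trans <|
      congrArg (c • ·) (hB ⟨u, hu⟩ ⟨v, hv⟩).symm
  smul_right c u v hu hv := (hB ⟨u, hu⟩ (c • ⟨v, hv⟩)).trans <|
    (congrArg Subtype.val (LinearMap.map_smul _ _ _)).trans <|
      congrArg (c • ·) (hB ⟨u, hu⟩ ⟨v, hv⟩).symm
  fun_fun f hf g hg := by
    have h := hB (algebraMap (smoothFun 𝕜 m M) _ ⟨f, hf⟩) (algebraMap (smoothFun 𝕜 m M) _ ⟨g, hg⟩)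
    rwa [hΩ.bracket_algebraMap_algebraMap L, coe_algebraMap, coe_algebraMap] at h
  sec_fun (X : L.Sec) f hf := by
    have h := hB (L.sec X) (algebraMap (smoothFun 𝕜 m M) _ ⟨f, hf⟩)
    rwa [hΩ.bracket_sec_algebraMap L, coe_algebraMap, coe_algebraMap] at h
  sec_sec X Y := (hB (L.sec X) (L.sec Y)).trans <|
    congrArg Subtype.val (hΩ.bracket_sec_sec L X Y)
  skew k l u v hu hv hk hl := by
    rw [hB ⟨u, hu⟩ ⟨v, hv⟩, hB ⟨v, hv⟩ ⟨u, hu⟩]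
    exact congrArg Subtype.val (hΩ.bracket_skew L (parity_of_hasDeg hk) (parity_of_hasDeg hl))
  leibniz k l u v w hu hv hw hk hl := by
    rw [hB ⟨u, hu⟩ ⟨v, hv⟩, hB ⟨u, hu⟩ ⟨w, hw⟩]
    exact (hB ⟨u, hu⟩ (⟨v, hv⟩ * ⟨w, hw⟩)).trans <| congrArg Subtype.val <|
      (isTwistedDerivation_bracket L hΩ (parity_of_hasDeg hk)).map_mul (parity_of_hasDeg hl) _

open Classical in
lemma exists_isSchouten : ∃ B : (∀ x, ExteriorAlgebra 𝕜 (V x)) → (∀ x, ExteriorAlgebra 𝕜 (V x)) →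
    (∀ x, ExteriorAlgebra 𝕜 (V x)), IsSchouten L B ∧
      ∀ u v : multivectors Γ, B u.1 v.1 = (hΩ.bracket L u v).1 := by
  let B := fun u v => if h : IsMultivector Γ u ∧ IsMultivector Γ v then
    (hΩ.bracket L ⟨u, h.1⟩ ⟨v, h.2⟩).1 else 0
  have hB (u v : multivectors Γ) : B u.1 v.1 = (hΩ.bracket L u v).1 := dif_pos ⟨u.2, v.2⟩
  exact ⟨B, hΩ.isSchouten L hB, hB⟩

lemma schouten_coe (u v : multivectors Γ) : schouten L u.1 v.1 = (hΩ.bracket L u v).1 := by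
  obtain ⟨B, hB, hB_coe⟩ := hΩ.exists_isSchouten L
  have hex : ∃ B, IsSchouten L B := ⟨B, hB⟩
  rw [schouten, dif_pos hex, ← hB_coe]
  exact congrArg Subtype.val <| LinearMap.congr_fun₂ (hex.choose_spec.bilin_eq hB) u v

end IsVolume

end Schouten

section Derivation

variable {𝕜 : Type*} [RCLike 𝕜] {m : ℕ} {M : Type*} [TopologicalSpace M]
  [ChartedSpace (EuclideanSpace ℝ (Fin m)) M]
  {V : M → Type*} [∀ x, AddCommGroup (V x)] [∀ x, Module 𝕜 (V x)]
  {Γ : Submodule (smoothFun 𝕜 m M) (∀ x, V x)} {L : LieAlgebroid Γ}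
  {D : (∀ x, ExteriorAlgebra 𝕜 (V x)) → (∀ x, ExteriorAlgebra 𝕜 (V x))}

namespace IsGerstenhaberDerivation

/-- A derivation of the Gerstenhaber algebra, restricted to smooth multivectors. -/
def linear {p : ℕ} (hD : IsGerstenhaberDerivation L p D) : multivectors Γ →ₗ[𝕜] multivectors Γ where
  toFun u := ⟨D u.1, hD.smooth _ u.2⟩
  map_add' u v := Subtype.ext <| hD.add _ _ u.2 v.2
  map_smul' c u := Subtype.ext <| hD.smul c _ u.2

variable (hD : IsGerstenhaberDerivation L 1 D) {n : ℕ} [hΓ : LocallyFree Γ n]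
include hΓ

lemma parity_linear (u : multivectors Γ) :
    parity (dualSections Γ) _ (hD.linear u) = -hD.linear (parity (dualSections Γ) _ u) := by
  induction u using multivectors_induction with
  | add u v hu hv =>
    rw [LinearMap.map_add, map_add (parity (dualSections Γ) _), hu, hv,
      map_add (parity (dualSections Γ) _), LinearMap.map_add, neg_add]
  | mem k u hu =>
    have hDu : HasDeg (k + 1) (hD.linear u).1 := hD.deg k _ u.2 hu
    rw [parity_of_hasDeg hDu, parity_of_hasDeg hu, LinearMap.map_smul, pow_succ, mul_neg_one,
      neg_smul]

lemma linear_mul (u v : multivectors Γ) :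
    hD.linear (u * v) = hD.linear u * v + parity (dualSections Γ) _ u * hD.linear v := by
  induction u using multivectors_induction with
  | add u u' hu hu' =>
    rw [add_mul, LinearMap.map_add, LinearMap.map_add, hu, hu', map_add (parity (dualSections Γ) _)]
    noncomm_ring
  | mem k u hu =>
    rw [parity_of_hasDeg hu, smul_mul_assoc, ← one_mul k]
    exact Subtype.ext <| hD.wedge k _ _ u.2 v.2 hu

lemma linear_bracket {Ω : forms Γ} (hΩ : IsVolume n Ω) (u v : multivectors Γ) :
    hD.linear (hΩ.bracket L u v) = hΩ.bracket L (hD.linear u) v -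
      hΩ.bracket L (parity (dualSections Γ) _ u) (hD.linear v) := by
  induction u using multivectors_induction with
  | add u u' hu hu' =>
    rw [LinearMap.map_add₂, LinearMap.map_add, LinearMap.map_add, hu, hu', LinearMap.map_add₂,
      map_add (parity (dualSections Γ) _), LinearMap.map_add₂]
    abel
  | mem k u hu =>
    have h := hD.bracket k _ _ u.2 v.2 hu
    rw [hΩ.schouten_coe L] at h
    rw [parity_of_hasDeg hu, LinearMap.map_smul₂, sub_eq_add_neg, ← neg_smul, ← mul_neg_one,
      ← pow_succ, ← one_mul (k + 1)]
    refine Subtype.ext <| h.trans <| congrArg₂ (· + ·) (hΩ.schouten_coe L (hD.linear u) v)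
      (congrArg _ (hΩ.schouten_coe L u (hD.linear v)))

end IsGerstenhaberDerivation

namespace IsVolume

variable {n : ℕ} [hΓ : LocallyFree Γ n] {Ω : forms Γ} (hΩ : IsVolume n Ω)
  {L' : LieAlgebroid (dualSections Γ)} (hbi : IsLieBialgebroid L L')
include hΩ

lemma laplacian_coe (u : multivectors Γ) : laplacian L L' Ω.1 u.1 =
    (hbi.linear (hΩ.divergence L u) + hΩ.divergence L (hbi.linear u)).1 :=
  congrArg₂ (· + ·) (congrArg (dStar L') (hΩ.del_coe L u)) (hΩ.del_coe L (hbi.linear u))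

include hbi

lemma laplacian_add_coe (u v : multivectors Γ) :
    laplacian L L' Ω.1 (u.1 + v.1) = laplacian L L' Ω.1 u.1 + laplacian L L' Ω.1 v.1 := by
  have h := hΩ.laplacian_coe hbi (u + v)
  rw [LinearMap.map_add, LinearMap.map_add, LinearMap.map_add, LinearMap.map_add,
    add_add_add_comm] at h
  rw [hΩ.laplacian_coe hbi u, hΩ.laplacian_coe hbi v]
  exact h

lemma laplacian_smul_coe (c : 𝕜) (u : multivectors Γ) :
    laplacian L L' Ω.1 (c • u.1) = c • laplacian L L' Ω.1 u.1 := by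
  have h := hΩ.laplacian_coe hbi (c • u)
  rw [LinearMap.map_smul, LinearMap.map_smul, LinearMap.map_smul, LinearMap.map_smul,
    ← smul_add] at h
  rw [hΩ.laplacian_coe hbi u]
  exact h

lemma laplacian_mul_coe (u v : multivectors Γ) :
    laplacian L L' Ω.1 (u.1 * v.1) =
      laplacian L L' Ω.1 u.1 * v.1 + u.1 * laplacian L L' Ω.1 v.1 := by
  rw [hΩ.laplacian_coe hbi u, hΩ.laplacian_coe hbi v]
  exact (hΩ.laplacian_coe hbi (u * v)).trans <| congrArg Subtype.val <|
    laplacian_mul (σ := (parity (dualSections Γ) fun _ => .id).restrictScalars 𝕜)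
      (fun u => hΩ.parity_divergence L u) (fun u => hbi.parity_linear u) (fun u => parity_parity u)
      (fun u v => hbi.linear_mul u v) (fun u v => hbi.linear_bracket hΩ u v) u v

lemma laplacian_schouten_coe (u v : multivectors Γ) :
    laplacian L L' Ω.1 (schouten L u.1 v.1) =
      schouten L (laplacian L L' Ω.1 u.1) v.1 + schouten L u.1 (laplacian L L' Ω.1 v.1) := by
  rw [hΩ.laplacian_coe hbi u, hΩ.laplacian_coe hbi v, hΩ.schouten_coe, hΩ.schouten_coe,
    hΩ.schouten_coe, hΩ.laplacian_coe hbi]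
  exact congrArg Subtype.val <|
    laplacian_koszulBracket (σ := (parity (dualSections Γ) fun _ => .id).restrictScalars 𝕜)
      (fun u => hΩ.parity_divergence L u) (fun u => hbi.parity_linear u) (fun u => parity_parity u)
      (fun u v => hbi.linear_mul u v) (fun u v => hbi.linear_bracket hΩ u v)
      (fun u => hΩ.divergence_divergence L u) u v

lemma hasDeg_laplacian {k : ℕ} {u : multivectors Γ} (hu : HasDeg k u.1) :
    HasDeg k (laplacian L L' Ω.1 u.1) := by
  have hdiv_linear : HasDeg k (hΩ.divergence L (hbi.linear u)).1 :=
    hΩ.hasDeg_divergence L (hbi.deg k _ u.2 hu)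
  have hlinear_div : HasDeg k (hbi.linear (hΩ.divergence L u)).1 := by
    cases k with
    | zero =>
      obtain ⟨f, rfl⟩ := exists_algebraMap_eq_of_hasDeg_zero hu
      rw [hΩ.divergence_algebraMap L f, LinearMap.map_zero]
      exact fun _ => zero_mem _
    | succ k => exact hbi.deg k _ (Subtype.prop _) (hΩ.hasDeg_divergence L hu)
  rw [hΩ.laplacian_coe hbi u]
  exact fun x => add_mem (hlinear_div x) (hdiv_linear x)

lemma isGerstenhaberDerivation_laplacian :
    IsGerstenhaberDerivation L 0 (laplacian L L' Ω.1) where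
  smooth u hu := hΩ.laplacian_coe hbi ⟨u, hu⟩ ▸ Subtype.prop _
  deg _ u hu hk := hΩ.hasDeg_laplacian hbi (u := ⟨u, hu⟩) hk
  add u v hu hv := hΩ.laplacian_add_coe hbi ⟨u, hu⟩ ⟨v, hv⟩
  smul c u hu := hΩ.laplacian_smul_coe hbi c ⟨u, hu⟩
  wedge k u v hu hv _ := by
    rw [zero_mul, pow_zero, one_smul]
    exact hΩ.laplacian_mul_coe hbi ⟨u, hu⟩ ⟨v, hv⟩
  bracket k u v hu hv _ := by
    rw [zero_mul, pow_zero, one_smul]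
    exact hΩ.laplacian_schouten_coe hbi ⟨u, hu⟩ ⟨v, hv⟩

end IsVolume

end Derivation

end LieBialg

end

theorem corollary2p6_general {𝕜 : Type*} [RCLike 𝕜] {m : ℕ} {M : Type*} [TopologicalSpace M]
    [ChartedSpace (EuclideanSpace ℝ (Fin m)) M]
    {V : M → Type*} [∀ x, AddCommGroup (V x)] [∀ x, Module 𝕜 (V x)]
    {Γ : Submodule (LieBialg.smoothFun 𝕜 m M) (∀ x, V x)} {n : ℕ} [LieBialg.LocallyFree Γ n]
    (L : LieBialg.LieAlgebroid Γ) (L' : LieBialg.LieAlgebroid (LieBialg.dualSections Γ))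
    (Ω : ∀ x, ExteriorAlgebra 𝕜 (Module.Dual 𝕜 (V x))) (hΩ : LieBialg.IsForm Γ Ω)
    (hΩ_deg : LieBialg.HasDeg n Ω) (hΩ_ne : ∀ x, Ω x ≠ 0) (hbi : LieBialg.IsLieBialgebroid L L') :
    LieBialg.IsGerstenhaberDerivation L 0 (LieBialg.laplacian L L' Ω) ∧
    (∀ u v : (∀ x, ExteriorAlgebra 𝕜 (V x)),
      LieBialg.IsMultivector Γ u → LieBialg.IsMultivector Γ v →
      LieBialg.laplacian L L' Ω (u * v) =
        LieBialg.laplacian L L' Ω u * v + u * LieBialg.laplacian L L' Ω v) ∧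
    (∀ u v : (∀ x, ExteriorAlgebra 𝕜 (V x)),
      LieBialg.IsMultivector Γ u → LieBialg.IsMultivector Γ v →
      LieBialg.laplacian L L' Ω (LieBialg.schouten L u v) =
        LieBialg.schouten L (LieBialg.laplacian L L' Ω u) v +
          LieBialg.schouten L u (LieBialg.laplacian L L' Ω v)) := by
  have hvol : LieBialg.IsVolume n (⟨Ω, hΩ⟩ : LieBialg.forms Γ) := ⟨hΩ_deg, hΩ_ne⟩
  exact ⟨hvol.isGerstenhaberDerivation_laplacian hbi,
    fun u v hu hv => hvol.laplacian_mul_coe hbi ⟨u, hu⟩ ⟨v, hv⟩,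
    fun u v hu hv => hvol.laplacian_schouten_coe hbi ⟨u, hu⟩ ⟨v, hv⟩⟩

theorem corollary2p6 {𝕜 : Type*} [RCLike 𝕜] {m : ℕ}
    {M : Type*} [TopologicalSpace M] [T2Space M] [SecondCountableTopology M]
    [ChartedSpace (EuclideanSpace ℝ (Fin m)) M] [IsManifold (𝓡 m) ∞ M]
    {F : Type*} [NormedAddCommGroup F] [NormedSpace ℝ F] [NormedSpace 𝕜 F] [IsScalarTower ℝ 𝕜 F]
    [FiniteDimensional 𝕜 F]
    (A : M → Type*) [TopologicalSpace (Bundle.TotalSpace F A)]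
    [∀ x, AddCommGroup (A x)] [∀ x, Module ℝ (A x)] [∀ x, Module 𝕜 (A x)]
    [∀ x, IsScalarTower ℝ 𝕜 (A x)]
    [∀ x, TopologicalSpace (A x)] [FiberBundle F A]
    [VectorBundle ℝ F A] [VectorBundle 𝕜 F A]
    [ContMDiffVectorBundle ∞ F A (𝓡 m)]
    (L : LieBialg.LieAlgebroid (LieBialg.sections 𝕜 m F A))
    (L' : LieBialg.LieAlgebroid (LieBialg.dualSections (LieBialg.sections 𝕜 m F A)))
    (Ω : ∀ x, ExteriorAlgebra 𝕜 (Module.Dual 𝕜 (A x)))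
    (hΩ : LieBialg.IsForm (LieBialg.sections 𝕜 m F A) Ω)
    (hΩ_deg : LieBialg.HasDeg (Module.finrank 𝕜 F) Ω) (hΩ_ne : ∀ x, Ω x ≠ 0)
    (hbi : LieBialg.IsLieBialgebroid L L') :
    LieBialg.IsGerstenhaberDerivation L 0 (LieBialg.laplacian L L' Ω) ∧
    (∀ u v : (∀ x, ExteriorAlgebra 𝕜 (A x)),
      LieBialg.IsMultivector (LieBialg.sections 𝕜 m F A) u →
      LieBialg.IsMultivector (LieBialg.sections 𝕜 m F A) v →
      LieBialg.laplacian L L' Ω (u * v) =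
        LieBialg.laplacian L L' Ω u * v + u * LieBialg.laplacian L L' Ω v) ∧
    (∀ u v : (∀ x, ExteriorAlgebra 𝕜 (A x)),
      LieBialg.IsMultivector (LieBialg.sections 𝕜 m F A) u →
      LieBialg.IsMultivector (LieBialg.sections 𝕜 m F A) v →
      LieBialg.laplacian L L' Ω (LieBialg.schouten L u v) =
        LieBialg.schouten L (LieBialg.laplacian L L' Ω u) v +
          LieBialg.schouten L u (LieBialg.laplacian L L' Ω v)) :=
  corollary2p6_general L L' Ω hΩ hΩ_deg hΩ_ne hbi
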